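/- Let $n\ge 3$ and let $\Omega\subset\mathbb R^n$ be a bounded domain with smooth boundary and outward unit normal $\nu$. Write $B_r^+(x_0)=B_r(x_0)\cap\Omega$, $\Gamma_r(x_0)=\partial\Omega\cap B_r(x_0)$. Let $\{g_\epsilon\}_{0<\epsilon\le1}\subset C^2(\partial\Omega,\mathbb S^1)$ satisfy condition (G) with constant $C_0>0$, that is, $\|g_\epsilon\|_{C^2(\partial\Omega)}\le C_0$ for all $\epsilon\in(0,1]$. For $\epsilon\in(0,1]$ let $\lambda_\epsilon=K\epsilon^{-\alpha}$ with $K>0$, $\alpha\in[0,1)$, and consider $$\Delta u_\epsilon+\tfrac1{\epsilon^2}(1-|u_\epsilon|^2)u_\epsilon=0\ \text{ in }\Omega,\qquad \frac{\partial u_\epsilon}{\partial\nu}+\lambda_\epsilon(u_\epsilon-g_\epsilon)=0\ \text{ on }\partial\Omega. \tag{1}$$ Define $$\widehat F_\epsilon^+(u_\epsilon;x_0,r)=\int_{B_r^+(x_0)}\Big(\frac{|\nabla u_\epsilon|^2}{2}+\frac{n}{n-2}\,\frac{(1-|u_\epsilon|^2)^2}{4\epsilon^2}\Big)dx+\int_{\Gamma_r(x_0)}\frac{n-1}{n-2}\,\frac{\lambda_\epsilon|u_\epsilon-g_\epsilon|^2}{2}\,dH^{n-1},$$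 $\widehat\Phi_\epsilon^+(u_\epsilon;x_0,r)=r^{2-n}\widehat F_\epsilon^+(u_\epsilon;x_0,r)$, and, for $A\subset\Omega$ and $\Gamma\subset\partial\Omega$, $$I_\epsilon(A,\Gamma)=\int_{A}|x-x_0|^{2-n}\Big(\Big|\frac{\partial u_\epsilon}{\partial|x-x_0|}\Big|^2+\frac{(1-|u_\epsilon|^2)^2}{2(n-2)\epsilon^2}\Big)dx+\int_{\Gamma}|x-x_0|^{2-n}\frac{\lambda_\epsilon|u_\epsilon-g_\epsilon|^2}{2(n-2)}\,dH^{n-1}.$$ **Theorem 2.4 (with Corollary 2.5).** There is $r_0\in(0,1)$ depending only on $\Omega$, and there are constants $C_3,C_4>0$ depending only on $\Omega$ and $C_0$, such that if $0<\epsilon\le1$ and $u_\epsilon\in C^2(\overline\Omega,\mathbb R^2)$ solves (1), then for every $x_0\in\partial\Omega$ and all $0<r\le R\le r_0$, with $I=I_\epsilon\big(B_R^+(x_0)\setminus B_r^+(x_0),\,\Gamma_R(x_0)\setminus\Gamma_r(x_0)\big)$, $$e^{-C_3R}\widehat\Phi_\epsilon^+(u_\epsilon;x_0,R)-e^{-C_3r}\widehat\Phi_\epsilon^+(u_\epsilon;x_0,r)\le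 2I+C_3(R-r),$$ $$e^{C_3R}\widehat\Phi_\epsilon^+(u_\epsilon;x_0,R)-e^{C_3r}\widehat\Phi_\epsilon^+(u_\epsilon;x_0,r)+C_3(R-r)\ge\tfrac12 I .$$ Moreover, for every $x_0\in\partial\Omega$ and $0<R\le r_0$, $$I_\epsilon\big(B_R^+(x_0),\Gamma_R(x_0)\big)\le e^{C_4R}\,\widehat\Phi_\epsilon^+(u_\epsilon;x_0,R)+C_4R .$$ -/

import Mathlib

open MeasureTheory Set Metric Filter Topology
open scoped InnerProductSpace Laplacian ContDiff

noncomputable section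

namespace WeakAnchoring

/-- The component of `v` orthogonal to the unit vector `ν`. -/
def tangentialPart {n : ℕ} (ν v : EuclideanSpace ℝ (Fin n)) : EuclideanSpace ℝ (Fin n) :=
  v - ⟪v, ν⟫_ℝ • ν

/-- Near `p`, the set `Ω` is the region below the graph of the smooth function `φ` over the
hyperplane through `p` orthogonal to the unit vector `ν`, and this hyperplane is tangent to the
graph at `p`. So `ν` is the outward unit normal of `Ω` at `p`, and only the values of `φ` on the
orthogonal complement of `ν` near `0` matter. -/
structure IsBoundaryGraph {n : ℕ} (Ω : Set (EuclideanSpace ℝ (Fin n)))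
    (p ν : EuclideanSpace ℝ (Fin n)) (φ : EuclideanSpace ℝ (Fin n) → ℝ) : Prop where
  norm_normal : ‖ν‖ = 1
  smooth : ContDiff ℝ ∞ φ
  map_zero : φ 0 = 0
  fderiv_zero : fderiv ℝ φ 0 = 0
  mem_iff : ∀ᶠ y in 𝓝 (0 : EuclideanSpace ℝ (Fin n)),
    p + y ∈ Ω ↔ ⟪y, ν⟫_ℝ < φ (tangentialPart ν y)

/-- `ν` is the outward unit normal of `Ω` at the boundary point `p`. -/
def IsOutwardNormal {n : ℕ} (Ω : Set (EuclideanSpace ℝ (Fin n)))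
    (p ν : EuclideanSpace ℝ (Fin n)) : Prop :=
  ∃ φ : EuclideanSpace ℝ (Fin n) → ℝ, IsBoundaryGraph Ω p ν φ

/-- Bounded domains (nonempty, open, connected) with smooth boundary. -/
structure IsBoundedSmoothDomain {n : ℕ} (Ω : Set (EuclideanSpace ℝ (Fin n))) : Prop where
  isOpen : IsOpen Ω
  isConnected : IsConnected Ω
  isBounded : Bornology.IsBounded Ω
  smooth_boundary : ∀ p ∈ frontier Ω, ∃ ν, IsOutwardNormal Ω p ν

/-- The graph parametrization of the boundary near `p` over the tangent hyperplane at `p`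
(extended to be constant in the direction `ν`). -/
def boundaryChart {n : ℕ} (p ν : EuclideanSpace ℝ (Fin n)) (φ : EuclideanSpace ℝ (Fin n) → ℝ)
    (v : EuclideanSpace ℝ (Fin n)) : EuclideanSpace ℝ (Fin n) :=
  p + tangentialPart ν v + φ (tangentialPart ν v) • ν

/-- `g` is of class `C²` on the boundary of `Ω` and `|g| + |∇g| + |∇²g| ≤ C` on the boundary.
The gradient and the Hessian of `g` along the boundary at `p` are the first two derivatives at `0`
of `g` in the graph parametrization over the tangent hyperplane at `p`; since the Christoffel
symbols of this parametrization vanish at `0`, they are the covariant ones. Only the values of `g`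
on the boundary enter. -/
def HasBoundaryC2Bound {n : ℕ} (Ω : Set (EuclideanSpace ℝ (Fin n)))
    (g : EuclideanSpace ℝ (Fin n) → EuclideanSpace ℝ (Fin 2)) (C : ℝ) : Prop :=
  ∀ p ∈ frontier Ω, ∀ (ν : EuclideanSpace ℝ (Fin n)) (φ : EuclideanSpace ℝ (Fin n) → ℝ),
    IsBoundaryGraph Ω p ν φ →
      ContDiffAt ℝ 2 (g ∘ boundaryChart p ν φ) 0 ∧
      ‖g p‖ + ‖fderiv ℝ (g ∘ boundaryChart p ν φ) 0‖
        + ‖iteratedFDeriv ℝ 2 (g ∘ boundaryChart p ν φ) 0‖ ≤ C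

/-- The condition (G) with constant `C₀`: the maps `g ε`, `0 < ε ≤ 1`, belong to `C²(∂Ω, 𝕊¹)` and
their `C²` norms are bounded by `C₀`, uniformly in `ε`. -/
def ConditionG {n : ℕ} (Ω : Set (EuclideanSpace ℝ (Fin n)))
    (g : ℝ → EuclideanSpace ℝ (Fin n) → EuclideanSpace ℝ (Fin 2)) (C₀ : ℝ) : Prop :=
  ∀ ε : ℝ, 0 < ε → ε ≤ 1 →
    (∀ p ∈ frontier Ω, ‖g ε p‖ = 1) ∧ HasBoundaryC2Bound Ω (g ε) C₀

/-- `u ∈ C²(closure Ω, ℝ²)` solves the Ginzburg-Landau equation in `Ω` with the weak anchoring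
boundary condition with data `g` and anchoring strength `lam`. -/
structure IsSolution {n : ℕ} (Ω : Set (EuclideanSpace ℝ (Fin n))) (ε lam : ℝ)
    (g u : EuclideanSpace ℝ (Fin n) → EuclideanSpace ℝ (Fin 2)) : Prop where
  contDiffOn : ContDiffOn ℝ 2 u (closure Ω)
  equation : ∀ x ∈ Ω, (Δ u) x + (1 / ε ^ 2 * (1 - ‖u x‖ ^ 2)) • u x = 0
  boundary : ∀ p ∈ frontier Ω, ∀ ν, IsOutwardNormal Ω p ν →
    fderivWithin ℝ u (closure Ω) p ν + lam • (u p - g p) = 0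

/-- `B_r⁺(x₀) = B_r(x₀) ∩ Ω`. -/
def ballPlus {n : ℕ} (Ω : Set (EuclideanSpace ℝ (Fin n))) (x₀ : EuclideanSpace ℝ (Fin n))
    (r : ℝ) : Set (EuclideanSpace ℝ (Fin n)) :=
  ball x₀ r ∩ Ω

/-- `Γ_r(x₀) = ∂Ω ∩ B_r(x₀)`. -/
def bdryPart {n : ℕ} (Ω : Set (EuclideanSpace ℝ (Fin n))) (x₀ : EuclideanSpace ℝ (Fin n))
    (r : ℝ) : Set (EuclideanSpace ℝ (Fin n)) :=
  frontier Ω ∩ ball x₀ r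

/-- `|∇u|²`, the sum of the squares of all partial derivatives of all components. -/
def gradSq {n : ℕ} (u : EuclideanSpace ℝ (Fin n) → EuclideanSpace ℝ (Fin 2))
    (x : EuclideanSpace ℝ (Fin n)) : ℝ :=
  ∑ i : Fin n, ‖fderiv ℝ u x (EuclideanSpace.single i (1 : ℝ))‖ ^ 2

/-- The radial derivative `∂u/∂|x - x₀|`. -/
def radialDeriv {n : ℕ} (u : EuclideanSpace ℝ (Fin n) → EuclideanSpace ℝ (Fin 2))
    (x₀ x : EuclideanSpace ℝ (Fin n)) : EuclideanSpace ℝ (Fin 2) :=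
  fderiv ℝ u x (‖x - x₀‖⁻¹ • (x - x₀))

/-- The modified energy density: the potential `(1 - |u|²)² / (4ε²)` of the Ginzburg-Landau energy
density carries the weight `n / (n - 2)`. -/
def modifiedDensity {n : ℕ} (ε : ℝ) (u : EuclideanSpace ℝ (Fin n) → EuclideanSpace ℝ (Fin 2))
    (x : EuclideanSpace ℝ (Fin n)) : ℝ :=
  gradSq u x / 2 + (n : ℝ) / ((n : ℝ) - 2) * ((1 - ‖u x‖ ^ 2) ^ 2 / (4 * ε ^ 2))

/-- The modified energy on `B_r⁺(x₀)`: the boundary term `lam / 2 * |u - g|²` carries the weight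
`(n - 1) / (n - 2)`. Here `μHE[n - 1]` is the surface measure on the boundary, that is the Hausdorff
measure normalized so that it is Lebesgue measure on Euclidean space of dimension `n - 1`. -/
def modifiedEnergy {n : ℕ} (Ω : Set (EuclideanSpace ℝ (Fin n))) (ε lam : ℝ)
    (g u : EuclideanSpace ℝ (Fin n) → EuclideanSpace ℝ (Fin 2))
    (x₀ : EuclideanSpace ℝ (Fin n)) (r : ℝ) : ℝ :=
  (∫ x in ballPlus Ω x₀ r, modifiedDensity ε u x)
    + ∫ x in bdryPart Ω x₀ r,
        ((n : ℝ) - 1) / ((n : ℝ) - 2) * (lam / 2 * ‖u x - g x‖ ^ 2) ∂μHE[n - 1]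

/-- The modified renormalized energy `r^(2 - n)` times the modified energy. -/
def modifiedPhi {n : ℕ} (Ω : Set (EuclideanSpace ℝ (Fin n))) (ε lam : ℝ)
    (g u : EuclideanSpace ℝ (Fin n) → EuclideanSpace ℝ (Fin 2))
    (x₀ : EuclideanSpace ℝ (Fin n)) (r : ℝ) : ℝ :=
  r ^ (2 - (n : ℤ)) * modifiedEnergy Ω ε lam g u x₀ r

/-- The integral over `A ⊆ Ω` of
`|x - x₀|^(2 - n) (|∂u/∂|x - x₀||² + (1 - |u|²)² / (2 (n - 2) ε²))`. -/
def weightedBulk {n : ℕ} (ε : ℝ) (u : EuclideanSpace ℝ (Fin n) → EuclideanSpace ℝ (Fin 2))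
    (x₀ : EuclideanSpace ℝ (Fin n)) (A : Set (EuclideanSpace ℝ (Fin n))) : ℝ :=
  ∫ x in A, ‖x - x₀‖ ^ (2 - (n : ℤ)) *
    (‖radialDeriv u x₀ x‖ ^ 2 + (1 - ‖u x‖ ^ 2) ^ 2 / (2 * ((n : ℝ) - 2) * ε ^ 2))

/-- The surface integral over `A ⊆ ∂Ω` of `|x - x₀|^(2 - n) lam |u - g|² / (2 (n - 2))`. -/
def weightedBdry {n : ℕ} (lam : ℝ) (g u : EuclideanSpace ℝ (Fin n) → EuclideanSpace ℝ (Fin 2))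
    (x₀ : EuclideanSpace ℝ (Fin n)) (A : Set (EuclideanSpace ℝ (Fin n))) : ℝ :=
  ∫ x in A, ‖x - x₀‖ ^ (2 - (n : ℤ)) *
    (lam * ‖u x - g x‖ ^ 2 / (2 * ((n : ℝ) - 2))) ∂μHE[n - 1]

end WeakAnchoring

end

/-! The monotonicity comes from one inner variation. Let `x₀` be a boundary point and let `Y` be the
radial field `x - x₀`, corrected so that it is tangent to the boundary. The stress-energy tensor,
the energy density `e` times the identity minus `∇u ⊗ ∇u`, is contracted with `η(|x - x₀|) Y`, and
the divergence theorem is applied. In the interior the equation leaves `η (n e - |∇u|²)` plus terms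
with `η'`; since `n e - |∇u|²` is `n - 2` times the modified density, the potential must carry the
weight `n / (n - 2)`. On the boundary, tangency removes the flux of `e`, and the anchoring condition
turns the rest into `λ⟨∂_Y u, u - g⟩ = ∂_Y (λ/2 |u - g|²) + λ⟨∂_Y g, u - g⟩`. The first summand is
integrated by parts in a graph chart, where the Euler field has divergence `n - 1`; hence the weight
`(n - 1) / (n - 2)`.

The second summand is the danger, because `λ` is unbounded as `ε → 0`. As `|g| = 1`, the vector `∂_Y
g` is a multiple `ψ` of the rotated `g`, and in the plane `⟨∂_Y g, u - g⟩ = ψ⟨u - g, u^⊥⟩`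
(`inner_sub_eq_of_unit`). Now `λ⟨u - g, u^⊥⟩ = -⟨∂_ν u, u^⊥⟩` is the flux of the current `⟨∇u,
u^⊥⟩`, which is divergence free because `Δu` is parallel to `u`. Adding the field `η ψ ⟨∇u, u^⊥⟩`
therefore cancels the bad term exactly (`Patch.sum_field_normal`) and creates only interior terms
linear in `∇u`. With `|u| ≤ 1` (`IsSolution.norm_le_one`) and Young's inequality these cost a
multiple of `r` times the energy and a constant depending on the domain and `C₀`. No constant sees
`λ` or `ε`.

Pushing the energies forward under `|x - x₀|` gives two finite measures on `[0, r₀)`: `μ` for the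
modified energy and `ν` for the density integrated in `I`. The variation then reads as a
one-dimensional inequality for all weights `w = -η'` (`Patch.firstVariationIneq`). It is tested with
the indicator of `[r, R)` times `exp(Ct) t^(1-n) / (1 + At)`, respectively `exp(-Ct) t^(1-n) / (1 -
At)`; this yields the integrated inequalities (`TestsAgainst.lower`, `TestsAgainst.upper`) without
differentiating the energy in the radius. The bound over the whole ball follows by letting the inner
radius tend to zero.

The geometric input is an area formula for graphs (`euclideanHausdorffMeasure_graph`), a divergence
theorem below a graph for functions that are merely continuous up to it
(`integral_fderiv_subgraph`), and a compactness argument that makes radius and chart bounds uniform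
along the boundary (`IsBoundedSmoothDomain.exists_patches`). -/

namespace WeakAnchoring

/-! ### Radial measures on the half-line: from test weights to integrated inequalities. -/

/-- The inequality obtained by testing the first variation of the energy `μ` (with radial part `ν`)
with a radial vector field whose profile has derivative `-w`. -/
def FirstVariationIneq (n : ℕ) (A B r₀ : ℝ) (μ ν : Measure ℝ) (w : ℝ → ℝ) : Prop :=
  |((n : ℝ) - 2) * (∫ s, (∫ t in s..r₀, w t) ∂μ) - (∫ s, s * w s ∂μ) + ∫ s, s * w s ∂ν|
    ≤ A * ((∫ s, s * (∫ t in s..r₀, w t) ∂μ) + ∫ s, s ^ 2 * w s ∂μ)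
      + B * ∫ s in (0 : ℝ)..r₀, s ^ (n - 1) * w s

lemma measurable_intervalIntegral_left {w : ℝ → ℝ} (hw : Measurable w) {M : ℝ}
    (hb : ∀ s, |w s| ≤ M) (r₀ : ℝ) : Continuous fun s => ∫ t in s..r₀, w t := by
  have hi : ∀ a b, IntervalIntegrable w volume a b := by
    intro a b
    apply (intervalIntegrable_const (c := M)).mono_fun hw.aestronglyMeasurable
    exact .of_forall fun t => (hb t).trans (le_abs_self M)
  have := intervalIntegral.continuous_primitive hi r₀
  rw [show (fun s => ∫ t in s..r₀, w t) = fun s => -∫ t in r₀..s, w t from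
    funext fun s => intervalIntegral.integral_symm _ _]
  exact this.neg

lemma tendsto_integral_of_bounded {μ : Measure ℝ} [IsFiniteMeasure μ] {F : ℕ → ℝ → ℝ} {f : ℝ → ℝ}
    {M : ℝ} (hF : ∀ k, Measurable (F k)) (hb : ∀ k, ∀ᵐ s ∂μ, |F k s| ≤ M)
    (hl : ∀ᵐ s ∂μ, Tendsto (fun k => F k s) atTop (𝓝 (f s))) :
    Tendsto (fun k => ∫ s, F k s ∂μ) atTop (𝓝 (∫ s, f s ∂μ)) :=
  tendsto_integral_of_dominated_convergence (fun _ => M) (fun k => (hF k).aestronglyMeasurable)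
    (integrable_const M) hb hl

/-- All six integrals converge by dominated convergence, since the measures are finite and live on
the bounded interval `[0, r₀)`. This is what allows discontinuous weights such as indicators. -/
lemma FirstVariationIneq.of_tendsto {n : ℕ} {A B r₀ : ℝ} (hr₀ : 0 ≤ r₀) {μ ν : Measure ℝ}
    [IsFiniteMeasure μ] [IsFiniteMeasure ν] (hμ : ∀ᵐ s ∂μ, s ∈ Ico 0 r₀)
    (hν : ∀ᵐ s ∂ν, s ∈ Ico 0 r₀) {wk : ℕ → ℝ → ℝ} {w : ℝ → ℝ} {M : ℝ}
    (hm : ∀ k, Measurable (wk k)) (hb : ∀ k s, |wk k s| ≤ M)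
    (hl : ∀ s, Tendsto (fun k => wk k s) atTop (𝓝 (w s)))
    (h : ∀ᶠ k in atTop, FirstVariationIneq n A B r₀ μ ν (wk k)) :
    FirstVariationIneq n A B r₀ μ ν w := by
  have hM : 0 ≤ M := (abs_nonneg _).trans (hb 0 0)
  have hη : ∀ s, Tendsto (fun k => ∫ t in s..r₀, wk k t) atTop (𝓝 (∫ t in s..r₀, w t)) := by
    intro s
    apply intervalIntegral.tendsto_integral_filter_of_dominated_convergence (fun _ => M)
    · exact .of_forall fun k => (hm k).aestronglyMeasurable
    · exact .of_forall fun k => .of_forall fun t _ => hb k t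
    · exact intervalIntegrable_const
    · exact .of_forall fun t _ => hl t
  have hηm : ∀ k, Measurable fun s => ∫ t in s..r₀, wk k t := fun k =>
    (measurable_intervalIntegral_left (hm k) (hb k) r₀).measurable
  have hηb : ∀ k, ∀ s ∈ Ico 0 r₀, |∫ t in s..r₀, wk k t| ≤ M * r₀ := by
    intro k s hs
    have := intervalIntegral.norm_integral_le_of_norm_le_const (a := s) (b := r₀) (f := wk k)
      (C := M) (fun t _ => hb k t)
    rw [Real.norm_eq_abs, abs_of_nonneg (a := r₀ - s) (by linarith [hs.2])] at this
    exact this.trans (mul_le_mul_of_nonneg_left (by linarith [hs.1]) hM)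
  have hsw : ∀ (k : ℕ), ∀ s ∈ Ico 0 r₀, |s * wk k s| ≤ r₀ * M := by
    intro k s hs
    rw [abs_mul, abs_of_nonneg hs.1]
    exact mul_le_mul hs.2.le (hb k s) (abs_nonneg _) hr₀
  have h1 := tendsto_integral_of_bounded (μ := μ) hηm (fun k => hμ.mono (hηb k))
    (.of_forall hη)
  have h2 := tendsto_integral_of_bounded (μ := μ) (F := fun k s => s * wk k s)
    (fun k => measurable_id.mul (hm k)) (fun k => hμ.mono (hsw k))
    (.of_forall fun s => (hl s).const_mul s)
  have h3 := tendsto_integral_of_bounded (μ := ν) (F := fun k s => s * wk k s)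
    (fun k => measurable_id.mul (hm k)) (fun k => hν.mono (hsw k))
    (.of_forall fun s => (hl s).const_mul s)
  have h4 := tendsto_integral_of_bounded (μ := μ) (F := fun k s => s * ∫ t in s..r₀, wk k t)
    (M := r₀ * (M * r₀)) (fun k => measurable_id.mul (hηm k)) (fun k => hμ.mono fun s hs => by
      rw [abs_mul, abs_of_nonneg hs.1]
      exact mul_le_mul hs.2.le (hηb k s hs) (abs_nonneg _) hr₀)
    (.of_forall fun s => (hη s).const_mul s)
  have h5 := tendsto_integral_of_bounded (μ := μ) (F := fun k s => s ^ 2 * wk k s)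
    (M := r₀ ^ 2 * M) (fun k => (measurable_id.pow_const 2).mul (hm k))
    (fun k => hμ.mono fun s hs => by
      rw [abs_mul, abs_of_nonneg (sq_nonneg s)]
      exact mul_le_mul (pow_le_pow_left₀ hs.1 hs.2.le 2) (hb k s) (abs_nonneg _) (by positivity))
    (.of_forall fun s => (hl s).const_mul (s ^ 2))
  have h6 : Tendsto (fun k => ∫ s in (0 : ℝ)..r₀, s ^ (n - 1) * wk k s) atTop
      (𝓝 (∫ s in (0 : ℝ)..r₀, s ^ (n - 1) * w s)) := by
    apply intervalIntegral.tendsto_integral_filter_of_dominated_convergence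
      (fun _ => r₀ ^ (n - 1) * M)
    · exact .of_forall fun k =>
        ((measurable_id.pow_const (n - 1)).mul (hm k)).aestronglyMeasurable
    · refine .of_forall fun k => .of_forall fun t ht => ?_
      rw [uIoc_of_le hr₀] at ht
      rw [Real.norm_eq_abs, abs_mul, abs_of_nonneg (pow_nonneg ht.1.le _)]
      exact mul_le_mul (pow_le_pow_left₀ ht.1.le ht.2 _) (hb k t) (abs_nonneg _) (by positivity)
    · exact intervalIntegrable_const
    · exact .of_forall fun t _ => (hl t).const_mul _
  exact le_of_tendsto_of_tendsto (((h1.const_mul _).sub h2).add h3).abs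
    (((h4.add h5).const_mul A).add (h6.const_mul B)) h

/-- Trapezoids with compact support in `(0, R)` approximating the indicator of `[r, R)`. -/
def trapezoid (r R : ℝ) (k : ℕ) (s : ℝ) : ℝ := max 0 (min 1 (min (k * (s - r) + 1) (k * (R - s) - 1)))

lemma trapezoid_nonneg (r R : ℝ) (k : ℕ) (s : ℝ) : 0 ≤ trapezoid r R k s := le_max_left _ _

lemma trapezoid_le_one (r R : ℝ) (k : ℕ) (s : ℝ) : trapezoid r R k s ≤ 1 :=
  max_le zero_le_one (min_le_left _ _)

lemma continuous_trapezoid (r R : ℝ) (k : ℕ) : Continuous (trapezoid r R k) := by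
  unfold trapezoid; fun_prop

lemma trapezoid_eq_zero_left {r R : ℝ} {k : ℕ} {s : ℝ} (h : k * (s - r) + 1 ≤ 0) :
    trapezoid r R k s = 0 :=
  max_eq_left ((min_le_right _ _).trans ((min_le_left _ _).trans h))

lemma trapezoid_eq_zero_right {r R : ℝ} {k : ℕ} {s : ℝ} (h : k * (R - s) - 1 ≤ 0) :
    trapezoid r R k s = 0 :=
  max_eq_left ((min_le_right _ _).trans ((min_le_right _ _).trans h))

lemma tendsto_trapezoid (r R s : ℝ) :
    Tendsto (fun k => trapezoid r R k s) atTop (𝓝 ((Ico r R).indicator 1 s)) := by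
  by_cases h1 : s < r
  · rw [indicator_of_notMem (by simp [h1])]
    apply tendsto_const_nhds.congr'
    obtain ⟨K, hK⟩ := exists_nat_ge (1 / (r - s))
    filter_upwards [eventually_ge_atTop K] with k hk
    rw [trapezoid_eq_zero_left]
    have : 1 / (r - s) ≤ k := hK.trans (by exact_mod_cast hk)
    rw [div_le_iff₀ (by linarith)] at this
    linarith
  by_cases h2 : R ≤ s
  · rw [indicator_of_notMem (by simp [h2])]
    apply tendsto_const_nhds.congr
    intro k
    rw [trapezoid_eq_zero_right]
    have : (k : ℝ) * (s - R) ≥ 0 := mul_nonneg (by positivity) (by linarith)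
    linarith
  push Not at h1 h2
  rw [indicator_of_mem (by exact ⟨h1, h2⟩)]
  apply tendsto_const_nhds.congr'
  obtain ⟨K, hK⟩ := exists_nat_ge (2 / (R - s))
  filter_upwards [eventually_ge_atTop K] with k hk
  have : 2 / (R - s) ≤ k := hK.trans (by exact_mod_cast hk)
  rw [div_le_iff₀ (by linarith)] at this
  have h3 : (k : ℝ) * (s - r) ≥ 0 := mul_nonneg (by positivity) (by linarith)
  unfold trapezoid
  rw [min_eq_left (le_min (by linarith) (by linarith)), max_eq_right zero_le_one]
  rfl

/-- The admissible weights of the first variation inequality. -/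
def TestsAgainst (n : ℕ) (A B r₀ : ℝ) (μ ν : Measure ℝ) : Prop :=
  ∀ (w : ℝ → ℝ) (a b : ℝ), Continuous w → (∀ s, 0 ≤ w s) → 0 < a → a < b → b < r₀ →
    (∀ s, s ∉ Icc a b → w s = 0) → FirstVariationIneq n A B r₀ μ ν w

/-- The half-open interval matters: energies are taken over open balls, so the mass of `Iio R` is
that of `Iio r` plus that of `Ico r R`. The trapezoids therefore reach `1` already at `r` and vanish
shortly before `R`. They spill over to the left of `r`, which is why `W` must be controlled down to
`r / 2`. -/
lemma TestsAgainst.indicator {n : ℕ} {A B r₀ : ℝ} {μ ν : Measure ℝ}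
    [IsFiniteMeasure μ] [IsFiniteMeasure ν] (hμ : ∀ᵐ s ∂μ, s ∈ Ico 0 r₀)
    (hν : ∀ᵐ s ∂ν, s ∈ Ico 0 r₀) (h : TestsAgainst n A B r₀ μ ν) {r R : ℝ} (hr : 0 < r)
    (hrR : r < R) (hR : R ≤ r₀) {W : ℝ → ℝ} (hW : ContinuousOn W (Icc (r / 2) R))
    (hW0 : ∀ s ∈ Icc (r / 2) R, 0 ≤ W s) :
    FirstVariationIneq n A B r₀ μ ν ((Ico r R).indicator W) := by
  -- Clamping the argument extends `W` from `[r / 2, R]` to a continuous bounded function on the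
  -- line.
  set V : ℝ → ℝ := fun s => W (max (r / 2) (min s R)) with hV
  have hmem : ∀ s, max (r / 2) (min s R) ∈ Icc (r / 2) R := fun s =>
    ⟨le_max_left _ _, max_le (by linarith) (min_le_right _ _)⟩
  have hVc : Continuous V := hW.comp_continuous (by fun_prop) hmem
  obtain ⟨M, hM⟩ := (isCompact_Icc.image_of_continuousOn hW).isBounded.exists_norm_le
  have hVM : ∀ s, |V s| ≤ M := fun s => hM _ ⟨_, hmem s, rfl⟩
  have hV0 : ∀ s, 0 ≤ V s := fun s => hW0 _ (hmem s)
  have hM0 : 0 ≤ M := (abs_nonneg _).trans (hVM 0)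
  refine FirstVariationIneq.of_tendsto (by linarith) hμ hν
    (wk := fun k s => V s * trapezoid r R k s) (M := M)
    (fun k => (hVc.mul (continuous_trapezoid r R k)).measurable) ?_ ?_ ?_
  · intro k s
    rw [abs_mul, abs_of_nonneg (trapezoid_nonneg _ _ _ _)]
    exact (mul_le_mul (hVM s) (trapezoid_le_one _ _ _ _) (trapezoid_nonneg _ _ _ _) hM0).trans
      (by simp)
  · intro s
    have := (tendsto_trapezoid r R s).const_mul (V s)
    convert this using 2
    by_cases hs : s ∈ Ico r R
    · rw [indicator_of_mem hs, indicator_of_mem hs, hV]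
      simp only [Pi.one_apply, mul_one]
      rw [min_eq_left hs.2.le, max_eq_right (by linarith [hs.1])]
    · simp [indicator_of_notMem hs]
  -- The first summand gives `r - 1 / k ≥ r / 2`, the second makes the support interval `[r / 2, R -
  -- 1 / k]` nondegenerate.
  · obtain ⟨K, hK⟩ := exists_nat_ge (2 / r + 2 / (R - r))
    filter_upwards [eventually_ge_atTop (max K 1)] with k hk
    have hk1 : (1 : ℝ) ≤ k := by exact_mod_cast (le_max_right K 1).trans hk
    have hkK : 2 / r + 2 / (R - r) ≤ k := hK.trans (by exact_mod_cast (le_max_left K 1).trans hk)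
    have p1 : 0 < 2 / r := by positivity
    have p2 : 0 < 2 / (R - r) := div_pos two_pos (by linarith)
    have q1 : 2 ≤ k * r := (div_le_iff₀ hr).1 (by linarith)
    have q2 : 2 ≤ k * (R - r) := (div_le_iff₀ (by linarith)).1 (by linarith)
    have hk0 : (0 : ℝ) < k := by linarith
    have e1 : (k : ℝ) * (1 / k) = 1 := by field_simp
    refine h _ (r / 2) (R - 1 / k) (hVc.mul (continuous_trapezoid r R k))
      (fun s => mul_nonneg (hV0 s) (trapezoid_nonneg _ _ _ _)) (by linarith) ?_ ?_ ?_
    · have : (k : ℝ) * (r / 2) < k * (R - 1 / k) := by nlinarith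
      exact lt_of_mul_lt_mul_left this hk0.le
    · have : 0 < 1 / (k : ℝ) := by positivity
      linarith
    · intro s hs
      simp only [mem_Icc, not_and_or, not_le] at hs
      rcases hs with hs | hs
      · rw [trapezoid_eq_zero_left, mul_zero]
        nlinarith
      · rw [trapezoid_eq_zero_right, mul_zero]
        nlinarith

lemma integral_indicator_Ico {W : ℝ → ℝ} {r R r₀ s : ℝ} (hrR : r < R) (hR : R ≤ r₀)
    (hs : s ≤ r₀) :
    ∫ t in s..r₀, (Ico r R).indicator W t =
      if s < R then ∫ t in (max s r)..R, W t else 0 := by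
  rw [intervalIntegral.integral_of_le hs, ← integral_Icc_eq_integral_Ioc,
    setIntegral_indicator measurableSet_Ico]
  split_ifs with h
  · have : Icc s r₀ ∩ Ico r R = Ico (max s r) R := by
      ext t; simp only [mem_inter_iff, mem_Icc, mem_Ico, max_le_iff]
      constructor
      · rintro ⟨⟨a, b⟩, c, d⟩; exact ⟨⟨a, c⟩, d⟩
      · rintro ⟨⟨a, c⟩, d⟩; exact ⟨⟨a, by linarith⟩, c, d⟩
    rw [this, integral_Ico_eq_integral_Ioo, ← integral_Ioc_eq_integral_Ioo,
      intervalIntegral.integral_of_le (max_le h.le hrR.le)]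
  · have : Icc s r₀ ∩ Ico r R = ∅ := by
      ext t; simp only [mem_inter_iff, mem_Icc, mem_Ico, mem_empty_iff_false, iff_false]
      rintro ⟨⟨a, b⟩, c, d⟩; linarith
    simp [this]

/-- Weighted form of the first variation inequality: if the primitive `a` of `a'` satisfies a
pointwise differential inequality against `W`, then it controls the energy difference. -/
lemma sub_le_of_primitive {n : ℕ} {A : ℝ} {r R r₀ : ℝ} (hrR : r < R)
    (hR : R ≤ r₀) {W a a' : ℝ → ℝ} {σ : ℝ}
    (hW : ContinuousOn W (Icc r R)) (hda : ∀ t ∈ Icc r R, HasDerivAt a (a' t) t)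
    (hca : ContinuousOn a' (Icc r R))
    (hle : ∀ t ∈ Icc r R, ∀ s, 0 ≤ s → s ≤ t → 0 ≤ a' t * σ + (n - 2) * W t * σ - A * s * W t)
    (haW : ∀ t ∈ Icc r R, a t * σ = (t * W t) * σ + A * t ^ 2 * W t)
    {s : ℝ} (hs : s ∈ Ico 0 r₀) :
    (s * (Ico r R).indicator W s) * σ + A * (s ^ 2 * (Ico r R).indicator W s)
      - ((n : ℝ) - 2) * (∫ t in s..r₀, (Ico r R).indicator W t) * σ
      + A * (s * ∫ t in s..r₀, (Ico r R).indicator W t)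
    ≤ (a R * (Iio R).indicator 1 s - a r * (Iio r).indicator 1 s) * σ := by
  rw [integral_indicator_Ico hrR hR hs.2.le]
  by_cases h : s < R
  swap
  · have h2 : s ∉ Ico r R := fun h' => h h'.2
    have h3 : s ∉ Iio R := h
    have h4 : s ∉ Iio r := fun h' => h (lt_trans h' hrR)
    simp [h, indicator_of_notMem h4]
  rw [if_pos h]
  -- The hypothesis `hle` is integrated over `[q, R]`, where `t ≥ s`. For `s < r` the primitive
  -- contributes `a R - a r`; for `s ≥ r` it contributes `a R - a s`, and `haW` identifies `a s`
  -- with the pointwise terms.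
  set q := max s r
  have hqR : q ≤ R := max_le h.le hrR.le
  have hsub : Icc q R ⊆ Icc r R := Icc_subset_Icc_left (le_max_right _ _)
  have hsub' : uIcc q R ⊆ Icc r R := by rw [uIcc_of_le hqR]; exact hsub
  have hWi : IntervalIntegrable W volume q R := (hW.mono hsub').intervalIntegrable
  have hai : IntervalIntegrable a' volume q R := (hca.mono hsub').intervalIntegrable
  have hint : ∫ t in q..R, a' t = a R - a q :=
    intervalIntegral.integral_eq_sub_of_hasDerivAt (fun t ht => hda t (hsub' ht)) hai
  have hnn : 0 ≤ ∫ t in q..R, (a' t * σ + (n - 2) * W t * σ - A * s * W t) :=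
    intervalIntegral.integral_nonneg hqR fun t ht =>
      hle t (hsub ht) s hs.1 ((le_max_left s r).trans ht.1)
  rw [intervalIntegral.integral_sub ((hai.mul_const _).add ((hWi.const_mul _).mul_const _))
    (hWi.const_mul _), intervalIntegral.integral_add (hai.mul_const _)
    ((hWi.const_mul _).mul_const _)] at hnn
  simp only [intervalIntegral.integral_mul_const, intervalIntegral.integral_const_mul] at hnn
  rw [hint] at hnn
  have h3 : s ∈ Iio R := h
  rw [indicator_of_mem h3]
  by_cases h4 : s < r
  · have h5 : s ∉ Ico r R := fun h' => absurd h'.1 (not_le.2 h4)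
    have h6 : s ∈ Iio r := h4
    have hq : q = r := max_eq_right h4.le
    rw [indicator_of_notMem h5, indicator_of_mem h6]
    rw [hq] at hnn ⊢
    simp only [Pi.one_apply]
    linarith
  · push Not at h4
    have h5 : s ∈ Ico r R := ⟨h4, h⟩
    have h6 : s ∉ Iio r := not_lt.2 h4
    have hq : q = s := max_eq_left h4
    rw [indicator_of_mem h5, indicator_of_notMem h6]
    rw [hq] at hnn ⊢
    simp only [Pi.one_apply]
    have := haW s ⟨h4, h.le⟩
    linarith


lemma abs_indicator_Ico_le {W : ℝ → ℝ} {r R M : ℝ} (hM : ∀ s ∈ Icc r R, |W s| ≤ M) (hM0 : 0 ≤ M)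
    (s : ℝ) : |(Ico r R).indicator W s| ≤ M := by
  by_cases h : s ∈ Ico r R
  · rw [indicator_of_mem h]; exact hM s ⟨h.1, h.2.le⟩
  · rw [indicator_of_notMem h]; simpa

/-- The integrated differential inequality that follows from the first variation inequality. -/
lemma TestsAgainst.integrated {n : ℕ} {A B r₀ : ℝ} {μ ν : Measure ℝ}
    [IsFiniteMeasure μ] [IsFiniteMeasure ν] (hμ : ∀ᵐ s ∂μ, s ∈ Ico 0 r₀)
    (hν : ∀ᵐ s ∂ν, s ∈ Ico 0 r₀) (h : TestsAgainst n A B r₀ μ ν) {r R : ℝ} (hr : 0 < r)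
    (hrR : r < R) (hR : R ≤ r₀) {W a a' : ℝ → ℝ} (hW : ContinuousOn W (Icc (r / 2) R))
    (hWm : Measurable W) (hW0 : ∀ s ∈ Icc (r / 2) R, 0 ≤ W s)
    (hda : ∀ t ∈ Icc r R, HasDerivAt a (a' t) t)
    (hca : ContinuousOn a' (Icc r R)) {σ : ℝ} (hσ : σ = 1 ∨ σ = -1)
    (hle : ∀ t ∈ Icc r R, ∀ s, 0 ≤ s → s ≤ t → 0 ≤ a' t * σ + (n - 2) * W t * σ - A * s * W t)
    (haW : ∀ t ∈ Icc r R, a t * σ = (t * W t) * σ + A * t ^ 2 * W t) :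
    (∫ s in Ico r R, s * W s ∂ν) * σ ≤
      (a R * μ.real (Iio R) - a r * μ.real (Iio r)) * σ
        + B * ∫ s in (0 : ℝ)..r₀, s ^ (n - 1) * (Ico r R).indicator W s := by
  have key := h.indicator hμ hν hr hrR hR hW hW0
  have hsub : Icc r R ⊆ Icc (r / 2) R := Icc_subset_Icc_left (by linarith)
  have hr₀ : 0 ≤ r₀ := by linarith
  unfold FirstVariationIneq at key
  set w := (Ico r R).indicator W with hw
  have hwm : Measurable w := hWm.indicator measurableSet_Ico
  obtain ⟨M, hM⟩ := (isCompact_Icc.image_of_continuousOn hW).isBounded.exists_norm_le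
  have hM0 : 0 ≤ M := (norm_nonneg _).trans (hM _ ⟨r, hsub ⟨le_rfl, hrR.le⟩, rfl⟩)
  have hb : ∀ s, |w s| ≤ M := abs_indicator_Ico_le (fun s hs => hM _ ⟨s, hsub hs, rfl⟩) hM0
  have hηm : Measurable fun s => ∫ t in s..r₀, w t :=
    (measurable_intervalIntegral_left hwm hb r₀).measurable
  have hηb : ∀ s ∈ Ico 0 r₀, |∫ t in s..r₀, w t| ≤ M * r₀ := by
    intro s hs
    have := intervalIntegral.norm_integral_le_of_norm_le_const (a := s) (b := r₀) (f := w)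
      (C := M) (fun t _ => hb t)
    rw [Real.norm_eq_abs, abs_of_nonneg (a := r₀ - s) (by linarith [hs.2])] at this
    exact this.trans (mul_le_mul_of_nonneg_left (by linarith [hs.1]) hM0)
  have i1 : Integrable (fun s => s * w s) μ :=
    Integrable.of_bound (measurable_id.mul hwm).aestronglyMeasurable (r₀ * M)
      (hμ.mono fun s hs => by
        rw [Real.norm_eq_abs, abs_mul, abs_of_nonneg hs.1]
        exact mul_le_mul hs.2.le (hb s) (abs_nonneg _) hr₀)
  have i2 : Integrable (fun s => s ^ 2 * w s) μ :=
    Integrable.of_bound ((measurable_id.pow_const 2).mul hwm).aestronglyMeasurable (r₀ ^ 2 * M)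
      (hμ.mono fun s hs => by
        rw [Real.norm_eq_abs, abs_mul, abs_of_nonneg (sq_nonneg s)]
        exact mul_le_mul (pow_le_pow_left₀ hs.1 hs.2.le 2) (hb s) (abs_nonneg _) (by positivity))
  have i3 : Integrable (fun s => ∫ t in s..r₀, w t) μ :=
    Integrable.of_bound hηm.aestronglyMeasurable (M * r₀) (hμ.mono hηb)
  have i4 : Integrable (fun s => s * ∫ t in s..r₀, w t) μ :=
    Integrable.of_bound (measurable_id.mul hηm).aestronglyMeasurable (r₀ * (M * r₀))
      (hμ.mono fun s hs => by
        rw [Real.norm_eq_abs, abs_mul, abs_of_nonneg hs.1]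
        exact mul_le_mul hs.2.le (hηb s hs) (abs_nonneg _) hr₀)
  have j1 : ∀ q, Integrable ((Iio q).indicator (1 : ℝ → ℝ)) μ := fun q =>
    (integrable_const (1 : ℝ)).indicator measurableSet_Iio
  have mono := integral_mono_ae
    (f := fun s => (s * w s) * σ + A * (s ^ 2 * w s) - ((n : ℝ) - 2) * (∫ t in s..r₀, w t) * σ
      + A * (s * ∫ t in s..r₀, w t))
    (g := fun s => (a R * (Iio R).indicator 1 s - a r * (Iio r).indicator 1 s) * σ)
    ((((i1.mul_const σ).add (i2.const_mul A)).sub ((i3.const_mul _).mul_const σ)).add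
      (i4.const_mul A))
    ((((j1 R).const_mul _).sub ((j1 r).const_mul _)).mul_const σ)
    (hμ.mono fun s hs => sub_le_of_primitive hrR hR (hW.mono hsub) hda hca hle haW hs)
  have k2 : Integrable (fun s => (s * w s) * σ + A * (s ^ 2 * w s)) μ :=
    (i1.mul_const σ).add (i2.const_mul A)
  have k3 : Integrable (fun s => (s * w s) * σ + A * (s ^ 2 * w s)
      - ((n : ℝ) - 2) * (∫ t in s..r₀, w t) * σ) μ := k2.sub ((i3.const_mul _).mul_const σ)
  rw [integral_add k3 (i4.const_mul A), integral_sub k2 ((i3.const_mul _).mul_const σ),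
      integral_add (i1.mul_const σ) (i2.const_mul A),
      integral_mul_const σ (fun s => a R * (Iio R).indicator 1 s - a r * (Iio r).indicator 1 s),
      integral_sub ((j1 R).const_mul _) ((j1 r).const_mul _)] at mono
  simp only [integral_mul_const, integral_const_mul, integral_indicator_one measurableSet_Iio]
    at mono
  have hν1 : ∫ s, s * w s ∂ν = ∫ s in Ico r R, s * W s ∂ν := by
    rw [← integral_indicator measurableSet_Ico]
    congr 1; ext s
    by_cases hs : s ∈ Ico r R
    · simp [hw, indicator_of_mem hs]
    · simp [hw, indicator_of_notMem hs]
  rw [hν1] at key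
  -- The sign `σ` selects which half of the two-sided bound is used: `σ = 1` bounds the `ν`-integral
  -- from above, `σ = -1` from below.
  have := abs_le.1 key
  rcases hσ with rfl | rfl <;> linarith [this.1, this.2]

/-- The weights used below are comparable to `s ^ (1 - n)`, which cancels the factor `s ^ (n - 1)`.
This is the origin of the additive terms proportional to `R - r`. -/
lemma integral_pow_mul_indicator_le {n : ℕ} (hn : 1 ≤ n) {r R r₀ M : ℝ} (hr : 0 < r) (hrR : r < R)
    (hR : R ≤ r₀) {W : ℝ → ℝ} (hW : ContinuousOn W (Icc r R))
    (hM : ∀ s ∈ Icc r R, W s ≤ M * s ^ (1 - (n : ℤ))) :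
    ∫ s in (0 : ℝ)..r₀, s ^ (n - 1) * (Ico r R).indicator W s ≤ M * (R - r) := by
  have : ∀ s : ℝ, s ^ (n - 1) * (Ico r R).indicator W s =
      (Ico r R).indicator (fun s => s ^ (n - 1) * W s) s := by
    intro s
    by_cases hs : s ∈ Ico r R
    · simp [indicator_of_mem hs]
    · simp [indicator_of_notMem hs]
  simp_rw [this]
  rw [integral_indicator_Ico hrR hR (by linarith), if_pos (by linarith), max_eq_right hr.le]
  have h := intervalIntegral.integral_mono_on (f := fun s => s ^ (n - 1) * W s) (g := fun _ => M)
    (μ := volume) hrR.le ?_ intervalIntegrable_const ?_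
  · simpa [mul_comm] using h
  · apply ContinuousOn.intervalIntegrable
    rw [uIcc_of_le hrR.le]
    exact (continuous_pow _).continuousOn.mul hW
  · intro s hs
    have hs0 : 0 < s := by linarith [hs.1]
    have h1 := mul_le_mul_of_nonneg_left (hM s hs) (pow_nonneg hs0.le (n - 1))
    refine h1.trans (le_of_eq ?_)
    have : s ^ (n - 1) * s ^ (1 - (n : ℤ)) = 1 := by
      rw [← zpow_natCast, ← zpow_add₀ hs0.ne', Nat.cast_sub hn]; simp
    rw [mul_left_comm, this, mul_one]

/-! ### Exponential weights and the monotonicity inequalities for radial measures. -/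

lemma hasDerivAt_exp_mul_zpow (n : ℕ) (C : ℝ) {t : ℝ} (ht : 0 < t) :
    HasDerivAt (fun s => Real.exp (C * s) * s ^ (2 - (n : ℤ)))
      (Real.exp (C * t) * t ^ (1 - (n : ℤ)) * (C * t - (n - 2))) t := by
  have h1 : HasDerivAt (fun s => Real.exp (C * s)) (Real.exp (C * t) * C) t := by
    simpa using ((hasDerivAt_id t).const_mul C).exp
  have h2 := hasDerivAt_zpow (2 - (n : ℤ)) t (Or.inl ht.ne')
  refine (h1.mul h2).congr_deriv ?_
  have e : t ^ (2 - (n : ℤ)) = t ^ (1 - (n : ℤ)) * t := by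
    rw [← zpow_add_one₀ ht.ne']; congr 1; ring
  have e2 : (2 - (n : ℤ) - 1) = 1 - n := by ring
  rw [e, e2]; push_cast; ring

lemma zpow_two_sub {n : ℕ} {t : ℝ} (ht : 0 < t) :
    t ^ (2 - (n : ℤ)) = t * t ^ (1 - (n : ℤ)) := by
  rw [mul_comm, ← zpow_add_one₀ ht.ne']; congr 1; ring

/-- The weight `W` is dictated by `t W (1 + A t) = exp(C t) t ^ (2 - n)`, so that the terms `s w`
and `A s² w` together rebuild the coefficient of the energy. The growth `C ≥ (n - 1) A` of the
exponential pays for the two remaining losses, `(n - 2) A t` from the denominator and `A s ≤ A t`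
from the error with `s` times the primitive. -/
lemma TestsAgainst.lower {n : ℕ} (hn : 3 ≤ n) {A B r₀ : ℝ} (hA : 0 ≤ A) (hB : 0 ≤ B)
    {μ ν : Measure ℝ} [IsFiniteMeasure μ] [IsFiniteMeasure ν] (hμ : ∀ᵐ s ∂μ, s ∈ Ico 0 r₀)
    (hν : ∀ᵐ s ∂ν, s ∈ Ico 0 r₀) (h : TestsAgainst n A B r₀ μ ν) {C : ℝ}
    (hC : (n - 1) * A ≤ C) {r R : ℝ} (hr : 0 < r) (hrR : r < R) (hR : R ≤ r₀) :
    ∫ s in Ico r R, s ^ (2 - (n : ℤ)) ∂ν ≤ (1 + A * R) *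
      (Real.exp (C * R) * (R ^ (2 - (n : ℤ)) * μ.real (Iio R))
        - Real.exp (C * r) * (r ^ (2 - (n : ℤ)) * μ.real (Iio r))
        + B * Real.exp (C * R) * (R - r)) := by
  have hn' : (3 : ℝ) ≤ n := by exact_mod_cast hn
  have hC0 : 0 ≤ C := le_trans (by nlinarith) hC
  set W : ℝ → ℝ := fun t => Real.exp (C * t) * t ^ (1 - (n : ℤ)) / (1 + A * t) with hWdef
  have hpos : ∀ t, 0 < t → 0 < 1 + A * t := fun t ht => by positivity
  have hWc : ContinuousOn W (Ioi 0) := by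
    apply ContinuousOn.div
    · exact (by fun_prop : Continuous fun t => Real.exp (C * t)).continuousOn.mul
        fun t ht => (continuousAt_zpow₀ t _ (Or.inl (ne_of_gt ht))).continuousWithinAt
    · fun_prop
    · exact fun t ht => (hpos t ht).ne'
  have hsub : Icc r R ⊆ Ioi 0 := fun t ht => lt_of_lt_of_le hr ht.1
  have hsub2 : Icc (r / 2) R ⊆ Ioi 0 := fun t ht => lt_of_lt_of_le (by linarith) ht.1
  have hWm : Measurable W := by
    have : Measurable fun t : ℝ => t ^ (1 - (n : ℤ)) := by fun_prop
    fun_prop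
  have hW0 : ∀ t, 0 < t → 0 ≤ W t := fun t ht => by have := hpos t ht; positivity
  have key := h.integrated hμ hν hr hrR hR (W := W) (σ := 1)
    (a := fun s => Real.exp (C * s) * s ^ (2 - (n : ℤ)))
    (a' := fun t => Real.exp (C * t) * t ^ (1 - (n : ℤ)) * (C * t - (n - 2)))
    (hWc.mono hsub2) hWm (fun t ht => hW0 t (hsub2 ht))
    (fun t ht => hasDerivAt_exp_mul_zpow n C (hsub ht)) ?_ (Or.inl rfl) ?_ ?_
  rotate_left
  · refine ((by fun_prop : Continuous fun t => Real.exp (C * t)).continuousOn.mul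
        fun t ht => (continuousAt_zpow₀ t _ (Or.inl (ne_of_gt (hsub ht)))).continuousWithinAt).mul
        (by fun_prop)
  · intro t ht s hs hst
    have ht0 : 0 < t := hsub ht
    have hp := hpos t ht0
    have : Real.exp (C * t) * t ^ (1 - (n : ℤ)) * (C * t - (n - 2)) * 1 + (n - 2) * W t * 1
        - A * s * W t = Real.exp (C * t) * t ^ (1 - (n : ℤ)) / (1 + A * t) *
          ((C * t - (n - 2)) * (1 + A * t) + (n - 2) - A * s) := by
      simp only [hWdef]; field_simp
    rw [this]
    refine mul_nonneg (hW0 t ht0) ?_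
    have h1 : A * s ≤ A * t := mul_le_mul_of_nonneg_left hst hA
    have h2 : (n - 1) * A * t ≤ C * t := mul_le_mul_of_nonneg_right hC ht0.le
    have h3 : 0 ≤ C * t * (A * t) := by positivity
    nlinarith
  · intro t ht
    have ht0 : 0 < t := hsub ht
    have hp := hpos t ht0
    simp only [hWdef]
    rw [zpow_two_sub ht0]
    field_simp
  have hlast : ∫ s in (0 : ℝ)..r₀, s ^ (n - 1) * (Ico r R).indicator W s
      ≤ Real.exp (C * R) * (R - r) := by
    apply integral_pow_mul_indicator_le (by omega) hr hrR hR (hWc.mono hsub)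
    intro s hs
    have hs0 : 0 < s := hsub hs
    have h1 : Real.exp (C * s) ≤ Real.exp (C * R) :=
      Real.exp_le_exp.2 (mul_le_mul_of_nonneg_left hs.2 hC0)
    have h2 : (0 : ℝ) < s ^ (1 - (n : ℤ)) := by positivity
    refine (div_le_self (by positivity) ?_).trans (mul_le_mul_of_nonneg_right h1 h2.le)
    have : 0 ≤ A * s := by positivity
    linarith
  have hpR := hpos R (by linarith)
  have hfirst : ∫ s in Ico r R, s ^ (2 - (n : ℤ)) ∂ν ≤
      (1 + A * R) * ∫ s in Ico r R, s * W s ∂ν := by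
    rw [← integral_const_mul]
    have hcI : ∀ f : ℝ → ℝ, ContinuousOn f (Icc r R) → IntegrableOn f (Ico r R) ν := fun f hf =>
      (hf.integrableOn_compact isCompact_Icc).mono_set Ico_subset_Icc_self
    apply setIntegral_mono_on
    · exact hcI _ fun t ht => (continuousAt_zpow₀ t _ (Or.inl (ne_of_gt (hsub ht)))).continuousWithinAt
    · exact hcI _ (continuousOn_const.mul (continuousOn_id.mul (hWc.mono hsub)))
    · exact measurableSet_Ico
    · intro s hs
      have hs0 : 0 < s := by linarith [hs.1]
      have hp := hpos s hs0
      have h2 : (0 : ℝ) < s ^ (1 - (n : ℤ)) := by positivity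
      rw [zpow_two_sub hs0]
      have h1 : 1 ≤ Real.exp (C * s) := Real.one_le_exp (by positivity)
      have h3 : 1 ≤ (1 + A * R) / (1 + A * s) := by
        rw [one_le_div hp]; nlinarith [hs.2]
      have h4 : 1 * 1 ≤ (1 + A * R) / (1 + A * s) * Real.exp (C * s) :=
        mul_le_mul h3 h1 zero_le_one (by positivity)
      calc s * s ^ (1 - (n : ℤ)) = (s * s ^ (1 - (n : ℤ))) * (1 * 1) := by ring
        _ ≤ (s * s ^ (1 - (n : ℤ))) * ((1 + A * R) / (1 + A * s) * Real.exp (C * s)) :=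
            mul_le_mul_of_nonneg_left h4 (by positivity)
        _ = _ := by simp only [hWdef]; ring
  refine hfirst.trans (mul_le_mul_of_nonneg_left ?_ hpR.le)
  have := mul_le_mul_of_nonneg_left hlast hB
  nlinarith

/-- Same mechanism with opposite sign: now `t W (1 - A t) = exp(-C t) t ^ (2 - n)`. Smallness of `A
r₀` keeps the denominator above `3 / 4`, which also gives `W ≤ 2 t ^ (1 - n)` and hence the factor
`2` on the right. -/
lemma TestsAgainst.upper {n : ℕ} (hn : 3 ≤ n) {A B r₀ : ℝ} (hA : 0 ≤ A) (hB : 0 ≤ B)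
    (hAr : A * r₀ ≤ 1 / 4)
    {μ ν : Measure ℝ} [IsFiniteMeasure μ] [IsFiniteMeasure ν] (hμ : ∀ᵐ s ∂μ, s ∈ Ico 0 r₀)
    (hν : ∀ᵐ s ∂ν, s ∈ Ico 0 r₀) (h : TestsAgainst n A B r₀ μ ν) {C : ℝ}
    (hC : 2 * ((n - 1) * A) ≤ C) {r R : ℝ} (hr : 0 < r) (hrR : r < R) (hR : R ≤ r₀) :
    Real.exp (-C * R) * (R ^ (2 - (n : ℤ)) * μ.real (Iio R))
        - Real.exp (-C * r) * (r ^ (2 - (n : ℤ)) * μ.real (Iio r))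
      ≤ 2 * (∫ s in Ico r R, s ^ (2 - (n : ℤ)) ∂ν) + 2 * B * (R - r) := by
  have hn' : (3 : ℝ) ≤ n := by exact_mod_cast hn
  have hC0 : 0 ≤ C := le_trans (by nlinarith) hC
  set W : ℝ → ℝ := fun t => Real.exp (-C * t) * t ^ (1 - (n : ℤ)) / (1 - A * t) with hWdef
  have hsub : Icc r R ⊆ Ioc 0 R := fun t ht => ⟨lt_of_lt_of_le hr ht.1, ht.2⟩
  have hsub2 : Icc (r / 2) R ⊆ Ioc 0 R := fun t ht => ⟨lt_of_lt_of_le (by linarith) ht.1, ht.2⟩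
  have hpos : ∀ t ∈ Ioc 0 R, 3 / 4 ≤ 1 - A * t := fun t ht => by
    have : A * t ≤ A * r₀ := mul_le_mul_of_nonneg_left (ht.2.trans hR) hA
    linarith
  have hWc : ContinuousOn W (Ioc 0 R) := by
    apply ContinuousOn.div
    · exact (by fun_prop : Continuous fun t => Real.exp (-C * t)).continuousOn.mul
        fun t ht => (continuousAt_zpow₀ t _ (Or.inl (ne_of_gt ht.1))).continuousWithinAt
    · fun_prop
    · exact fun t ht => by linarith [hpos t ht]
  have hWm : Measurable W := by
    have : Measurable fun t : ℝ => t ^ (1 - (n : ℤ)) := by fun_prop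
    fun_prop
  have hW0 : ∀ t ∈ Ioc 0 R, 0 ≤ W t := fun t ht => by
    have := hpos t ht
    have := ht.1
    exact div_nonneg (by positivity) (by linarith)
  have hW2 : ∀ t ∈ Ioc 0 R, W t ≤ 2 * t ^ (1 - (n : ℤ)) := fun t ht => by
    have h1 := hpos t ht
    have h0 := ht.1
    have h2 : (0 : ℝ) < t ^ (1 - (n : ℤ)) := by positivity
    have h3 : Real.exp (-C * t) ≤ 1 := Real.exp_le_one_iff.2 (by nlinarith)
    simp only [hWdef]
    rw [div_le_iff₀ (by linarith)]
    nlinarith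
  have key := h.integrated hμ hν hr hrR hR (W := W) (σ := -1)
    (a := fun s => Real.exp (-C * s) * s ^ (2 - (n : ℤ)))
    (a' := fun t => Real.exp (-C * t) * t ^ (1 - (n : ℤ)) * (-C * t - (n - 2)))
    (hWc.mono hsub2) hWm (fun t ht => hW0 t (hsub2 ht))
    (fun t ht => hasDerivAt_exp_mul_zpow n (-C) (hsub ht).1) ?_ (Or.inr rfl) ?_ ?_
  rotate_left
  · refine ((by fun_prop : Continuous fun t => Real.exp (-C * t)).continuousOn.mul
        fun t ht => (continuousAt_zpow₀ t _ (Or.inl (ne_of_gt (hsub ht).1))).continuousWithinAt).mul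
        (by fun_prop)
  · intro t ht s hs hst
    have ht0 : 0 < t := (hsub ht).1
    have hp := hpos t (hsub ht)
    have hp' : W t * (1 - A * t) = Real.exp (-C * t) * t ^ (1 - (n : ℤ)) :=
      div_mul_cancel₀ _ (by linarith)
    have : Real.exp (-C * t) * t ^ (1 - (n : ℤ)) * (-C * t - (n - 2)) * -1 + (n - 2) * W t * -1
        - A * s * W t = W t *
          ((C * t + (n - 2)) * (1 - A * t) - (n - 2) - A * s) := by
      linear_combination (-(C * t + (n - 2))) * hp'
    rw [this]
    refine mul_nonneg (hW0 t (hsub ht)) ?_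
    have h1 : A * s ≤ A * t := mul_le_mul_of_nonneg_left hst hA
    have h2 : 2 * ((n - 1) * A) * t ≤ C * t := mul_le_mul_of_nonneg_right hC ht0.le
    have h3 : C * t * (3 / 4) ≤ C * t * (1 - A * t) :=
      mul_le_mul_of_nonneg_left hp (by positivity)
    have h4 : 0 ≤ (n - 1) * A * t := mul_nonneg (mul_nonneg (by linarith) hA) ht0.le
    nlinarith
  · intro t ht
    have ht0 : 0 < t := (hsub ht).1
    have hp := hpos t (hsub ht)
    have hp' : W t * (1 - A * t) = Real.exp (-C * t) * t ^ (1 - (n : ℤ)) :=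
      div_mul_cancel₀ _ (by linarith)
    rw [zpow_two_sub ht0]
    linear_combination t * hp'
  have hlast : ∫ s in (0 : ℝ)..r₀, s ^ (n - 1) * (Ico r R).indicator W s
      ≤ 2 * (R - r) :=
    integral_pow_mul_indicator_le (by omega) hr hrR hR (hWc.mono hsub)
      fun s hs => hW2 s (hsub hs)
  have hfirst : ∫ s in Ico r R, s * W s ∂ν ≤ 2 * ∫ s in Ico r R, s ^ (2 - (n : ℤ)) ∂ν := by
    rw [← integral_const_mul]
    have hcI : ∀ f : ℝ → ℝ, ContinuousOn f (Icc r R) → IntegrableOn f (Ico r R) ν := fun f hf =>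
      (hf.integrableOn_compact isCompact_Icc).mono_set Ico_subset_Icc_self
    apply setIntegral_mono_on
    · exact hcI _ (continuousOn_id.mul (hWc.mono hsub))
    · exact hcI _ (continuousOn_const.mul fun t ht =>
        (continuousAt_zpow₀ t _ (Or.inl (ne_of_gt (hsub ht).1))).continuousWithinAt)
    · exact measurableSet_Ico
    · intro s hs
      have hs' := hsub ⟨hs.1, hs.2.le⟩
      rw [zpow_two_sub hs'.1]
      nlinarith [hW2 s hs', hs'.1]
  have := mul_le_mul_of_nonneg_left hlast hB
  nlinarith


lemma integrableOn_zpow_Ico (n : ℕ) (ν : Measure ℝ) [IsFiniteMeasure ν] {r : ℝ} (hr : 0 < r)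
    (R : ℝ) : IntegrableOn (fun s : ℝ => s ^ (2 - (n : ℤ))) (Ico r R) ν :=
  have hc : ContinuousOn (fun s : ℝ => s ^ (2 - (n : ℤ))) (Icc r R) := fun t ht =>
    (continuousAt_zpow₀ t _ (Or.inl (ne_of_gt (lt_of_lt_of_le hr ht.1)))).continuousWithinAt
  (hc.integrableOn_compact isCompact_Icc).mono_set Ico_subset_Icc_self

/-- For radii that are not too small, the weighted energy is monotone for trivial reasons. -/
lemma exp_mul_energy_mono {n : ℕ} {μ ν : Measure ℝ} [IsFiniteMeasure μ]
    [IsFiniteMeasure ν] (hνμ : ∀ s, ν s ≤ 2 * μ s) {C r R : ℝ} (hC : 0 ≤ C) (hr : 0 < r)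
    (hrR : r ≤ R) (hrC : (n : ℝ) - 2 ≤ C * r) :
    1 / 2 * ∫ s in Ico r R, s ^ (2 - (n : ℤ)) ∂ν ≤
      Real.exp (C * R) * (R ^ (2 - (n : ℤ)) * μ.real (Iio R))
        - Real.exp (C * r) * (r ^ (2 - (n : ℤ)) * μ.real (Iio r)) := by
  set a : ℝ → ℝ := fun s => Real.exp (C * s) * s ^ (2 - (n : ℤ)) with ha
  -- The derivative of `a` has the sign of `C t - (n - 2)`, which is nonnegative from `r` on. The
  -- exponential thus outweighs the decay of `t ^ (2 - n)`, and no variational information is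
  -- needed.
  have hmono : MonotoneOn a (Ici r) := by
    apply monotoneOn_of_deriv_nonneg (convex_Ici r)
    · exact fun t ht => (hasDerivAt_exp_mul_zpow n C
        (lt_of_lt_of_le hr ht)).continuousAt.continuousWithinAt
    · intro t ht
      rw [interior_Ici] at ht
      exact (hasDerivAt_exp_mul_zpow n C (lt_trans hr ht)).differentiableAt.differentiableWithinAt
    · intro t ht
      rw [interior_Ici] at ht
      have ht0 : 0 < t := lt_trans hr ht
      rw [(hasDerivAt_exp_mul_zpow n C ht0).deriv]
      have : C * r ≤ C * t := mul_le_mul_of_nonneg_left (le_of_lt ht) hC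
      exact mul_nonneg (by positivity) (by linarith)
  have hR0 : 0 < R := by linarith
  have h1 : ∫ s in Ico r R, s ^ (2 - (n : ℤ)) ∂ν ≤ 2 * ∫ s in Ico r R, s ^ (2 - (n : ℤ)) ∂μ := by
    have hle : ν.restrict (Ico r R) ≤ (2 : ENNReal) • μ.restrict (Ico r R) := by
      rw [← Measure.restrict_smul]
      exact Measure.restrict_mono_measure (Measure.le_iff.2 fun s _ => by simpa using hνμ s) _
    have h2 := integral_mono_measure (f := fun s : ℝ => s ^ (2 - (n : ℤ))) hle ?_ ?_
    · rw [integral_smul_measure] at h2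
      simpa using h2
    · apply Measure.ae_smul_measure
      filter_upwards [ae_restrict_mem measurableSet_Ico] with s hs
      have : 0 < s := lt_of_lt_of_le hr hs.1
      simp only [Pi.zero_apply]; positivity
    · exact (integrableOn_zpow_Ico n μ hr R).integrable.smul_measure (by simp)
  have h3 : ∫ s in Ico r R, s ^ (2 - (n : ℤ)) ∂μ ≤ a R * μ.real (Ico r R) := by
    have := setIntegral_mono_on (f := fun s : ℝ => s ^ (2 - (n : ℤ))) (g := fun _ => a R)
      (integrableOn_zpow_Ico n μ hr R) (integrable_const _) measurableSet_Ico fun s hs => by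
        have hs0 : 0 < s := lt_of_lt_of_le hr hs.1
        refine le_trans ?_ (hmono hs.1 hrR hs.2.le)
        exact le_mul_of_one_le_left (by positivity) (Real.one_le_exp (by positivity))
    simpa [mul_comm] using this
  have h4 : μ.real (Iio R) = μ.real (Iio r) + μ.real (Ico r R) := by
    rw [← measureReal_union _ measurableSet_Ico, Iio_union_Ico_eq_Iio hrR]
    exact Set.disjoint_left.2 fun s hs hs' => absurd hs'.1 (not_le.2 hs)
  have h5 : a r ≤ a R := hmono (mem_Ici.2 le_rfl) hrR hrR
  have h6 : 0 ≤ μ.real (Iio r) := measureReal_nonneg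
  have : Real.exp (C * R) * (R ^ (2 - (n : ℤ)) * μ.real (Iio R))
        - Real.exp (C * r) * (r ^ (2 - (n : ℤ)) * μ.real (Iio r)) =
      (a R - a r) * μ.real (Iio r) + a R * μ.real (Ico r R) := by
    rw [h4]; simp only [ha]; ring
  rw [this]
  have := mul_nonneg (sub_nonneg.2 h5) h6
  linarith

/-- In `TestsAgainst.lower` the additive error is `B exp(C R)`, and requiring it to be at most `C`
would be circular, as `r₀` is fixed before `C`. The remedy is to use that lemma only for `C R ≤ n -
2`, where `B exp(n - 2) ≤ C` is enough, and the trivial monotonicity of `exp_mul_energy_mono` for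
larger radii. The factor `1 / 2` absorbs `1 + A R ≤ 5 / 4`. -/
lemma TestsAgainst.lower_exp {n : ℕ} (hn : 3 ≤ n) {A B r₀ : ℝ} (hA : 0 ≤ A) (hB : 0 ≤ B)
    (hAr : A * r₀ ≤ 1 / 4) {μ ν : Measure ℝ} [IsFiniteMeasure μ] [IsFiniteMeasure ν]
    (hμ : ∀ᵐ s ∂μ, s ∈ Ico 0 r₀) (hν : ∀ᵐ s ∂ν, s ∈ Ico 0 r₀) (hνμ : ∀ s, ν s ≤ 2 * μ s)
    (h : TestsAgainst n A B r₀ μ ν) {C : ℝ} (hC0 : 0 < C) (hC : (n - 1) * A ≤ C)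
    (hCB : B * Real.exp (n - 2) ≤ C) {r R : ℝ} (hr : 0 < r) (hrR : r ≤ R) (hR : R ≤ r₀) :
    1 / 2 * ∫ s in Ico r R, s ^ (2 - (n : ℤ)) ∂ν ≤
      Real.exp (C * R) * (R ^ (2 - (n : ℤ)) * μ.real (Iio R))
        - Real.exp (C * r) * (r ^ (2 - (n : ℤ)) * μ.real (Iio r)) + C * (R - r) := by
  have hn' : (3 : ℝ) ≤ n := by exact_mod_cast hn
  have small : ∀ R', r ≤ R' → R' ≤ R → C * R' ≤ n - 2 →
      1 / 2 * ∫ s in Ico r R', s ^ (2 - (n : ℤ)) ∂ν ≤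
      Real.exp (C * R') * (R' ^ (2 - (n : ℤ)) * μ.real (Iio R'))
        - Real.exp (C * r) * (r ^ (2 - (n : ℤ)) * μ.real (Iio r)) + C * (R' - r) := by
    intro R' h1 h2 h3
    rcases h1.eq_or_lt with rfl | h1
    · simp
    have hl := h.lower hn hA hB hμ hν hC hr h1 (h2.trans hR)
    have hI : 0 ≤ ∫ s in Ico r R', s ^ (2 - (n : ℤ)) ∂ν :=
      setIntegral_nonneg measurableSet_Ico fun s hs => by
        have : 0 < s := lt_of_lt_of_le hr hs.1
        positivity
    have hR' : 0 < R' := by linarith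
    have h4 : A * R' ≤ 1 / 4 := (mul_le_mul_of_nonneg_left (h2.trans hR) hA).trans hAr
    have h4' : 0 ≤ A * R' := by positivity
    have h5 : B * Real.exp (C * R') * (R' - r) ≤ C * (R' - r) :=
      mul_le_mul_of_nonneg_right ((mul_le_mul_of_nonneg_left (Real.exp_le_exp.2 h3) hB).trans hCB)
        (by linarith)
    set X := Real.exp (C * R') * (R' ^ (2 - (n : ℤ)) * μ.real (Iio R'))
        - Real.exp (C * r) * (r ^ (2 - (n : ℤ)) * μ.real (Iio r))
    set Y := ∫ s in Ico r R', s ^ (2 - (n : ℤ)) ∂ν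
    have h6 : 0 ≤ X + B * Real.exp (C * R') * (R' - r) := by
      by_contra hneg
      push Not at hneg
      have := mul_neg_of_pos_of_neg (by linarith : 0 < 1 + A * R') hneg
      linarith
    nlinarith
  by_cases h1 : (n : ℝ) - 2 ≤ C * r
  · have := exp_mul_energy_mono hνμ hC0.le hr hrR h1
    have h2 : 0 ≤ C * (R - r) := mul_nonneg hC0.le (by linarith)
    linarith
  by_cases h2 : C * R ≤ n - 2
  · exact small R hrR le_rfl h2
  push Not at h1 h2
  -- The radius at which `exp(C s) s ^ (2 - n)` turns from decreasing to increasing; the two regimes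
  -- are glued there.
  set q := ((n : ℝ) - 2) / C
  have hq : C * q = n - 2 := mul_div_cancel₀ _ hC0.ne'
  have hrq : r ≤ q := le_of_mul_le_mul_left (by linarith) hC0
  have hqR : q ≤ R := le_of_mul_le_mul_left (by linarith) hC0
  have e1 := small q hrq hqR hq.le
  have e2 := exp_mul_energy_mono hνμ hC0.le (lt_of_lt_of_le hr hrq) hqR hq.ge
  have e3 : 0 ≤ C * (R - q) := mul_nonneg hC0.le (by linarith)
  have e4 : ∫ s in Ico r R, s ^ (2 - (n : ℤ)) ∂ν =
      (∫ s in Ico r q, s ^ (2 - (n : ℤ)) ∂ν) + ∫ s in Ico q R, s ^ (2 - (n : ℤ)) ∂ν := by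
    rw [← setIntegral_union _ measurableSet_Ico (integrableOn_zpow_Ico n ν hr q)
      (integrableOn_zpow_Ico n ν (lt_of_lt_of_le hr hrq) R), Ico_union_Ico_eq_Ico hrq hqR]
    exact Set.disjoint_left.2 fun s hs hs' => absurd hs'.1 (not_le.2 hs.2)
  rw [e4]
  linarith

/-- With the inner radius sent to zero, the inner energy may be dropped by its sign, and no factor
`1 / 2` is lost because `1 + A R` is absorbed into the exponential. -/
lemma TestsAgainst.lower_zero {n : ℕ} (hn : 3 ≤ n) {A B r₀ : ℝ} (hA : 0 ≤ A) (hB : 0 ≤ B)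
    (hr₀ : r₀ ≤ 1) {μ ν : Measure ℝ} [IsFiniteMeasure μ] [IsFiniteMeasure ν]
    (hμ : ∀ᵐ s ∂μ, s ∈ Ico 0 r₀) (hν : ∀ᵐ s ∂ν, s ∈ Ico 0 r₀)
    (h : TestsAgainst n A B r₀ μ ν) {C : ℝ} (hC : n * A ≤ C)
    (hCB : B * Real.exp (n * A) ≤ C) {R : ℝ} (hR0 : 0 < R) (hR : R ≤ r₀) :
    ∫ s in Iio R, s ^ (2 - (n : ℤ)) ∂ν ≤
      Real.exp (C * R) * (R ^ (2 - (n : ℤ)) * μ.real (Iio R)) + C * R := by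
  have hn' : (3 : ℝ) ≤ n := by exact_mod_cast hn
  have hC0 : 0 ≤ C := le_trans (by positivity) hC
  set K := Real.exp (C * R) * (R ^ (2 - (n : ℤ)) * μ.real (Iio R)) + C * R with hK
  have hK0 : 0 ≤ K := by positivity
  have key : ∀ r, 0 < r → r < R → ∫ s in Ico r R, s ^ (2 - (n : ℤ)) ∂ν ≤ K := by
    intro r hr hrR
    -- The smallest admissible exponent is used: after absorbing `1 + A R ≤ exp(A R)` it becomes `n
    -- A`, and since `R ≤ 1` the error factor `exp(n A R)` is bounded independently of `C`.
    have hl := h.lower hn hA hB hμ hν (C := (n - 1) * A) le_rfl hr hrR hR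
    refine hl.trans ?_
    have p1 : 0 ≤ Real.exp ((n - 1) * A * r) * (r ^ (2 - (n : ℤ)) * μ.real (Iio r)) := by
      positivity
    have p2 : 1 + A * R ≤ Real.exp (A * R) := by
      linarith [Real.add_one_le_exp (A * R)]
    have p3 : 0 ≤ 1 + A * R := by positivity
    have p4 : Real.exp (A * R) * Real.exp ((n - 1) * A * R) = Real.exp (n * A * R) := by
      rw [← Real.exp_add]; congr 1; ring
    have p5 : Real.exp (n * A * R) ≤ Real.exp (C * R) :=
      Real.exp_le_exp.2 (mul_le_mul_of_nonneg_right hC hR0.le)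
    have p6 : Real.exp (n * A * R) ≤ Real.exp (n * A) :=
      Real.exp_le_exp.2 (mul_le_of_le_one_right (by positivity) (hR.trans hr₀))
    set Φ := R ^ (2 - (n : ℤ)) * μ.real (Iio R)
    have hΦ : 0 ≤ Φ := by positivity
    calc _ ≤ (1 + A * R) * (Real.exp ((n - 1) * A * R) * Φ
          + B * Real.exp ((n - 1) * A * R) * R) := by
          apply mul_le_mul_of_nonneg_left _ p3
          have : B * Real.exp ((n - 1) * A * R) * (R - r) ≤ B * Real.exp ((n - 1) * A * R) * R :=
            mul_le_mul_of_nonneg_left (by linarith) (by positivity)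
          linarith
      _ ≤ Real.exp (A * R) * (Real.exp ((n - 1) * A * R) * Φ
          + B * Real.exp ((n - 1) * A * R) * R) :=
          mul_le_mul_of_nonneg_right p2 (by positivity)
      _ = Real.exp (n * A * R) * Φ + B * Real.exp (n * A * R) * R := by rw [← p4]; ring
      _ ≤ K := by
          apply add_le_add (mul_le_mul_of_nonneg_right p5 hΦ)
          exact mul_le_mul_of_nonneg_right ((mul_le_mul_of_nonneg_left p6 hB).trans hCB) hR0.le
  -- Without integrability the integral takes the default value `0`, and the right side is
  -- nonnegative.
  by_cases hint : IntegrableOn (fun s : ℝ => s ^ (2 - (n : ℤ))) (Iio R) ν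
  swap
  · rw [integral_undef hint]; exact hK0
  -- A possible atom at the origin does not matter, since `0 ^ (2 - n) = 0` by convention.
  have hIoo : ∫ s in Iio R, s ^ (2 - (n : ℤ)) ∂ν = ∫ s in Ioo 0 R, s ^ (2 - (n : ℤ)) ∂ν := by
    refine setIntegral_eq_of_subset_of_ae_sdiff_eq_zero measurableSet_Iio.nullMeasurableSet
      (fun s hs => hs.2) ?_
    filter_upwards [hν] with s hs hs'
    have : s = 0 := by
      by_contra h0
      exact hs'.2 ⟨lt_of_le_of_ne hs.1 (Ne.symm h0), hs'.1⟩
    rw [this, zero_zpow]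
    omega
  have hU : Ioo 0 R = ⋃ k : ℕ, Ico (R / (k + 2)) R := by
    ext s
    simp only [mem_Ioo, mem_iUnion, mem_Ico]
    constructor
    · rintro ⟨h1, h2⟩
      obtain ⟨k, hk⟩ := exists_nat_ge (R / s)
      refine ⟨k, ?_, h2⟩
      rw [div_le_iff₀ (by positivity)]
      rw [div_le_iff₀ h1] at hk
      nlinarith
    · rintro ⟨k, h1, h2⟩
      exact ⟨lt_of_lt_of_le (by positivity) h1, h2⟩
  have hmono : Monotone fun k : ℕ => Ico (R / ((k : ℝ) + 2)) R := by
    intro i j hij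
    have : (i : ℝ) ≤ j := by exact_mod_cast hij
    exact Ico_subset_Ico_left (div_le_div_of_nonneg_left hR0.le (by positivity) (by linarith))
  rw [hIoo, hU]
  have hlim := tendsto_setIntegral_of_monotone (μ := ν) (f := fun s : ℝ => s ^ (2 - (n : ℤ)))
    (fun k : ℕ => (measurableSet_Ico : MeasurableSet (Ico (R / ((k : ℝ) + 2)) R))) hmono
    (hint.mono_set (by rw [← hU]; exact fun s hs => hs.2))
  refine le_of_tendsto' hlim fun k => key _ (by positivity) ?_
  exact div_lt_self hR0 (by have : (0 : ℝ) ≤ k := by positivity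
                            linarith)


open scoped NNReal ENNReal

/-! ### The area formula for Hausdorff measure. -/

section AreaFormula

/-- On `A` the map `F` factors through `G` by a `K`-Lipschitz map, obtained from any right inverse
of `G`; the hypothesis shows that the choice of preimage is irrelevant. It serves to compare a
parametrization with its linearization in both directions. -/
lemma euclideanHausdorffMeasure_image_le {X Y Z : Type*} [MetricSpace Y] [MeasurableSpace Y]
    [BorelSpace Y] [MetricSpace Z] [MeasurableSpace Z] [BorelSpace Z] {F : X → Y} {G : X → Z}
    {A : Set X} {K : ℝ≥0} (h : ∀ x ∈ A, ∀ y ∈ A, dist (F x) (F y) ≤ K * dist (G x) (G y)) (m : ℕ) :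
    μHE[m] (F '' A) ≤ (K : ℝ≥0∞) ^ m * μHE[m] (G '' A) := by
  rcases isEmpty_or_nonempty X with hX | hX
  · simp [Set.eq_empty_of_isEmpty A]
  set H : Z → Y := fun z => F (Function.invFunOn G A z)
  have hinv : ∀ z ∈ G '' A, Function.invFunOn G A z ∈ A ∧ G (Function.invFunOn G A z) = z :=
    fun z hz => ⟨Function.invFunOn_mem hz, Function.invFunOn_eq hz⟩
  have hL : LipschitzOnWith K H (G '' A) := by
    refine LipschitzOnWith.of_dist_le_mul fun z hz w hw => ?_
    have := h _ (hinv z hz).1 _ (hinv w hw).1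
    rwa [(hinv z hz).2, (hinv w hw).2] at this
  have himg : H '' (G '' A) = F '' A := by
    rw [image_image]
    refine image_congr fun a ha => ?_
    have h1 := hinv (G a) ⟨a, ha, rfl⟩
    have := h _ h1.1 a ha
    rw [h1.2, dist_self, mul_zero] at this
    exact dist_le_zero.1 this
  have := hL.hausdorffMeasure_image_le (d := m) (by positivity)
  rw [himg] at this
  simp only [Measure.euclideanHausdorffMeasure_def, Measure.smul_apply, ENNReal.smul_def,
    smul_eq_mul]
  rw [ENNReal.rpow_natCast] at this
  rw [mul_left_comm]
  gcongr

/-- Countably many of the neighborhoods cover the space, and making them disjoint lets the local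
bounds be summed with the same constant. -/
lemma measure_le_smul_of_locally {X : Type*} [TopologicalSpace X] [SecondCountableTopology X]
    [MeasurableSpace X] [OpensMeasurableSpace X] {μ ν : Measure X} {c : ℝ≥0∞}
    (h : ∀ x, ∃ O ∈ 𝓝 x, ∀ A ⊆ O, MeasurableSet A → μ A ≤ c * ν A) {A : Set X}
    (hA : MeasurableSet A) : μ A ≤ c * ν A := by
  rcases isEmpty_or_nonempty X with hX | hX
  · simp [Set.eq_empty_of_isEmpty A]
  choose O hO hle using h
  obtain ⟨t, htc, ht⟩ := TopologicalSpace.countable_cover_nhds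
    (f := fun x => interior (O x)) fun x => interior_mem_nhds.2 (hO x)
  have hne : t.Nonempty := by
    by_contra h
    rw [not_nonempty_iff_eq_empty] at h
    simp [h] at ht
    exact (empty_ne_univ ht).elim
  obtain ⟨s, hs⟩ := htc.exists_eq_range hne
  have hcov : ⋃ k, interior (O (s k)) = univ := by
    rw [← ht, hs, biUnion_range]
  set U : ℕ → Set X := fun k => interior (O (s k))
  have hUm : ∀ k, MeasurableSet (U k) := fun k => isOpen_interior.measurableSet
  have hDm : ∀ k, MeasurableSet (A ∩ disjointed U k) := fun k =>
    hA.inter (MeasurableSet.disjointed hUm k)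
  have hdis : Pairwise (Function.onFun Disjoint fun k => A ∩ disjointed U k) := fun i j hij =>
    (disjoint_disjointed U hij).mono inter_subset_right inter_subset_right
  have hAe : A = ⋃ k, A ∩ disjointed U k := by
    rw [← inter_iUnion, iUnion_disjointed, hcov, inter_univ]
  rw [hAe, measure_iUnion hdis hDm, measure_iUnion hdis hDm, ← ENNReal.tsum_mul_left]
  refine ENNReal.tsum_le_tsum fun k => hle (s k) _ ?_ (hDm k)
  exact inter_subset_right.trans ((disjointed_subset U k).trans interior_subset)

lemma le_of_forall_one_lt_le_mul' {a b : ℝ≥0∞} (h : ∀ c : ℝ, 1 < c → a ≤ ENNReal.ofReal c * b) :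
    a ≤ b := by
  have h1 : Tendsto (fun c : ℝ => ENNReal.ofReal c * b) (𝓝[>] 1) (𝓝 (1 * b)) := by
    refine ENNReal.Tendsto.mul_const ?_ (Or.inl one_ne_zero)
    have : Tendsto ENNReal.ofReal (𝓝 1) (𝓝 (ENNReal.ofReal 1)) :=
      ENNReal.continuous_ofReal.tendsto 1
    rw [ENNReal.ofReal_one] at this
    exact this.mono_left nhdsWithin_le_nhds
  rw [one_mul] at h1
  exact ge_of_tendsto h1 (eventually_mem_nhdsWithin.mono fun c hc => h c hc)

/-- **Area formula** for injective maps with strict derivative everywhere. The differential at `v`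
has the same metric distortion as the linear endomorphism `S v`. -/
theorem euclideanHausdorffMeasure_image_eq {m : ℕ} {E : Type*} [NormedAddCommGroup E]
    [NormedSpace ℝ E] [MeasurableSpace E] [BorelSpace E]
    {γ : EuclideanSpace ℝ (Fin m) → E} (hemb : MeasurableEmbedding γ)
    {D : EuclideanSpace ℝ (Fin m) → EuclideanSpace ℝ (Fin m) →L[ℝ] E}
    (hD : ∀ v, HasStrictFDerivAt γ (D v) v)
    {S : EuclideanSpace ℝ (Fin m) → EuclideanSpace ℝ (Fin m) →ₗ[ℝ] EuclideanSpace ℝ (Fin m)}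
    (hS : ∀ v x, ‖S v x‖ = ‖D v x‖) (hS1 : ∀ v x, ‖x‖ ≤ ‖S v x‖)
    {J : EuclideanSpace ℝ (Fin m) → ℝ} (hJ : Continuous J) (hJ1 : ∀ v, 1 ≤ J v)
    (hdet : ∀ v, |LinearMap.det (S v)| = J v) {A : Set (EuclideanSpace ℝ (Fin m))}
    (hA : MeasurableSet A) :
    μHE[m] (γ '' A) = ∫⁻ v in A, ENNReal.ofReal (J v) := by
  set μ₁ : Measure (EuclideanSpace ℝ (Fin m)) := (μHE[m]).comap γ with hμ₁
  set μ₂ : Measure (EuclideanSpace ℝ (Fin m)) := volume.withDensity fun v => ENNReal.ofReal (J v) with hμ₂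
  have e₁ : ∀ B, MeasurableSet B → μ₁ B = μHE[m] (γ '' B) := fun B hB =>
    hemb.comap_apply _ _
  have e₂ : ∀ B, MeasurableSet B → μ₂ B = ∫⁻ v in B, ENNReal.ofReal (J v) := fun B hB =>
    withDensity_apply _ hB
  rw [← e₁ A hA, ← e₂ A hA]
  have hSv : ∀ v (B : Set (EuclideanSpace ℝ (Fin m))), μHE[m] (S v '' B) = ENNReal.ofReal (J v) * volume B := by
    intro v B
    rw [EuclideanSpace.euclideanHausdorffMeasure_eq_volume, Measure.addHaar_image_linearMap, hdet]
  -- Strict differentiability makes `γ` and the linear map `S v` bilipschitz equivalent near `v`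
  -- with constants close to `1`, the expansion bound `hS1` turning the absolute error into a
  -- relative one. For `S v` the measure of the image is the determinant times the volume, and `J`
  -- varies little near `v`.
  have main : ∀ κ : ℝ, 1 < κ → ∀ v, ∃ O ∈ 𝓝 v, ∀ B ⊆ O, MeasurableSet B →
      μ₁ B ≤ ENNReal.ofReal κ * μ₂ B ∧ μ₂ B ≤ ENNReal.ofReal κ * μ₁ B := by
    intro κ hκ v
    obtain ⟨c, hc0, hc1, hcκ, hcκ'⟩ : ∃ c : ℝ, 0 < c ∧ c < 1 ∧ (1 + c) ^ m * (1 + c) ≤ κ ∧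
        ((1 - c)⁻¹) ^ m * (1 + c) ≤ κ := by
      have t1 : Tendsto (fun c : ℝ => (1 + c) ^ m * (1 + c)) (𝓝[>] 0) (𝓝 1) := by
        have : ContinuousAt (fun c : ℝ => (1 + c) ^ m * (1 + c)) 0 := by fun_prop
        simpa [ContinuousAt] using this.tendsto.mono_left (nhdsWithin_le_nhds (s := Ioi 0))
      have t2 : Tendsto (fun c : ℝ => ((1 - c)⁻¹) ^ m * (1 + c)) (𝓝[>] 0) (𝓝 1) := by
        have : ContinuousAt (fun c : ℝ => ((1 - c)⁻¹) ^ m * (1 + c)) 0 := by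
          have : ContinuousAt (fun c : ℝ => (1 - c)⁻¹) 0 :=
            ContinuousAt.inv₀ (by fun_prop) (by simp)
          fun_prop
        simpa [ContinuousAt] using this.tendsto.mono_left (nhdsWithin_le_nhds (s := Ioi 0))
      have t3 : ∀ᶠ c : ℝ in 𝓝[>] 0, c < 1 :=
        nhdsWithin_le_nhds (Iio_mem_nhds one_pos)
      obtain ⟨c, h1, h2, h3, h4⟩ := (((t1.eventually (Iio_mem_nhds hκ)).and
        (t2.eventually (Iio_mem_nhds hκ))).and (t3.and eventually_mem_nhdsWithin)).exists.imp
          fun c h => And.intro h.2.2 (And.intro h.2.1 (And.intro h.1.1.le h.1.2.le))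
      exact ⟨c, h1, h2, h3, h4⟩
    have hd := (hD v).isLittleO.def hc0
    rw [nhds_prod_eq] at hd
    obtain ⟨O₁, hO₁, hsub⟩ := mem_prod_self_iff.1 hd
    replace hd : ∀ x ∈ O₁, ∀ y ∈ O₁, ‖γ x - γ y - D v (x - y)‖ ≤ c * ‖x - y‖ :=
      fun x hx y hy => hsub (mk_mem_prod hx hy)
    have hJv : 0 < J v := lt_of_lt_of_le one_pos (hJ1 v)
    have hO₂ : ∀ᶠ w in 𝓝 v, J w ≤ (1 + c) * J v ∧ J v ≤ (1 + c) * J w := by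
      have a1 : J v < (1 + c) * J v := by nlinarith
      refine (hJ.continuousAt.eventually (Iio_mem_nhds a1)).mono (fun w hw => le_of_lt hw)
        |>.and ?_
      have a2 : Continuous fun w => (1 + c) * J w := by fun_prop
      exact (a2.continuousAt.eventually (Ioi_mem_nhds a1)).mono (fun w hw => le_of_lt hw)
    refine ⟨O₁ ∩ {w | J w ≤ (1 + c) * J v ∧ J v ≤ (1 + c) * J w}, inter_mem hO₁ hO₂,
      fun B hB hBm => ?_⟩
    have up : ∀ x ∈ B, ∀ y ∈ B, dist (γ x) (γ y) ≤ Real.toNNReal (1 + c) *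
        dist (S v x) (S v y) := by
      intro x hx y hy
      have h1 := hd x (hB hx).1 y (hB hy).1
      have h2 := hS1 v (x - y)
      simp only [dist_eq_norm, ← map_sub]
      rw [Real.coe_toNNReal _ (by linarith)]
      have h3 : ‖γ x - γ y‖ ≤ ‖γ x - γ y - D v (x - y)‖ + ‖D v (x - y)‖ := by
        simpa using norm_add_le (γ x - γ y - D v (x - y)) (D v (x - y))
      rw [← hS] at h3
      nlinarith
    have dn : ∀ x ∈ B, ∀ y ∈ B, dist (S v x) (S v y) ≤
        Real.toNNReal ((1 - c)⁻¹) * dist (γ x) (γ y) := by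
      intro x hx y hy
      have h1 := hd x (hB hx).1 y (hB hy).1
      have h2 := hS1 v (x - y)
      simp only [dist_eq_norm, ← map_sub]
      rw [Real.coe_toNNReal _ (inv_nonneg.2 (by linarith))]
      have h3 : ‖D v (x - y)‖ ≤ ‖γ x - γ y - D v (x - y)‖ + ‖γ x - γ y‖ := by
        rw [norm_sub_rev (γ x - γ y)]
        simpa using norm_add_le (D v (x - y) - (γ x - γ y)) (γ x - γ y)
      rw [← hS] at h3
      rw [inv_mul_eq_div, le_div_iff₀ (by linarith)]
      nlinarith
    have up' := euclideanHausdorffMeasure_image_le up m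
    have dn' := euclideanHausdorffMeasure_image_le dn m
    rw [hSv] at up' dn'
    have k1 : ENNReal.ofReal (J v) * volume B ≤ ENNReal.ofReal (1 + c) * μ₂ B := by
      rw [e₂ B hBm, ← setLIntegral_const, ← lintegral_const_mul' _ _ ENNReal.ofReal_ne_top]
      refine setLIntegral_mono' hBm fun w hw => ?_
      rw [← ENNReal.ofReal_mul (by positivity)]
      exact ENNReal.ofReal_le_ofReal (hB hw).2.2
    have k2 : μ₂ B ≤ ENNReal.ofReal (1 + c) * (ENNReal.ofReal (J v) * volume B) := by
      rw [e₂ B hBm, ← mul_assoc, ← setLIntegral_const, ← ENNReal.ofReal_mul (by positivity)]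
      exact setLIntegral_mono' hBm fun w hw => ENNReal.ofReal_le_ofReal (hB hw).2.1
    change _ ≤ ENNReal.ofReal (1 + c) ^ m * _ at up'
    change _ ≤ ENNReal.ofReal ((1 - c)⁻¹) ^ m * _ at dn'
    have hinv0 : 0 ≤ (1 - c)⁻¹ := inv_nonneg.2 (by linarith)
    constructor
    · rw [e₁ B hBm]
      calc _ ≤ _ := up'
        _ ≤ ENNReal.ofReal (1 + c) ^ m * (ENNReal.ofReal (1 + c) * μ₂ B) := by gcongr
        _ = ENNReal.ofReal ((1 + c) ^ m * (1 + c)) * μ₂ B := by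
            rw [ENNReal.ofReal_mul (by positivity), ENNReal.ofReal_pow (by positivity), mul_assoc]
        _ ≤ _ := by gcongr
    · calc _ ≤ _ := k2
        _ ≤ ENNReal.ofReal (1 + c) * (ENNReal.ofReal ((1 - c)⁻¹) ^ m * μHE[m] (γ '' B)) := by
            gcongr
        _ = ENNReal.ofReal (((1 - c)⁻¹) ^ m * (1 + c)) * μ₁ B := by
            rw [e₁ B hBm, ENNReal.ofReal_mul (by positivity), ENNReal.ofReal_pow hinv0]
            ring
        _ ≤ _ := by gcongr
  apply le_antisymm
  · refine le_of_forall_one_lt_le_mul' fun κ hκ => measure_le_smul_of_locally (fun v => ?_) hA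
    obtain ⟨O, hO, h⟩ := main κ hκ v
    exact ⟨O, hO, fun B hB hBm => (h B hB hBm).1⟩
  · refine le_of_forall_one_lt_le_mul' fun κ hκ => measure_le_smul_of_locally (fun v => ?_) hA
    obtain ⟨O, hO, h⟩ := main κ hκ v
    exact ⟨O, hO, fun B hB hBm => (h B hB hBm).2⟩

end AreaFormula


/-! ### Coordinates adapted to a normal direction, and surface integrals over graphs. -/

section Coordinates

/-- Isometric coordinates splitting off one direction. -/
abbrev Splitting (m : ℕ) :=
  EuclideanSpace ℝ (Fin (m + 1)) ≃ₗᵢ[ℝ] WithLp 2 (EuclideanSpace ℝ (Fin m) × ℝ)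

variable {m : ℕ} (e : Splitting m)

/-- The horizontal coordinates. -/
noncomputable def hor : EuclideanSpace ℝ (Fin (m + 1)) →L[ℝ] EuclideanSpace ℝ (Fin m) :=
  (WithLp.fstL 2 ℝ (EuclideanSpace ℝ (Fin m)) ℝ).comp e.toContinuousLinearEquiv.toContinuousLinearMap

/-- The vertical coordinate. -/
noncomputable def ver : EuclideanSpace ℝ (Fin (m + 1)) →L[ℝ] ℝ :=
  (WithLp.sndL 2 ℝ (EuclideanSpace ℝ (Fin m)) ℝ).comp e.toContinuousLinearEquiv.toContinuousLinearMap

/-- The point with given coordinates. -/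
noncomputable def pt (v : EuclideanSpace ℝ (Fin m)) (t : ℝ) : EuclideanSpace ℝ (Fin (m + 1)) :=
  e.symm (WithLp.toLp 2 (v, t))

/-- The inclusion of the horizontal hyperplane. -/
noncomputable def incl : EuclideanSpace ℝ (Fin m) →L[ℝ] EuclideanSpace ℝ (Fin (m + 1)) :=
  e.symm.toContinuousLinearEquiv.toContinuousLinearMap.comp
    ((WithLp.prodContinuousLinearEquiv 2 ℝ (EuclideanSpace ℝ (Fin m)) ℝ).symm.toContinuousLinearMap.comp
      (ContinuousLinearMap.inl ℝ (EuclideanSpace ℝ (Fin m)) ℝ))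

/-- The unit vector in the vertical direction. -/
noncomputable def axis : EuclideanSpace ℝ (Fin (m + 1)) := pt e 0 1

@[simp] lemma hor_pt (v : EuclideanSpace ℝ (Fin m)) (t : ℝ) : hor e (pt e v t) = v := by
  simp [hor, pt]

@[simp] lemma ver_pt (v : EuclideanSpace ℝ (Fin m)) (t : ℝ) : ver e (pt e v t) = t := by
  simp [ver, pt]

@[simp] lemma pt_hor_ver (x : EuclideanSpace ℝ (Fin (m + 1))) : pt e (hor e x) (ver e x) = x := by
  apply e.injective
  simp only [pt, LinearIsometryEquiv.apply_symm_apply]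
  rfl

lemma incl_eq_pt (v : EuclideanSpace ℝ (Fin m)) : incl e v = pt e v 0 := rfl

lemma ext_coord {x y : EuclideanSpace ℝ (Fin (m + 1))} (h1 : hor e x = hor e y)
    (h2 : ver e x = ver e y) : x = y := by
  rw [← pt_hor_ver e x, ← pt_hor_ver e y, h1, h2]

@[simp] lemma hor_incl (v : EuclideanSpace ℝ (Fin m)) : hor e (incl e v) = v := by
  simp [incl_eq_pt]

@[simp] lemma ver_incl (v : EuclideanSpace ℝ (Fin m)) : ver e (incl e v) = 0 := by
  simp [incl_eq_pt]

@[simp] lemma hor_axis : hor e (axis e) = 0 := by simp [axis]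

@[simp] lemma ver_axis : ver e (axis e) = 1 := by simp [axis]

lemma pt_eq (v : EuclideanSpace ℝ (Fin m)) (t : ℝ) : pt e v t = incl e v + t • axis e := by
  apply ext_coord e <;> simp

lemma incl_hor_add (x : EuclideanSpace ℝ (Fin (m + 1))) :
    incl e (hor e x) + ver e x • axis e = x := by
  rw [← pt_eq, pt_hor_ver]

lemma inner_eq_coord (x y : EuclideanSpace ℝ (Fin (m + 1))) :
    ⟪x, y⟫_ℝ = ⟪hor e x, hor e y⟫_ℝ + ver e x * ver e y := by
  rw [← e.inner_map_map, WithLp.prod_inner_apply]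
  simp [hor, ver, mul_comm]

lemma norm_sq_eq_coord (x : EuclideanSpace ℝ (Fin (m + 1))) :
    ‖x‖ ^ 2 = ‖hor e x‖ ^ 2 + ver e x ^ 2 := by
  rw [← real_inner_self_eq_norm_sq, inner_eq_coord e, real_inner_self_eq_norm_sq]; ring

lemma norm_hor_le (x : EuclideanSpace ℝ (Fin (m + 1))) : ‖hor e x‖ ≤ ‖x‖ :=
  (sq_le_sq₀ (norm_nonneg _) (norm_nonneg _)).1 <| by
    rw [norm_sq_eq_coord e x]; nlinarith [sq_nonneg (ver e x)]

lemma abs_ver_le (x : EuclideanSpace ℝ (Fin (m + 1))) : |ver e x| ≤ ‖x‖ := by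
  apply abs_le_of_sq_le_sq _ (norm_nonneg x)
  rw [norm_sq_eq_coord e x]; nlinarith [sq_nonneg ‖hor e x‖]

lemma norm_axis : ‖axis e‖ = 1 := by
  have := norm_sq_eq_coord e (axis e)
  rw [← sq_eq_sq₀ (norm_nonneg _) zero_le_one]
  simpa using this

lemma inner_axis (x : EuclideanSpace ℝ (Fin (m + 1))) : ⟪x, axis e⟫_ℝ = ver e x := by
  rw [inner_eq_coord e]; simp

@[simp] lemma norm_incl (v : EuclideanSpace ℝ (Fin m)) : ‖incl e v‖ = ‖v‖ := by
  have := norm_sq_eq_coord e (incl e v)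
  simpa using this

lemma measurePreserving_pt :
    MeasurePreserving (fun p : EuclideanSpace ℝ (Fin m) × ℝ => pt e p.1 p.2)
      (volume.prod volume) volume :=
  e.symm.measurePreserving.comp (WithLp.volume_preserving_toLp (EuclideanSpace ℝ (Fin m)) ℝ)

lemma isClosedEmbedding_pt :
    IsClosedEmbedding (fun p : EuclideanSpace ℝ (Fin m) × ℝ => pt e p.1 p.2) :=
  (e.symm.toHomeomorph.isClosedEmbedding).comp
    (WithLp.prodContinuousLinearEquiv 2 ℝ (EuclideanSpace ℝ (Fin m)) ℝ).symm.toHomeomorph.isClosedEmbedding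

lemma continuous_pt : Continuous (fun p : EuclideanSpace ℝ (Fin m) × ℝ => pt e p.1 p.2) :=
  (isClosedEmbedding_pt e).continuous

lemma exists_splitting {ν : EuclideanSpace ℝ (Fin (m + 1))} (hν : ‖ν‖ = 1) :
    ∃ e : Splitting m, axis e = ν := by
  have hf : Module.finrank ℝ (WithLp 2 (EuclideanSpace ℝ (Fin m) × ℝ)) = m + 1 := by
    rw [(WithLp.linearEquiv 2 ℝ (EuclideanSpace ℝ (Fin m) × ℝ)).finrank_eq]
    simp
  let b := (stdOrthonormalBasis ℝ (WithLp 2 (EuclideanSpace ℝ (Fin m) × ℝ))).reindex (finCongr hf)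
  let e₀ : Splitting m := b.repr.symm
  have h0 : ‖axis e₀‖ = ‖ν‖ := by rw [norm_axis, hν]
  -- An arbitrary splitting is corrected by the reflection that exchanges its axis with `ν`.
  let ρ := (ℝ ∙ (axis e₀ - ν))ᗮ.reflection
  have hρ : ρ (axis e₀) = ν := Submodule.reflection_sub h0
  refine ⟨ρ.symm.trans e₀, ?_⟩
  rw [← hρ]
  rfl

/-- The graph parametrization. -/
noncomputable def graphMap (f : EuclideanSpace ℝ (Fin m) → ℝ) (v : EuclideanSpace ℝ (Fin m)) :
    EuclideanSpace ℝ (Fin (m + 1)) := pt e v (f v)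

/-- The upward normal of the graph, not normalized. -/
noncomputable def graphNormal (f : EuclideanSpace ℝ (Fin m) → ℝ) (v : EuclideanSpace ℝ (Fin m)) :
    EuclideanSpace ℝ (Fin (m + 1)) := axis e - incl e (gradient f v)

/-- The area density of the graph. -/
noncomputable def graphJac (f : EuclideanSpace ℝ (Fin m) → ℝ) (v : EuclideanSpace ℝ (Fin m)) : ℝ :=
  √(1 + ‖gradient f v‖ ^ 2)

variable {f : EuclideanSpace ℝ (Fin m) → ℝ}

@[simp] lemma hor_graphMap (v : EuclideanSpace ℝ (Fin m)) : hor e (graphMap e f v) = v := hor_pt _ _ _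

@[simp] lemma ver_graphMap (v : EuclideanSpace ℝ (Fin m)) : ver e (graphMap e f v) = f v :=
  ver_pt _ _ _

lemma inner_graphNormal (a : EuclideanSpace ℝ (Fin (m + 1))) (v : EuclideanSpace ℝ (Fin m)) :
    ⟪a, graphNormal e f v⟫_ℝ = ver e a - fderiv ℝ f v (hor e a) := by
  rw [graphNormal, inner_sub_right, inner_axis, inner_eq_coord e, hor_incl, ver_incl,
    real_inner_comm, inner_gradient_left]; simp

lemma norm_graphNormal (v : EuclideanSpace ℝ (Fin m)) : ‖graphNormal e f v‖ = graphJac f v := by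
  rw [graphJac, eq_comm, Real.sqrt_eq_iff_mul_self_eq (by positivity) (norm_nonneg _), ← sq,
    norm_sq_eq_coord e]
  simp [graphNormal]; ring

lemma one_le_graphJac (v : EuclideanSpace ℝ (Fin m)) : 1 ≤ graphJac f v :=
  Real.one_le_sqrt.2 (by nlinarith [sq_nonneg ‖gradient f v‖])

lemma contDiff_gradient (hf : ContDiff ℝ ∞ f) : ContDiff ℝ ∞ (gradient f) :=
  (InnerProductSpace.toDual ℝ (EuclideanSpace ℝ (Fin m))).symm.contDiff.comp
    (hf.fderiv_right (by simp))

lemma contDiff_graphJac (hf : ContDiff ℝ ∞ f) : ContDiff ℝ ∞ (graphJac f) := by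
  refine ContDiff.sqrt (contDiff_const.add ((contDiff_gradient hf).norm_sq ℝ)) fun v => ?_
  positivity

lemma contDiff_graphMap (hf : ContDiff ℝ ∞ f) : ContDiff ℝ ∞ (graphMap e f) := by
  have : graphMap e f = fun v => incl e v + f v • axis e := funext fun v => pt_eq _ _ _
  rw [this]; fun_prop

lemma hasFDerivAt_graphMap (hf : ContDiff ℝ ∞ f) (v : EuclideanSpace ℝ (Fin m)) :
    HasFDerivAt (graphMap e f) (incl e + (fderiv ℝ f v).smulRight (axis e)) v := by
  have : graphMap e f = fun v => incl e v + f v • axis e := funext fun v => pt_eq _ _ _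
  rw [this]
  exact (incl e).hasFDerivAt.add
    (((hf.differentiable (by simp)) v).hasFDerivAt.smul_const _)

lemma isClosedEmbedding_graphMap (hf : ContDiff ℝ ∞ f) : IsClosedEmbedding (graphMap e f) := by
  have hc := (contDiff_graphMap e hf).continuous
  have hl : Function.LeftInverse (hor e) (graphMap e f) := hor_graphMap e
  exact hl.isClosedEmbedding (hor e).continuous hc

/-- **Area formula** for graphs. -/
theorem euclideanHausdorffMeasure_graph (hf : ContDiff ℝ ∞ f)
    {A : Set (EuclideanSpace ℝ (Fin m))} (hA : MeasurableSet A) :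
    μHE[m] (graphMap e f '' A) = ∫⁻ v in A, ENNReal.ofReal (graphJac f v) := by
  -- This is the symmetric square root of the Gram matrix `1 + ∇f ⊗ ∇f`: the coefficient `1 / (1 +
  -- J)` solves `2 c + c² |∇f|² = 1` because `|∇f|² = J² - 1`. As a rank-one perturbation of the
  -- identity it has determinant `1 + c |∇f|² = J`.
  set S : EuclideanSpace ℝ (Fin m) → EuclideanSpace ℝ (Fin m) →ₗ[ℝ] EuclideanSpace ℝ (Fin m) :=
    fun v => LinearMap.transvection ((1 / (1 + graphJac f v)) • (fderiv ℝ f v : _ →ₗ[ℝ] ℝ))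
      (gradient f v) with hS
  have hJ1 : ∀ v, 1 ≤ graphJac f v := one_le_graphJac
  have hJ2 : ∀ v, graphJac f v ^ 2 = 1 + ‖gradient f v‖ ^ 2 := fun v =>
    Real.sq_sqrt (by positivity)
  have hSx : ∀ v x, S v x = x + (1 / (1 + graphJac f v) * fderiv ℝ f v x) • gradient f v := by
    intro v x
    simp [hS, LinearMap.transvection.apply]
  have hn : ∀ v x, ‖S v x‖ ^ 2 = ‖x‖ ^ 2 + (fderiv ℝ f v x) ^ 2 := by
    intro v x
    have h0 : 0 < 1 + graphJac f v := by linarith [hJ1 v]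
    rw [hSx, norm_add_sq_real, norm_smul, inner_smul_right, real_inner_comm, inner_gradient_left,
      mul_pow, Real.norm_eq_abs, sq_abs]
    have := hJ2 v
    field_simp
    linear_combination (- (fderiv ℝ f v x) ^ 2) * this
  have hD : ∀ v x, ‖(incl e + (fderiv ℝ f v).smulRight (axis e)) x‖ ^ 2 =
      ‖x‖ ^ 2 + (fderiv ℝ f v x) ^ 2 := by
    intro v x
    rw [norm_sq_eq_coord e]; simp
  refine euclideanHausdorffMeasure_image_eq (isClosedEmbedding_graphMap e hf).measurableEmbedding
    (D := fun v => incl e + (fderiv ℝ f v).smulRight (axis e)) (S := S)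
    (fun v => ?_) (fun v x => ?_) (fun v x => ?_) (contDiff_graphJac hf).continuous hJ1
    (fun v => ?_) hA
  · have h1 := (contDiff_graphMap e hf).contDiffAt (x := v) |>.hasStrictFDerivAt (by simp)
    rwa [(hasFDerivAt_graphMap e hf v).fderiv] at h1
  · rw [← sq_eq_sq₀ (norm_nonneg _) (norm_nonneg _), hn, hD]
  · rw [← sq_le_sq₀ (norm_nonneg _) (norm_nonneg _), hn]; nlinarith [sq_nonneg (fderiv ℝ f v x)]
  · have h0 : 0 < 1 + graphJac f v := by linarith [hJ1 v]
    have h3 : (fderiv ℝ f v) (gradient f v) = ‖gradient f v‖ ^ 2 := by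
      rw [← inner_gradient_left, real_inner_self_eq_norm_sq]
    have : LinearMap.det (S v) = graphJac f v := by
      rw [hS, LinearMap.transvection.det]
      simp only [LinearMap.smul_apply, ContinuousLinearMap.coe_coe, h3, smul_eq_mul]
      field_simp
      linear_combination - hJ2 v
    rw [this, abs_of_nonneg (by linarith [hJ1 v])]

/-- Surface integrals over pieces of a graph. -/
theorem setIntegral_graph (hf : ContDiff ℝ ∞ f) {A : Set (EuclideanSpace ℝ (Fin m))}
    (hA : MeasurableSet A) (F : EuclideanSpace ℝ (Fin (m + 1)) → ℝ) :
    ∫ x in graphMap e f '' A, F x ∂μHE[m] = ∫ v in A, F (graphMap e f v) * graphJac f v := by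
  have hemb := (isClosedEmbedding_graphMap e hf).measurableEmbedding
  have hJ : Measurable (graphJac f) := (contDiff_graphJac hf).continuous.measurable
  have h1 : (μHE[m]).comap (graphMap e f) =
      volume.withDensity fun v => ENNReal.ofReal (graphJac f v) := by
    ext B hB
    rw [hemb.comap_apply, withDensity_apply _ hB, euclideanHausdorffMeasure_graph e hf hB]
  have h2 : (μHE[m]).restrict (graphMap e f '' A) =
      (((μHE[m]).comap (graphMap e f)).restrict A).map (graphMap e f) := by
    have h3 := hemb.restrict_map ((μHE[m]).comap (graphMap e f)) (graphMap e f '' A)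
    rw [hemb.map_comap, Measure.restrict_restrict (hemb.measurableSet_image.2 hA),
      inter_eq_left.2 (image_subset_range _ _), preimage_image_eq _ hemb.injective] at h3
    exact h3
  rw [h2, hemb.integral_map, h1, restrict_withDensity hA,
    integral_withDensity_eq_integral_toReal_smul (by fun_prop) (by simp)]
  refine integral_congr_ae (.of_forall fun v => ?_)
  simp only [smul_eq_mul]
  rw [ENNReal.toReal_ofReal (zero_le_one.trans (one_le_graphJac v)), mul_comm]

end Coordinates


/-! ### The divergence theorem below a graph. -/

section Divergence

/-- A smooth cutoff equal to `1` on `(-∞, -2]` and to `0` on `[-1, ∞)`. -/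
noncomputable def belowCutoff (s : ℝ) : ℝ := Real.smoothTransition (-1 - s)

lemma contDiff_belowCutoff : ContDiff ℝ ∞ belowCutoff :=
  Real.smoothTransition.contDiff.comp (contDiff_const.sub contDiff_id)

lemma belowCutoff_eq_one {s : ℝ} (h : s ≤ -2) : belowCutoff s = 1 :=
  Real.smoothTransition.one_of_one_le (by linarith)

lemma belowCutoff_eq_zero {s : ℝ} (h : -1 ≤ s) : belowCutoff s = 0 :=
  Real.smoothTransition.zero_of_nonpos (by linarith)

lemma abs_belowCutoff_le (s : ℝ) : |belowCutoff s| ≤ 1 := by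
  rw [belowCutoff, abs_of_nonneg (Real.smoothTransition.nonneg _)]
  exact Real.smoothTransition.le_one _

lemma deriv_belowCutoff_eq_zero {s : ℝ} (h : s ∉ Icc (-2 : ℝ) (-1)) : deriv belowCutoff s = 0 := by
  simp only [mem_Icc, not_and_or, not_le] at h
  rcases h with h | h
  · have : belowCutoff =ᶠ[𝓝 s] fun _ => 1 := by
      filter_upwards [Iio_mem_nhds h] with x hx using belowCutoff_eq_one (le_of_lt hx)
    rw [this.deriv_eq, deriv_const]
  · have : belowCutoff =ᶠ[𝓝 s] fun _ => 0 := by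
      filter_upwards [Ioi_mem_nhds h] with x hx using belowCutoff_eq_zero (le_of_lt hx)
    rw [this.deriv_eq, deriv_const]

lemma continuous_deriv_belowCutoff : Continuous (deriv belowCutoff) :=
  contDiff_belowCutoff.continuous_deriv (by simp)

lemma exists_deriv_belowCutoff_le : ∃ C, 0 ≤ C ∧ ∀ s, |deriv belowCutoff s| ≤ C := by
  obtain ⟨C, hC⟩ := (isCompact_Icc.image (s := Icc (-2 : ℝ) (-1))
    continuous_deriv_belowCutoff).isBounded.exists_norm_le
  have h0 : 0 ≤ C := (norm_nonneg _).trans (hC _ ⟨-1, by norm_num, rfl⟩)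
  refine ⟨C, h0, fun s => ?_⟩
  by_cases hs : s ∈ Icc (-2 : ℝ) (-1)
  · exact hC _ ⟨s, hs, rfl⟩
  · rwa [deriv_belowCutoff_eq_zero hs, abs_zero]

lemma integral_deriv_belowCutoff : ∫ s in (-2 : ℝ)..(-1), deriv belowCutoff s = -1 := by
  rw [intervalIntegral.integral_deriv_eq_sub
    (fun x _ => (contDiff_belowCutoff.differentiable (by simp)) x)
    (continuous_deriv_belowCutoff.intervalIntegrable _ _), belowCutoff_eq_zero le_rfl,
    belowCutoff_eq_one le_rfl]
  norm_num

variable {m : ℕ} (e : Splitting m) {f : EuclideanSpace ℝ (Fin m) → ℝ}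

/-- The height above the graph. -/
noncomputable def height (f : EuclideanSpace ℝ (Fin m) → ℝ) (x : EuclideanSpace ℝ (Fin (m + 1))) : ℝ :=
  ver e x - f (hor e x)

lemma hasFDerivAt_height (hf : ContDiff ℝ ∞ f) (x : EuclideanSpace ℝ (Fin (m + 1))) :
    HasFDerivAt (height e f) (ver e - (fderiv ℝ f (hor e x)).comp (hor e)) x :=
  (ver e).hasFDerivAt.sub
    (((hf.differentiable (by simp)) (hor e x)).hasFDerivAt.comp x (hor e).hasFDerivAt)

lemma continuous_height (hf : ContDiff ℝ ∞ f) : Continuous (height e f) :=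
  continuous_iff_continuousAt.2 fun x => (hasFDerivAt_height e hf x).continuousAt

lemma height_pt (v : EuclideanSpace ℝ (Fin m)) (t : ℝ) : height e f (pt e v t) = t - f v := by
  simp [height]

/-- The **divergence theorem** on the region below a graph, for a single partial derivative of a
function with compact support in the region `U` where the domain is a subgraph. -/
theorem integral_fderiv_subgraph (hf : ContDiff ℝ ∞ f)
    {Ω U K : Set (EuclideanSpace ℝ (Fin (m + 1)))} (hΩo : IsOpen Ω) (hU : IsOpen U)
    (hg : ∀ x ∈ U, x ∈ Ω ↔ height e f x < 0) (hK : IsCompact K) (hKU : K ⊆ U)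
    {ζ : EuclideanSpace ℝ (Fin (m + 1)) → ℝ} (h0 : ∀ x ∉ K, ζ x = 0)
    (hc : ContinuousOn ζ {x | x ∈ U ∧ height e f x ≤ 0})
    (hd : ∀ x ∈ Ω ∩ U, DifferentiableAt ℝ ζ x) {M : ℝ}
    (hM : ∀ x ∈ Ω ∩ U, ‖fderiv ℝ ζ x‖ ≤ M) (a : EuclideanSpace ℝ (Fin (m + 1))) :
    ∫ x in Ω, fderiv ℝ ζ x a =
      ∫ v, ζ (graphMap e f v) * ⟪a, graphNormal e f v⟫_ℝ := by
  have hs := continuous_height e hf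
  have hKz : ∀ x ∉ K, ζ =ᶠ[𝓝 x] fun _ => 0 := fun x hx => by
    filter_upwards [hK.isClosed.isOpen_compl.mem_nhds hx] with y hy using h0 y hy
  have hKf : ∀ x ∉ K, fderiv ℝ ζ x = 0 := fun x hx => by
    rw [(hKz x hx).fderiv_eq, fderiv_fun_const]; rfl
  have hζc : ∀ x, height e f x < 0 → ContinuousAt ζ x := by
    intro x hx
    by_cases hxU : x ∈ U
    · exact (hd x ⟨(hg x hxU).2 hx, hxU⟩).continuousAt
    · exact continuousAt_const.congr (hKz x (fun h => hxU (hKU h))).symm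
  obtain ⟨Mζ, hMζ0, hMζ⟩ : ∃ Mζ, 0 ≤ Mζ ∧ ∀ x, height e f x ≤ 0 → |ζ x| ≤ Mζ := by
    obtain ⟨C, hC⟩ := ((hK.inter_right (isClosed_le hs continuous_const)).image_of_continuousOn
      (hc.mono fun x hx => ⟨hKU hx.1, hx.2⟩)).isBounded.exists_norm_le
    refine ⟨max C 0, le_max_right _ _, fun x hx => ?_⟩
    by_cases hxK : x ∈ K
    · exact (hC _ ⟨x, ⟨hxK, hx⟩, rfl⟩).trans (le_max_left _ _)
    · rw [h0 x hxK, abs_zero]; exact le_max_right _ _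
  have hMall : ∀ x ∈ Ω, ‖fderiv ℝ ζ x‖ ≤ max M 0 := by
    intro x hx
    by_cases hxU : x ∈ U
    · exact (hM x ⟨hx, hxU⟩).trans (le_max_left _ _)
    · rw [hKf x (fun h => hxU (hKU h)), norm_zero]; exact le_max_right _ _
  obtain ⟨Cχ, hCχ0, hCχ⟩ := exists_deriv_belowCutoff_le
  set c : EuclideanSpace ℝ (Fin m) → ℝ := fun v => ⟪a, graphNormal e f v⟫_ℝ with hcdef
  have hcc : Continuous c := by
    have : Continuous (graphNormal e f) := by
      unfold graphNormal
      exact continuous_const.sub ((incl e).continuous.comp (contDiff_gradient hf).continuous)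
    exact continuous_const.inner this
  have hK' : IsCompact (hor e '' K) := hK.image (hor e).continuous
  obtain ⟨Cc, hCc⟩ := (hK'.image hcc).isBounded.exists_norm_le
  replace hCc : ∀ x ∈ K, |c (hor e x)| ≤ max Cc 0 := fun x hx =>
    (hCc _ ⟨_, ⟨x, hx, rfl⟩, rfl⟩).trans (le_max_left _ _)
  have hCc0 : 0 ≤ max Cc 0 := le_max_right _ _
  -- The cutoff removes a layer of thickness of order `1 / κ` below the graph, so `ζ` need not be
  -- differentiable up to the boundary. In the derivative of `χ ζ`, the part `G1` tends to the bulk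
  -- integrand and `G2` concentrates on the graph.
  set χ : ℝ → EuclideanSpace ℝ (Fin (m + 1)) → ℝ := fun κ x => belowCutoff (κ * height e f x)
    with hχdef
  set G1 : ℝ → EuclideanSpace ℝ (Fin (m + 1)) → ℝ := fun κ x => χ κ x * fderiv ℝ ζ x a with hG1
  set G2 : ℝ → EuclideanSpace ℝ (Fin (m + 1)) → ℝ := fun κ x =>
    ζ x * (deriv belowCutoff (κ * height e f x) * (κ * c (hor e x))) with hG2
  -- On and above the graph nothing is assumed about the derivative of `ζ`, but there the cutoff
  -- vanishes in a whole neighborhood.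
  have hder : ∀ κ, 0 < κ → ∀ x, HasFDerivAt (fun x => χ κ x * ζ x)
      (χ κ x • fderiv ℝ ζ x + ζ x • (deriv belowCutoff (κ * height e f x) •
        (κ • (ver e - (fderiv ℝ f (hor e x)).comp (hor e))))) x := by
    intro κ hκ x
    by_cases hxK : x ∈ K
    swap
    · rw [hKf x hxK, h0 x hxK]
      simp only [smul_zero, zero_smul, add_zero]
      refine (hasFDerivAt_const (0 : ℝ) x).congr_of_eventuallyEq ?_
      filter_upwards [hKz x hxK] with y hy
      rw [hy, mul_zero]
    rcases lt_or_ge (height e f x) 0 with hx | hx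
    · have h1 : HasFDerivAt (χ κ) (deriv belowCutoff (κ * height e f x) •
        (κ • (ver e - (fderiv ℝ f (hor e x)).comp (hor e)))) x :=
        ((contDiff_belowCutoff.differentiable (by simp)) _).hasDerivAt.comp_hasFDerivAt x
          ((hasFDerivAt_height e hf x).const_mul κ)
      exact h1.mul (hd x ⟨(hg x (hKU hxK)).2 hx, hKU hxK⟩).hasFDerivAt
    · have h1 : χ κ x = 0 := belowCutoff_eq_zero (by nlinarith)
      have h2 : deriv belowCutoff (κ * height e f x) = 0 :=
        deriv_belowCutoff_eq_zero fun h => by nlinarith [h.2]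
      rw [h1, h2]
      simp only [smul_zero, zero_smul, add_zero]
      refine (hasFDerivAt_const (0 : ℝ) x).congr_of_eventuallyEq ?_
      have : ∀ᶠ y in 𝓝 x, -1 < κ * height e f y :=
        (continuous_const.mul hs).continuousAt.eventually
          (Ioi_mem_nhds (by nlinarith : -1 < κ * height e f x))
      filter_upwards [this] with y hy
      rw [hχdef]; simp only; rw [belowCutoff_eq_zero hy.le, zero_mul]
  have hdera : ∀ κ, 0 < κ → ∀ x, fderiv ℝ (fun x => χ κ x * ζ x) x a = G1 κ x + G2 κ x := by
    intro κ hκ x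
    rw [(hder κ hκ x).fderiv]
    simp [hG1, hG2, hcdef, inner_graphNormal]
  have hχm : ∀ κ, Continuous (χ κ) := fun κ =>
    contDiff_belowCutoff.continuous.comp (continuous_const.mul hs)
  have hG1m : ∀ κ, Measurable (G1 κ) := fun κ =>
    (hχm κ).measurable.mul (measurable_fderiv_apply_const ℝ ζ a)
  have hG2m : ∀ κ, 0 < κ → Measurable (G2 κ) := fun κ hκ => by
    have : G2 κ = fun x => fderiv ℝ (fun x => χ κ x * ζ x) x a - G1 κ x :=
      funext fun x => by rw [hdera κ hκ]; ring
    rw [this]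
    exact (measurable_fderiv_apply_const ℝ _ a).sub (hG1m κ)
  have hzero : ∀ κ, 0 < κ → ∀ x ∉ Ω, G1 κ x = 0 := by
    intro κ hκ x hx
    by_cases hxK : x ∈ K
    · have : 0 ≤ height e f x := not_lt.1 fun h => hx ((hg x (hKU hxK)).2 h)
      have h1 : χ κ x = 0 := belowCutoff_eq_zero (by nlinarith)
      simp only [hG1, h1, zero_mul]
    · simp [hG1, hKf x hxK]
  have hG1b : ∀ κ, 0 < κ → ∀ x, |G1 κ x| ≤ max M 0 * ‖a‖ := by
    intro κ hκ x
    by_cases hx : x ∈ Ω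
    · rw [hG1]; simp only; rw [abs_mul]
      calc _ ≤ 1 * (max M 0 * ‖a‖) := mul_le_mul (abs_belowCutoff_le _)
            (((fderiv ℝ ζ x).le_opNorm a).trans
              (mul_le_mul_of_nonneg_right (hMall x hx) (norm_nonneg a))) (abs_nonneg _) zero_le_one
        _ = _ := one_mul _
    · rw [hzero κ hκ x hx, abs_zero]; positivity
  have hG2b : ∀ κ, 0 < κ → ∀ x ∈ K, |G2 κ x| ≤ Mζ * (Cχ * (κ * max Cc 0)) := by
    intro κ hκ x hxK
    rw [hG2]; simp only
    by_cases hx : height e f x ≤ 0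
    · rw [abs_mul, abs_mul, abs_mul, abs_of_pos hκ]
      have := hCc x hxK
      have := hMζ x hx
      have := hCχ (κ * height e f x)
      gcongr
    · rw [deriv_belowCutoff_eq_zero fun h => by nlinarith [h.2]]
      simp only [zero_mul, mul_zero, abs_zero]
      positivity
  have hG1z : ∀ κ, ∀ x ∉ K, G1 κ x = 0 := fun κ x hx => by simp [hG1, hKf x hx]
  have hG2z : ∀ κ, ∀ x ∉ K, G2 κ x = 0 := fun κ x hx => by simp [hG2, h0 x hx]
  have hG1i : ∀ κ, 0 < κ → Integrable (G1 κ) := fun κ hκ =>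
    IntegrableOn.integrable_of_forall_notMem_eq_zero
      (Measure.integrableOn_of_bounded hK.measure_lt_top.ne (hG1m κ).aestronglyMeasurable
        (.of_forall fun x => hG1b κ hκ x)) (hG1z κ)
  have hG2i : ∀ κ, 0 < κ → Integrable (G2 κ) := fun κ hκ =>
    IntegrableOn.integrable_of_forall_notMem_eq_zero
      (Measure.integrableOn_of_bounded hK.measure_lt_top.ne (hG2m κ hκ).aestronglyMeasurable
        ((ae_restrict_mem hK.measurableSet).mono fun x hx => hG2b κ hκ x hx)) (hG2z κ)
  -- The product `χ ζ` is differentiable on the whole space with compact support, so its derivative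
  -- integrates to zero.
  have hparts : ∀ κ, 0 < κ → ∫ x, G1 κ x = - ∫ x, G2 κ x := by
    intro κ hκ
    have hdiff : Differentiable ℝ (fun x => χ κ x * ζ x) := fun x => (hder κ hκ x).differentiableAt
    have hcs : HasCompactSupport (fun x => χ κ x * ζ x) :=
      HasCompactSupport.intro hK fun x hx => by rw [h0 x hx, mul_zero]
    have h1 := integral_mul_fderiv_eq_neg_fderiv_mul_of_integrable (μ := volume)
      (f := fun _ : EuclideanSpace ℝ (Fin (m + 1)) => (1 : ℝ)) (g := fun x => χ κ x * ζ x) (v := a)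
      (by simp) (by
        simp only [one_mul]
        exact ((hG1i κ hκ).add (hG2i κ hκ)).congr (.of_forall fun x => (hdera κ hκ x).symm))
      (by simpa using hdiff.continuous.integrable_of_hasCompactSupport hcs)
      (fun x _ => by fun_prop) (fun x _ => hdiff x)
    simp only [one_mul, fderiv_fun_const, Pi.zero_apply, _root_.zero_apply, zero_mul, integral_zero,
      neg_zero, hdera κ hκ] at h1
    rw [integral_add (hG1i κ hκ) (hG2i κ hκ)] at h1
    linarith
  have hκ : ∀ k : ℕ, (0 : ℝ) < k + 1 := fun k => by positivity
  have hκlim : Tendsto (fun k : ℕ => (k : ℝ) + 1) atTop atTop :=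
    tendsto_atTop_add_const_right _ _ tendsto_natCast_atTop_atTop
  have lim1 : Tendsto (fun k : ℕ => ∫ x, G1 (k + 1) x) atTop (𝓝 (∫ x in Ω, fderiv ℝ ζ x a)) := by
    have h1 : ∀ k : ℕ, ∫ x, G1 (k + 1) x = ∫ x in Ω, G1 (k + 1) x := fun k =>
      (setIntegral_eq_integral_of_forall_compl_eq_zero (hzero _ (hκ k))).symm
    simp_rw [h1]
    refine tendsto_integral_of_dominated_convergence (K.indicator fun _ => max M 0 * ‖a‖)
      (fun k => (hG1m _).aestronglyMeasurable) ?_ ?_ ?_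
    · exact ((integrable_indicator_iff hK.measurableSet).2
        (integrableOn_const hK.measure_lt_top.ne)).restrict
    · refine fun k => .of_forall fun x => ?_
      by_cases hx : x ∈ K
      · rw [indicator_of_mem hx]; exact hG1b _ (hκ k) x
      · rw [indicator_of_notMem hx, hG1z _ x hx, norm_zero]
    · filter_upwards [ae_restrict_mem hΩo.measurableSet] with x hx
      by_cases hxK : x ∈ K
      swap
      · simp [hG1, hKf x hxK]
      have hneg : height e f x < 0 := (hg x (hKU hxK)).1 hx
      refine tendsto_const_nhds.congr' ?_
      have : Tendsto (fun k : ℕ => ((k : ℝ) + 1) * height e f x) atTop atBot :=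
        hκlim.atTop_mul_const_of_neg hneg
      filter_upwards [this.eventually (eventually_le_atBot (-2))] with k hk
      simp only [hG1, hχdef]
      rw [belowCutoff_eq_one hk, one_mul]
  -- The layer integral along a vertical line, rescaled by `σ = κ (t - f v)`. As `κ → ∞` only
  -- boundary values of `ζ` survive, and the profile has total derivative `-1`.
  set H : ℝ → EuclideanSpace ℝ (Fin m) → ℝ := fun κ v =>
    ∫ σ in Icc (-2 : ℝ) (-1), ζ (pt e v (f v + σ / κ)) * (deriv belowCutoff σ * c v) with hH
  have hinner : ∀ κ, 0 < κ → ∀ v, ∫ t, G2 κ (pt e v t) = H κ v := by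
    intro κ hκ v
    set g : ℝ → ℝ := fun σ => ζ (pt e v (f v + σ / κ)) * (deriv belowCutoff σ * c v) with hgdef
    have h1 : ∀ t, G2 κ (pt e v t) = κ * g (κ * (t - f v)) := by
      intro t
      have : f v + κ * (t - f v) / κ = t := by field_simp; ring
      simp only [hG2, hgdef, height_pt, hor_pt, this]; ring
    simp_rw [h1]
    rw [integral_const_mul, integral_sub_right_eq_self (fun t => g (κ * t)) (f v),
      Measure.integral_comp_mul_left, smul_eq_mul, abs_of_pos (inv_pos.2 hκ), ← mul_assoc,
      mul_inv_cancel₀ hκ.ne', one_mul, hH]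
    refine (setIntegral_eq_integral_of_forall_compl_eq_zero fun σ hσ => ?_).symm
    simp only [hgdef, deriv_belowCutoff_eq_zero hσ, zero_mul, mul_zero]
  have hprodi : ∀ κ, 0 < κ → Integrable (fun p : EuclideanSpace ℝ (Fin m) × ℝ =>
      G2 κ (pt e p.1 p.2)) (volume.prod volume) := fun κ hκ =>
    ((measurePreserving_pt e).integrable_comp_emb
      (isClosedEmbedding_pt e).measurableEmbedding).2 (hG2i κ hκ)
  have hG2H : ∀ κ, 0 < κ → ∫ x, G2 κ x = ∫ v, H κ v := by
    intro κ hκ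
    rw [← (measurePreserving_pt e).integral_comp (isClosedEmbedding_pt e).measurableEmbedding,
      integral_prod _ (hprodi κ hκ)]
    exact integral_congr_ae (.of_forall fun v => hinner κ hκ v)
  have hHm : ∀ κ, 0 < κ → AEStronglyMeasurable (H κ) := fun κ hκ =>
    ((hprodi κ hκ).integral_prod_left.aestronglyMeasurable).congr
      (.of_forall fun v => hinner κ hκ v)
  have hpth : ∀ κ, 0 < κ → ∀ v, ∀ σ ∈ Icc (-2 : ℝ) (-1),
      height e f (pt e v (f v + σ / κ)) < 0 := by
    intro κ hκ v σ hσ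
    rw [height_pt, add_sub_cancel_left]
    exact div_neg_of_neg_of_pos (by linarith [hσ.2]) hκ
  have hgb : ∀ κ, 0 < κ → ∀ v, ∀ σ ∈ Icc (-2 : ℝ) (-1),
      ‖ζ (pt e v (f v + σ / κ)) * (deriv belowCutoff σ * c v)‖ ≤
        (hor e '' K).indicator (fun _ => Mζ * (Cχ * max Cc 0)) v := by
    intro κ hκ v σ hσ
    by_cases hx : pt e v (f v + σ / κ) ∈ K
    · have hv : v ∈ hor e '' K := ⟨_, hx, hor_pt _ _ _⟩
      rw [indicator_of_mem hv, Real.norm_eq_abs, abs_mul, abs_mul]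
      have h1 := hCc _ hx
      rw [hor_pt] at h1
      have h2 := hMζ _ (hpth κ hκ v σ hσ).le
      have h3 := hCχ σ
      gcongr
    · rw [h0 _ hx, zero_mul, norm_zero]
      exact indicator_nonneg (fun _ _ => by positivity) _
  have hHlim : ∀ v, Tendsto (fun k : ℕ => H (k + 1) v) atTop (𝓝 (-(ζ (graphMap e f v) * c v))) := by
    intro v
    have e1 : -(ζ (graphMap e f v) * c v) =
        ∫ σ in Icc (-2 : ℝ) (-1), ζ (graphMap e f v) * (deriv belowCutoff σ * c v) := by
      rw [integral_const_mul, integral_mul_const, integral_Icc_eq_integral_Ioc,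
        ← intervalIntegral.integral_of_le (by norm_num), integral_deriv_belowCutoff]; ring
    rw [e1]
    refine tendsto_integral_of_dominated_convergence
      (fun _ => (hor e '' K).indicator (fun _ => Mζ * (Cχ * max Cc 0)) v) (fun k => ?_)
      (integrable_const _) (fun k => ?_) ?_
    · refine ContinuousOn.aestronglyMeasurable (fun σ hσ => ?_) measurableSet_Icc
      have h1 : ContinuousAt (fun σ : ℝ => pt e v (f v + σ / ((k : ℝ) + 1))) σ :=
        ((continuous_pt e).comp (Continuous.prodMk continuous_const
          (by fun_prop : Continuous fun σ : ℝ => f v + σ / ((k : ℝ) + 1)))).continuousAt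
      have h2 : ContinuousAt (fun σ : ℝ => ζ (pt e v (f v + σ / ((k : ℝ) + 1)))) σ :=
        ContinuousAt.comp (g := ζ) (hζc _ (hpth _ (hκ k) v σ hσ)) h1
      exact (h2.mul (continuous_deriv_belowCutoff.continuousAt.mul
        continuousAt_const)).continuousWithinAt
    · filter_upwards [ae_restrict_mem measurableSet_Icc] with σ hσ using hgb _ (hκ k) v σ hσ
    · filter_upwards [ae_restrict_mem measurableSet_Icc] with σ hσ
      refine Tendsto.mul_const _ ?_
      have hto : Tendsto (fun k : ℕ => pt e v (f v + σ / ((k : ℝ) + 1))) atTop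
          (𝓝 (graphMap e f v)) := by
        have : Tendsto (fun k : ℕ => f v + σ / ((k : ℝ) + 1)) atTop (𝓝 (f v + 0)) :=
          tendsto_const_nhds.add (tendsto_const_nhds.div_atTop hκlim)
        rw [add_zero] at this
        exact ((continuous_pt e).tendsto (v, f v)).comp (tendsto_const_nhds.prodMk_nhds this)
      by_cases hgK : graphMap e f v ∈ U
      · have hmem : graphMap e f v ∈ {x | x ∈ U ∧ height e f x ≤ 0} :=
          ⟨hgK, by simp [height]⟩
        refine ((hc _ hmem).tendsto).comp (tendsto_nhdsWithin_iff.2 ⟨hto, ?_⟩)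
        filter_upwards [hto.eventually (hU.mem_nhds hgK)] with k hk
        exact ⟨hk, (hpth _ (hκ k) v σ hσ).le⟩
      · have hnK : graphMap e f v ∉ K := fun h => hgK (hKU h)
        rw [h0 _ hnK]
        refine tendsto_const_nhds.congr' ?_
        filter_upwards [hto.eventually (hK.isClosed.isOpen_compl.mem_nhds hnK)] with k hk
        exact (h0 _ hk).symm
  have lim2 : Tendsto (fun k : ℕ => ∫ v, H (k + 1) v) atTop
      (𝓝 (∫ v, -(ζ (graphMap e f v) * c v))) := by
    refine tendsto_integral_of_dominated_convergence
      ((hor e '' K).indicator fun _ => Mζ * (Cχ * max Cc 0)) (fun k => hHm _ (hκ k)) ?_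
      (fun k => .of_forall fun v => ?_) (.of_forall hHlim)
    · exact (integrable_indicator_iff hK'.measurableSet).2
        (integrableOn_const hK'.measure_lt_top.ne)
    · have := norm_setIntegral_le_of_norm_le_const (μ := volume) (s := Icc (-2 : ℝ) (-1))
        (by simp) (hgb _ (hκ k) v)
      refine this.trans (le_of_eq ?_)
      simp [Measure.real]; norm_num
  have lim3 : Tendsto (fun k : ℕ => ∫ x, G1 (k + 1) x) atTop
      (𝓝 (-∫ v, -(ζ (graphMap e f v) * c v))) := by
    refine lim2.neg.congr fun k => ?_
    rw [hparts _ (hκ k), hG2H _ (hκ k)]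
  rw [tendsto_nhds_unique lim1 lim3, integral_neg, neg_neg]

end Divergence


/-! ### Domains that are locally subgraphs: closure, frontier, and outward normals. -/

section LocalGraph

variable {m : ℕ}

/-- In the open set `U`, the set `Ω` is the region below the graph of the smooth function `f`. -/
structure LocalGraph (e : Splitting m) (f : EuclideanSpace ℝ (Fin m) → ℝ)
    (Ω U : Set (EuclideanSpace ℝ (Fin (m + 1)))) : Prop where
  smooth : ContDiff ℝ ∞ f
  isOpen_domain : IsOpen Ω
  isOpen_chart : IsOpen U
  mem_iff : ∀ x ∈ U, x ∈ Ω ↔ height e f x < 0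

variable {e : Splitting m} {f : EuclideanSpace ℝ (Fin m) → ℝ}
  {Ω U : Set (EuclideanSpace ℝ (Fin (m + 1)))}

lemma height_sub_axis (x : EuclideanSpace ℝ (Fin (m + 1))) (t : ℝ) :
    height e f (x - t • axis e) = height e f x - t := by
  simp [height]; ring

lemma height_graphMap (v : EuclideanSpace ℝ (Fin m)) : height e f (graphMap e f v) = 0 := by
  simp [height]

lemma graphMap_hor {x : EuclideanSpace ℝ (Fin (m + 1))} (h : height e f x = 0) :
    graphMap e f (hor e x) = x := by
  apply ext_coord e
  · simp
  · simp only [ver_graphMap]; rw [height] at h; linarith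

lemma LocalGraph.closure_iff (h : LocalGraph e f Ω U) {x : EuclideanSpace ℝ (Fin (m + 1))}
    (hx : x ∈ U) : x ∈ closure Ω ↔ height e f x ≤ 0 := by
  have hs := continuous_height e h.smooth
  constructor
  · intro hcl
    by_contra hpos
    push Not at hpos
    obtain ⟨y, ⟨hyU, hy⟩, hyΩ⟩ := mem_closure_iff.1 hcl (U ∩ {y | 0 < height e f y})
      (h.isOpen_chart.inter (isOpen_lt continuous_const hs)) ⟨hx, hpos⟩
    exact absurd ((h.mem_iff y hyU).1 hyΩ) (not_lt.2 (le_of_lt hy))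
  · intro hle
    have hto : Tendsto (fun t : ℝ => x - t • axis e) (𝓝[>] 0) (𝓝 x) := by
      have : ContinuousAt (fun t : ℝ => x - t • axis e) 0 := by fun_prop
      simpa [ContinuousAt] using this.tendsto.mono_left (nhdsWithin_le_nhds (s := Ioi 0))
    refine mem_closure_of_tendsto hto ?_
    filter_upwards [hto.eventually (h.isOpen_chart.mem_nhds hx), eventually_mem_nhdsWithin]
      with t ht ht0
    rw [h.mem_iff _ ht, height_sub_axis]
    have : 0 < t := ht0
    linarith

lemma LocalGraph.frontier_iff (h : LocalGraph e f Ω U) {x : EuclideanSpace ℝ (Fin (m + 1))}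
    (hx : x ∈ U) : x ∈ frontier Ω ↔ height e f x = 0 := by
  rw [h.isOpen_domain.frontier_eq, Set.mem_sdiff, h.closure_iff hx, h.mem_iff x hx, not_lt]
  exact ⟨fun h => le_antisymm h.1 h.2, fun h => ⟨h.le, h.ge⟩⟩

lemma LocalGraph.graphMap_mem (h : LocalGraph e f Ω U) {v : EuclideanSpace ℝ (Fin m)}
    (hv : graphMap e f v ∈ U) : graphMap e f v ∈ frontier Ω :=
  (h.frontier_iff hv).2 (height_graphMap v)

lemma LocalGraph.mono (h : LocalGraph e f Ω U) {U' : Set (EuclideanSpace ℝ (Fin (m + 1)))}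
    (hU' : IsOpen U') (hs : U' ⊆ U) : LocalGraph e f Ω U' :=
  ⟨h.smooth, h.isOpen_domain, hU', fun x hx => h.mem_iff x (hs hx)⟩

/-- Since `f` is locally Lipschitz, a truncated open cone with vertex at `x` opens downwards inside
`Ω`, and a convex set with nonempty interior has unique derivatives at points of its closure. This
gives meaning and continuity to the derivative of `u` up to the boundary. -/
lemma LocalGraph.uniqueDiffWithinAt (h : LocalGraph e f Ω U)
    {x : EuclideanSpace ℝ (Fin (m + 1))} (hx : x ∈ U) (hxf : x ∈ frontier Ω) :
    UniqueDiffWithinAt ℝ (closure Ω) x := by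
  obtain ⟨K, t, ht, hK⟩ := (h.smooth.contDiffAt (x := hor e x)).of_le (m := 1) (by simp)
    |>.exists_lipschitzOnWith
  have h0 : height e f x = 0 := (h.frontier_iff hx).1 hxf
  have hmem : U ∩ hor e ⁻¹' t ∈ 𝓝 x :=
    inter_mem (h.isOpen_chart.mem_nhds hx) ((hor e).continuous.continuousAt.preimage_mem_nhds ht)
  obtain ⟨δ, hδ, hball⟩ := Metric.mem_nhds_iff.1 hmem
  set C : Set (EuclideanSpace ℝ (Fin (m + 1))) :=
    {y | ver e (y - x) + K * ‖hor e (y - x)‖ < 0} ∩ ball x δ with hC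
  have hCo : IsOpen C := by
    refine IsOpen.inter (isOpen_lt ?_ continuous_const) isOpen_ball
    fun_prop
  have hCc : Convex ℝ C := by
    refine Convex.inter ?_ (convex_ball x δ)
    intro y hy z hz a b ha hb hab
    have e1 : a • y + b • z - x = a • (y - x) + b • (z - x) := by
      rw [smul_sub, smul_sub, sub_add_sub_comm, ← add_smul, hab, one_smul]
    simp only [mem_ofPred_eq, e1, map_add, map_smul, smul_eq_mul] at hy hz ⊢
    have e2 := norm_add_le (a • hor e (y - x)) (b • hor e (z - x))
    rw [norm_smul, norm_smul, Real.norm_of_nonneg ha, Real.norm_of_nonneg hb] at e2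
    have hK0 : (0 : ℝ) ≤ K := K.2
    have e3 := mul_le_mul_of_nonneg_left e2 hK0
    rcases ha.eq_or_lt with rfl | ha'
    · have : b = 1 := by linarith
      subst this; nlinarith
    · nlinarith
  have hCΩ : C ⊆ Ω := by
    rintro y ⟨hy1, hy2⟩
    obtain ⟨hyU, hyt⟩ := hball hy2
    rw [h.mem_iff y hyU]
    have h2 := hK.dist_le_mul _ hyt _ (mem_of_mem_nhds ht)
    rw [Real.dist_eq, dist_eq_norm, ← map_sub] at h2
    have h3 := (abs_le.1 h2).1
    simp only [mem_ofPred_eq, map_sub] at hy1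
    rw [map_sub] at h3
    rw [height] at h0 ⊢
    linarith
  have hxC : x ∈ closure C := by
    have hto : Tendsto (fun s : ℝ => x - s • axis e) (𝓝[>] 0) (𝓝 x) := by
      have : ContinuousAt (fun s : ℝ => x - s • axis e) 0 := by fun_prop
      simpa [ContinuousAt] using this.tendsto.mono_left (nhdsWithin_le_nhds (s := Ioi 0))
    refine mem_closure_of_tendsto hto ?_
    filter_upwards [hto.eventually (ball_mem_nhds x hδ), eventually_mem_nhdsWithin] with s hs hs0
    refine ⟨?_, hs⟩
    have : (0 : ℝ) < s := hs0
    simpa using this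
  have hne : (interior C).Nonempty := by
    rw [hCo.interior_eq]
    exact closure_nonempty_iff.1 ⟨x, hxC⟩
  exact (uniqueDiffWithinAt_convex hCc hne hxC).mono (hCΩ.trans subset_closure)

/-- Choosing coordinates whose axis is `ν` turns the coordinate-free chart centered at `p` into a
subgraph with horizontal tangent plane at `p`. The last clause relates the two parametrizations and
is needed to transfer the bounds on the boundary data. -/
lemma IsBoundaryGraph.exists_localGraph {p ν : EuclideanSpace ℝ (Fin (m + 1))}
    {φ : EuclideanSpace ℝ (Fin (m + 1)) → ℝ} (hΩ : IsOpen Ω) (h : IsBoundaryGraph Ω p ν φ) :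
    ∃ (e : Splitting m) (f : EuclideanSpace ℝ (Fin m) → ℝ) (ρ : ℝ), axis e = ν ∧ 0 < ρ ∧
      LocalGraph e f Ω (ball p ρ) ∧ fderiv ℝ f (hor e p) = 0 ∧ height e f p = 0 ∧
      ∀ y, boundaryChart p ν φ y = graphMap e f (hor e p + hor e y) := by
  obtain ⟨e, he⟩ := exists_splitting h.norm_normal
  set f : EuclideanSpace ℝ (Fin m) → ℝ := fun v => ver e p + φ (incl e (v - hor e p)) with hf
  have htan : ∀ y, tangentialPart ν y = incl e (hor e y) := by
    intro y
    rw [tangentialPart, ← he, inner_axis]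
    nth_rewrite 1 [← incl_hor_add e y]
    simp
  obtain ⟨ρ, hρ, hball⟩ := Metric.eventually_nhds_iff_ball.1 h.mem_iff
  refine ⟨e, f, ρ, he, hρ, ⟨?_, hΩ, isOpen_ball, ?_⟩, ?_, ?_, ?_⟩
  · have := h.smooth
    simp only [hf]; fun_prop
  · intro x hx
    have := hball (x - p) (by simpa [dist_eq_norm] using hx)
    rw [add_sub_cancel, htan, ← he, inner_axis] at this
    rw [this, height, hf]
    simp only [map_sub]
    constructor <;> intro h <;> linarith
  · have h1 : HasFDerivAt φ (fderiv ℝ φ 0) (incl e (hor e p - hor e p)) := by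
      rw [show incl e (hor e p - hor e p) = 0 by simp]
      exact ((h.smooth.differentiable (by simp)) 0).hasFDerivAt
    have h2 := (incl e).hasFDerivAt.comp (hor e p)
      ((hasFDerivAt_id (𝕜 := ℝ) (hor e p)).sub_const (hor e p))
    have h3 : HasFDerivAt f _ (hor e p) := (h1.comp (hor e p) h2).const_add (ver e p)
    rw [h3.fderiv, h.fderiv_zero, ContinuousLinearMap.zero_comp]
  · simp [height, hf, h.map_zero]
  · intro y
    apply ext_coord e
    · rw [boundaryChart, htan, ← he]; simp
    · rw [boundaryChart, htan, ← he]; simp [hf]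

/-- The height function of the chart that defines `ν` vanishes along the given graph, so its
differential at the point, the pairing with `ν`, annihilates the tangent space. This makes the
outward normal independent of the chart and lets the anchoring condition be read in any graph
coordinates. -/
lemma IsOutwardNormal.eq_graphNormal (h : LocalGraph e f Ω U) {v : EuclideanSpace ℝ (Fin m)}
    (hv : graphMap e f v ∈ U) {ν : EuclideanSpace ℝ (Fin (m + 1))}
    (hν : IsOutwardNormal Ω (graphMap e f v) ν) :
    graphJac f v • ν = graphNormal e f v := by
  obtain ⟨φ, hφ⟩ := hν
  obtain ⟨e', f', ρ, he', hρ, h', hf', h0', -⟩ := hφ.exists_localGraph h.isOpen_domain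
  have hder : HasFDerivAt (height e' f') (ver e') (graphMap e f v) := by
    have := hasFDerivAt_height e' h'.smooth (graphMap e f v)
    rwa [hf', ContinuousLinearMap.zero_comp, sub_zero] at this
  have htan : ∀ w, ver e' (incl e w + fderiv ℝ f v w • axis e) = 0 := by
    intro w
    have h1 := hder.comp v (hasFDerivAt_graphMap e h.smooth v)
    have h2 : (height e' f') ∘ (graphMap e f) =ᶠ[𝓝 v] fun _ => 0 := by
      have hc := (contDiff_graphMap e h.smooth).continuous.continuousAt (x := v)
      filter_upwards [hc.eventually (h.isOpen_chart.mem_nhds hv),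
        hc.eventually (ball_mem_nhds _ hρ)] with w hw hw'
      exact (h'.frontier_iff hw').1 (h.graphMap_mem hw)
    have h3 := (h1.congr_of_eventuallyEq h2.symm).unique (hasFDerivAt_const (0 : ℝ) v)
    have := congrArg (fun L => L w) h3
    simpa using this
  set c := ver e ν with hc
  have hcν : ver e' (axis e) = c := by rw [← inner_axis, he', real_inner_comm, inner_axis]
  have hin : ∀ w, ver e' (incl e w) = ⟪w, hor e ν⟫_ℝ := by
    intro w; rw [← inner_axis, he', inner_eq_coord e]; simp
  have hhor : hor e ν = -(c • gradient f v) := by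
    refine ext_inner_left ℝ fun w => ?_
    have := htan w
    rw [map_add, map_smul, hcν, hin, smul_eq_mul] at this
    rw [inner_neg_right, inner_smul_right, real_inner_comm (gradient f v) w, inner_gradient_left]
    linarith
  have hνN : ν = c • graphNormal e f v := by
    apply ext_coord e
    · rw [hhor]; simp [graphNormal]
    · simp [graphNormal, hc]
  -- The sign: moving straight down from the graph enters `Ω`, so the other height function cannot
  -- increase in that direction.
  have hc0 : 0 ≤ c := by
    by_contra hneg
    push Not at hneg
    have h1 : HasDerivAt (fun s : ℝ => height e' f' (graphMap e f v - s • axis e)) (-c) 0 := by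
      have h2 : HasDerivAt (fun s : ℝ => graphMap e f v - s • axis e) (-axis e) 0 := by
        simpa using ((hasDerivAt_id (0 : ℝ)).smul_const (axis e)).const_sub (graphMap e f v)
      have h3 : HasFDerivAt (height e' f') (ver e') (graphMap e f v - (0 : ℝ) • axis e) := by
        simpa using hder
      have h4 := HasFDerivAt.comp_hasDerivAt (x := (0 : ℝ)) (l := height e' f') (l' := ver e')
        (f := fun s : ℝ => graphMap e f v - s • axis e) h3 h2
      rw [map_neg, hcν] at h4
      exact h4
    have h2 := (hasDerivAt_iff_tendsto_slope_zero.1 h1).mono_left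
      (nhdsGT_le_nhdsNE (0 : ℝ))
    have h3 : ∀ᶠ t in 𝓝[>] (0 : ℝ), t⁻¹ • (height e' f' (graphMap e f v - (0 + t) • axis e)
        - height e' f' (graphMap e f v - (0 : ℝ) • axis e)) ≤ 0 := by
      have hto : Tendsto (fun s : ℝ => graphMap e f v - s • axis e) (𝓝[>] 0)
          (𝓝 (graphMap e f v)) := by
        have : ContinuousAt (fun s : ℝ => graphMap e f v - s • axis e) 0 := by fun_prop
        simpa [ContinuousAt] using this.tendsto.mono_left (nhdsWithin_le_nhds (s := Ioi 0))
      filter_upwards [hto.eventually (h.isOpen_chart.mem_nhds hv),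
        hto.eventually (ball_mem_nhds _ hρ), eventually_mem_nhdsWithin] with t h1 h2 ht
      have ht' : (0 : ℝ) < t := ht
      have h4 : graphMap e f v - t • axis e ∈ Ω := by
        rw [h.mem_iff _ h1, height_sub_axis, height_graphMap]; linarith
      rw [h'.mem_iff _ h2] at h4
      rw [zero_add, zero_smul, sub_zero, h0', sub_zero, smul_eq_mul]
      exact mul_nonpos_of_nonneg_of_nonpos (inv_nonneg.2 ht'.le) h4.le
    have := le_of_tendsto h2 h3
    linarith
  have hcJ : c * graphJac f v = 1 := by
    have := congrArg norm hνN
    rw [hφ.norm_normal, norm_smul, norm_graphNormal, Real.norm_of_nonneg hc0] at this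
    exact this.symm
  rw [hνN, smul_smul, mul_comm, hcJ, one_smul]

lemma IsBoundedSmoothDomain.uniqueDiffOn (h : IsBoundedSmoothDomain Ω) :
    UniqueDiffOn ℝ (closure Ω) := by
  intro x hx
  by_cases hxΩ : x ∈ Ω
  · exact (h.isOpen.uniqueDiffWithinAt hxΩ).mono subset_closure
  · have hxf : x ∈ frontier Ω := by rw [h.isOpen.frontier_eq]; exact ⟨hx, hxΩ⟩
    obtain ⟨ν, φ, hφ⟩ := h.smooth_boundary x hxf
    obtain ⟨e, f, ρ, -, hρ, hl, -⟩ := hφ.exists_localGraph h.isOpen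
    exact hl.uniqueDiffWithinAt (mem_ball_self hρ) hxf

end LocalGraph

/-! ### Regularity up to the boundary and the maximum principle. -/

section Regularity

variable {n : ℕ} {Ω : Set (EuclideanSpace ℝ (Fin n))} {ε lam : ℝ}
  {g u : EuclideanSpace ℝ (Fin n) → EuclideanSpace ℝ (Fin 2)}

/-- The derivative of `u` up to the boundary. -/
noncomputable def bdryDeriv (Ω : Set (EuclideanSpace ℝ (Fin n)))
    (u : EuclideanSpace ℝ (Fin n) → EuclideanSpace ℝ (Fin 2)) (x : EuclideanSpace ℝ (Fin n)) :
    EuclideanSpace ℝ (Fin n) →L[ℝ] EuclideanSpace ℝ (Fin 2) := fderivWithin ℝ u (closure Ω) x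

lemma closure_mem_nhds (hΩ : IsOpen Ω) {x : EuclideanSpace ℝ (Fin n)} (hx : x ∈ Ω) :
    closure Ω ∈ 𝓝 x := mem_of_superset (hΩ.mem_nhds hx) subset_closure

lemma bdryDeriv_eq (hΩ : IsOpen Ω) {x : EuclideanSpace ℝ (Fin n)} (hx : x ∈ Ω) :
    bdryDeriv Ω u x = fderiv ℝ u x := fderivWithin_of_mem_nhds (closure_mem_nhds hΩ hx)

lemma bdryDeriv_eventuallyEq (hΩ : IsOpen Ω) {x : EuclideanSpace ℝ (Fin n)} (hx : x ∈ Ω) :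
    bdryDeriv Ω u =ᶠ[𝓝 x] fderiv ℝ u := by
  filter_upwards [hΩ.mem_nhds hx] with y hy using bdryDeriv_eq hΩ hy

lemma hasFDerivAt_bdryDeriv (hΩ : IsOpen Ω) (hu : ContDiffOn ℝ 2 u (closure Ω))
    {x : EuclideanSpace ℝ (Fin n)} (hx : x ∈ Ω) :
    HasFDerivAt (bdryDeriv Ω u) (fderiv ℝ (fderiv ℝ u) x) x := by
  have h1 : ContDiffAt ℝ 2 u x := hu.contDiffAt (closure_mem_nhds hΩ hx)
  have h2 : ContDiffAt ℝ 1 (fderiv ℝ u) x := h1.fderiv_right (by norm_num)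
  exact (h2.differentiableAt (by norm_num)).hasFDerivAt.congr_of_eventuallyEq
    (bdryDeriv_eventuallyEq hΩ hx)

lemma hasFDerivWithinAt_bdryDeriv (hu : ContDiffOn ℝ 2 u (closure Ω))
    {x : EuclideanSpace ℝ (Fin n)} (hx : x ∈ closure Ω) :
    HasFDerivWithinAt u (bdryDeriv Ω u x) (closure Ω) x :=
  ((hu.differentiableOn (by norm_num)) x hx).hasFDerivWithinAt

lemma continuousOn_bdryDeriv (hun : UniqueDiffOn ℝ (closure Ω))
    (hu : ContDiffOn ℝ 2 u (closure Ω)) : ContinuousOn (bdryDeriv Ω u) (closure Ω) :=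
  hu.continuousOn_fderivWithin hun (by norm_num)

lemma exists_bound_deriv (hΩ : IsOpen Ω) (hb : Bornology.IsBounded Ω)
    (hun : UniqueDiffOn ℝ (closure Ω)) (hu : ContDiffOn ℝ 2 u (closure Ω)) :
    ∃ M, 0 ≤ M ∧ (∀ x ∈ closure Ω, ‖bdryDeriv Ω u x‖ ≤ M) ∧
      ∀ x ∈ Ω, ‖fderiv ℝ (fderiv ℝ u) x‖ ≤ M := by
  have hcomp : IsCompact (closure Ω) := hb.isCompact_closure
  obtain ⟨M₁, hM₁⟩ := (hcomp.image_of_continuousOn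
    (continuousOn_bdryDeriv hun hu)).isBounded.exists_norm_le
  have h1 : ContDiffOn ℝ 1 (bdryDeriv Ω u) (closure Ω) := hu.fderivWithin hun (by norm_num)
  obtain ⟨M₂, hM₂⟩ := (hcomp.image_of_continuousOn
    (h1.continuousOn_fderivWithin hun le_rfl)).isBounded.exists_norm_le
  refine ⟨max (max M₁ M₂) 0, le_max_right _ _, fun x hx => ?_, fun x hx => ?_⟩
  · exact (hM₁ _ ⟨x, hx, rfl⟩).trans ((le_max_left _ _).trans (le_max_left _ _))
  · have := hM₂ _ ⟨x, subset_closure hx, rfl⟩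
    rw [fderivWithin_of_mem_nhds (closure_mem_nhds hΩ hx),
      (hasFDerivAt_bdryDeriv hΩ hu hx).fderiv] at this
    exact this.trans ((le_max_right _ _).trans (le_max_left _ _))

lemma laplacian_eq_sum (x : EuclideanSpace ℝ (Fin n)) :
    (Δ u) x = ∑ i, fderiv ℝ (fderiv ℝ u) x (EuclideanSpace.single i 1)
      (EuclideanSpace.single i 1) := by
  rw [congrFun (InnerProductSpace.laplacian_eq_iteratedFDeriv_orthonormalBasis u
    (EuclideanSpace.basisFun (Fin n) ℝ)) x]
  refine Finset.sum_congr rfl fun i _ => ?_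
  rw [iteratedFDeriv_two_apply]
  simp

/-- By the second derivative test the point would also be a local minimum, so the function would be
locally constant, against `c > 0`. -/
lemma not_isLocalMax_of_deriv_pos {h h' : ℝ → ℝ} {c : ℝ} (hmax : IsLocalMax h 0)
    (hd : ∀ᶠ t in 𝓝 0, HasDerivAt h (h' t) t) (hd' : HasDerivAt h' c 0) (hc : 0 < c) : False := by
  have h1 : deriv h =ᶠ[𝓝 0] h' := hd.mono fun t ht => ht.deriv
  have h2 : deriv (deriv h) 0 = c := by rw [h1.deriv_eq, hd'.deriv]
  have h3 : deriv h 0 = 0 := hmax.deriv_eq_zero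
  have h4 : IsLocalMin h 0 :=
    isLocalMin_of_deriv_deriv_pos (by rwa [h2]) h3 hd.self_of_nhds.continuousAt
  have h5 : h =ᶠ[𝓝 0] fun _ => h 0 := by
    filter_upwards [hmax, h4] with t a b using le_antisymm a b
  have h6 : deriv h =ᶠ[𝓝 0] fun _ => 0 := by
    have := h5.deriv
    simpa using this
  rw [h6.deriv_eq, deriv_const] at h2
  exact hc.ne h2

/-- The maximum principle for solutions. -/
lemma IsSolution.norm_le_one {m : ℕ} {Ω : Set (EuclideanSpace ℝ (Fin (m + 1)))}
    {g u : EuclideanSpace ℝ (Fin (m + 1)) → EuclideanSpace ℝ (Fin 2)}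
    (hΩ : IsBoundedSmoothDomain Ω) (hε : 0 < ε) (hlam : 0 < lam)
    (hg : ∀ p ∈ frontier Ω, ‖g p‖ = 1) (hu : IsSolution Ω ε lam g u) {x} (hx : x ∈ closure Ω) :
    ‖u x‖ ≤ 1 := by
  have hcomp : IsCompact (closure Ω) := hΩ.isBounded.isCompact_closure
  obtain ⟨q, hq, hmax⟩ := hcomp.exists_isMaxOn (f := fun y => ‖u y‖ ^ 2) ⟨x, hx⟩
    (hu.contDiffOn.continuousOn.norm.pow 2)
  suffices h : ‖u q‖ ≤ 1 by
    have h1 : ‖u x‖ ^ 2 ≤ ‖u q‖ ^ 2 := hmax hx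
    have h2 : ‖u x‖ ≤ ‖u q‖ := (sq_le_sq₀ (norm_nonneg _) (norm_nonneg _)).1 h1
    linarith
  by_contra hgt
  push Not at hgt
  by_cases hqΩ : q ∈ Ω
  · have hu2 : ContDiffAt ℝ 2 u q := hu.contDiffOn.contDiffAt (closure_mem_nhds hΩ.isOpen hqΩ)
    have hfd : HasFDerivAt (fderiv ℝ u) (fderiv ℝ (fderiv ℝ u) q) q :=
      ((hu2.fderiv_right (m := 1) (by norm_num)).differentiableAt (by norm_num)).hasFDerivAt
    -- Half the second derivative of `|u|²` along a coordinate line. Summed over `i` it gives `|∇u|²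
    -- + ⟨u, Δu⟩ ≤ 0`, while the equation makes `⟨u, Δu⟩` positive where `|u| > 1`.
    have key : ∀ i : Fin (m + 1), ‖fderiv ℝ u q (EuclideanSpace.single i 1)‖ ^ 2 +
        ⟪u q, fderiv ℝ (fderiv ℝ u) q (EuclideanSpace.single i 1)
          (EuclideanSpace.single i 1)⟫_ℝ ≤ 0 := by
      intro i
      by_contra hpos
      push Not at hpos
      set b : EuclideanSpace ℝ (Fin (m + 1)) := EuclideanSpace.single i 1
      set ℓ : ℝ → EuclideanSpace ℝ (Fin (m + 1)) := fun t => q + t • b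
      have hℓ : ∀ t, HasDerivAt ℓ b t := fun t =>
        (((hasDerivAt_id t).smul_const b).const_add q).congr_deriv (one_smul ℝ b)
      have hℓ0 : ℓ 0 = q := by simp [ℓ]
      have hℓΩ : ∀ᶠ t in 𝓝 (0 : ℝ), ℓ t ∈ Ω :=
        (hℓ 0).continuousAt.eventually (by rw [hℓ0]; exact hΩ.isOpen.mem_nhds hqΩ)
      refine not_isLocalMax_of_deriv_pos (h := fun t => ‖u (ℓ t)‖ ^ 2)
        (h' := fun t => 2 * ⟪u (ℓ t), fderiv ℝ u (ℓ t) b⟫_ℝ) ?_ ?_ ?_ (mul_pos two_pos hpos)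
      · filter_upwards [hℓΩ] with t ht
        rw [hℓ0]
        exact hmax (subset_closure ht)
      · filter_upwards [hℓΩ] with t ht
        have h1 : HasFDerivAt u (fderiv ℝ u (ℓ t)) (ℓ t) :=
          ((hu.contDiffOn.contDiffAt (closure_mem_nhds hΩ.isOpen ht)).differentiableAt
            (by norm_num)).hasFDerivAt
        exact (h1.comp_hasDerivAt t (hℓ t)).norm_sq
      · have h1 : HasFDerivAt u (fderiv ℝ u (ℓ 0)) (ℓ 0) := by
          rw [hℓ0]; exact (hu2.differentiableAt (by norm_num)).hasFDerivAt
        have h2 := h1.comp_hasDerivAt (0 : ℝ) (hℓ 0)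
        have h3 : HasDerivAt (fun t => fderiv ℝ u (ℓ t) b) (fderiv ℝ (fderiv ℝ u) q b b) 0 := by
          rw [← hℓ0] at hfd
          have := (hfd.comp_hasDerivAt (0 : ℝ) (hℓ 0)).clm_apply (hasDerivAt_const (0 : ℝ) b)
          simpa [hℓ0] using this
        have h4 := (h2.inner ℝ h3).const_mul 2
        refine h4.congr_deriv ?_
        simp only [Function.comp, hℓ0]
        rw [real_inner_self_eq_norm_sq]; ring
    have hsum := Finset.sum_nonpos fun i (_ : i ∈ Finset.univ) => key i
    rw [Finset.sum_add_distrib, ← inner_sum, ← laplacian_eq_sum] at hsum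
    have heq := hu.equation q hqΩ
    have hΔ : (Δ u) q = -((1 / ε ^ 2 * (1 - ‖u q‖ ^ 2)) • u q) := eq_neg_of_add_eq_zero_left heq
    rw [hΔ, inner_neg_right, inner_smul_right, real_inner_self_eq_norm_sq] at hsum
    have h1 : 0 ≤ ∑ i : Fin (m + 1), ‖fderiv ℝ u q (EuclideanSpace.single i 1)‖ ^ 2 :=
      Finset.sum_nonneg fun i _ => by positivity
    have h2 : 0 < 1 / ε ^ 2 * (‖u q‖ ^ 2 - 1) * ‖u q‖ ^ 2 := by
      have : 0 < ‖u q‖ ^ 2 - 1 := by nlinarith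
      positivity
    nlinarith
  · have hqf : q ∈ frontier Ω := by rw [hΩ.isOpen.frontier_eq]; exact ⟨hq, hqΩ⟩
    obtain ⟨ν, hν⟩ := hΩ.smooth_boundary q hqf
    obtain ⟨φ, hφ⟩ := hν
    obtain ⟨e, f, ρ, he, hρ, hl, -, h0, -⟩ := hφ.exists_localGraph hΩ.isOpen
    have hbd := hu.boundary q hqf ν ⟨φ, hφ⟩
    have hd := (hasFDerivWithinAt_bdryDeriv hu.contDiffOn hq).norm_sq
    -- An inward segment, along which `|u|²` cannot increase at a maximum. The anchoring condition
    -- gives it slope proportional to `λ⟨u, u - g⟩`, which is positive when `|u| > 1 = |g|`.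
    have hseg : segment ℝ q (q + (-(ρ / 2) • ν)) ⊆ closure Ω := by
      rw [segment_eq_image']
      rintro _ ⟨θ, hθ, rfl⟩
      have e1 : q + θ • (q + -(ρ / 2) • ν - q) = q - (θ * (ρ / 2)) • axis e := by
        rw [he, add_sub_cancel_left, smul_smul, mul_neg, neg_smul, sub_eq_add_neg]
      simp only [e1]
      have hmem : q - (θ * (ρ / 2)) • axis e ∈ ball q ρ := by
        rw [mem_ball, dist_eq_norm, sub_sub_cancel_left, norm_neg, norm_smul, norm_axis, mul_one,
          Real.norm_of_nonneg (mul_nonneg hθ.1 (by positivity))]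
        nlinarith [hθ.2]
      rw [hl.closure_iff hmem, height_sub_axis, h0]
      have : 0 ≤ θ * (ρ / 2) := mul_nonneg hθ.1 (by positivity)
      linarith
    have hle := (IsMaxOn.localize hmax).hasFDerivWithinAt_nonpos hd
      (mem_posTangentConeAt_of_segment_subset hseg)
    have hP : bdryDeriv Ω u q ν = -(lam • (u q - g q)) := eq_neg_of_add_eq_zero_left hbd
    simp only [map_smul, _root_.smul_apply, ContinuousLinearMap.comp_apply,
      innerSL_apply_apply, hP, inner_neg_right, inner_smul_right, inner_sub_right, smul_eq_mul,
      real_inner_self_eq_norm_sq] at hle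
    have hcs : ⟪u q, g q⟫_ℝ ≤ ‖u q‖ := by
      have := real_inner_le_norm (u q) (g q)
      rwa [hg q hqf, mul_one] at this
    have h1 : 0 < ‖u q‖ ^ 2 - ⟪u q, g q⟫_ℝ := by nlinarith
    have h2 : 0 < ρ / 2 * (lam * (‖u q‖ ^ 2 - ⟪u q, g q⟫_ℝ)) := by positivity
    simp only [nsmul_eq_mul, Nat.cast_ofNat] at hle
    nlinarith

end Regularity


/-! ### Bounds for the boundary data in an arbitrary graph chart. -/

section BoundaryData

lemma norm_fderiv_fderiv_comp_le {E F G : Type*} [NormedAddCommGroup E] [NormedSpace ℝ E]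
    [NormedAddCommGroup F] [NormedSpace ℝ F] [NormedAddCommGroup G] [NormedSpace ℝ G]
    {φ : F → G} {κ : E → F} {x : E} (hφ : ContDiffAt ℝ 2 φ (κ x)) (hκ : ContDiffAt ℝ 2 κ x) :
    ‖fderiv ℝ (fderiv ℝ (φ ∘ κ)) x‖ ≤ ‖fderiv ℝ (fderiv ℝ φ) (κ x)‖ * ‖fderiv ℝ κ x‖ ^ 2
      + ‖fderiv ℝ φ (κ x)‖ * ‖fderiv ℝ (fderiv ℝ κ) x‖ := by
  have h1 : fderiv ℝ (φ ∘ κ) =ᶠ[𝓝 x] fun y => (fderiv ℝ φ (κ y)).comp (fderiv ℝ κ y) := by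
    filter_upwards [hκ.eventually (by simp), hκ.continuousAt.eventually (hφ.eventually (by simp))]
      with y hy hy'
    exact fderiv_comp y (hy'.differentiableAt (by norm_num)) (hy.differentiableAt (by norm_num))
  have h2 : HasFDerivAt (fun y => fderiv ℝ φ (κ y))
      ((fderiv ℝ (fderiv ℝ φ) (κ x)).comp (fderiv ℝ κ x)) x :=
    (((hφ.fderiv_right (m := 1) (by norm_num)).differentiableAt (by norm_num)).hasFDerivAt).comp x
      (hκ.differentiableAt (by norm_num)).hasFDerivAt
  have h3 : HasFDerivAt (fderiv ℝ κ) (fderiv ℝ (fderiv ℝ κ) x) x :=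
    ((hκ.fderiv_right (m := 1) (by norm_num)).differentiableAt (by norm_num)).hasFDerivAt
  rw [h1.fderiv_eq, (h2.clm_comp h3).fderiv]
  refine ContinuousLinearMap.opNorm_le_bound _ (by positivity) fun w => ?_
  have e1 : ‖(fderiv ℝ φ (κ x)).comp (fderiv ℝ (fderiv ℝ κ) x w)‖ ≤
      ‖fderiv ℝ φ (κ x)‖ * (‖fderiv ℝ (fderiv ℝ κ) x‖ * ‖w‖) :=
    (ContinuousLinearMap.opNorm_comp_le _ _).trans (by gcongr; exact ContinuousLinearMap.le_opNorm _ _)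
  have e2 : ‖(fderiv ℝ (fderiv ℝ φ) (κ x) (fderiv ℝ κ x w)).comp (fderiv ℝ κ x)‖ ≤
      ‖fderiv ℝ (fderiv ℝ φ) (κ x)‖ * (‖fderiv ℝ κ x‖ * ‖w‖) * ‖fderiv ℝ κ x‖ :=
    (ContinuousLinearMap.opNorm_comp_le _ _).trans (by
      gcongr
      refine (ContinuousLinearMap.le_opNorm _ _).trans ?_
      gcongr
      exact ContinuousLinearMap.le_opNorm _ _)
  refine (norm_add_le _ _).trans ((add_le_add e1 e2).trans (le_of_eq ?_))
  ring

variable {m : ℕ} {e : Splitting m} {f : EuclideanSpace ℝ (Fin m) → ℝ}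
  {Ω U : Set (EuclideanSpace ℝ (Fin (m + 1)))}

lemma norm_smulRight_axis_le (ℓ : EuclideanSpace ℝ (Fin m) →L[ℝ] ℝ) :
    ‖ℓ.smulRight (axis e)‖ = ‖ℓ‖ := by
  rw [ContinuousLinearMap.norm_smulRight_apply, norm_axis, mul_one]

lemma norm_fderiv_graphMap_le (hf : ContDiff ℝ ∞ f) (v : EuclideanSpace ℝ (Fin m)) :
    ‖fderiv ℝ (graphMap e f) v‖ ≤ 1 + ‖fderiv ℝ f v‖ := by
  rw [(hasFDerivAt_graphMap e hf v).fderiv]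
  refine (norm_add_le _ _).trans (add_le_add ?_ (norm_smulRight_axis_le _).le)
  exact ContinuousLinearMap.opNorm_le_bound _ zero_le_one fun w => by simp

lemma norm_fderiv_fderiv_graphMap_le (hf : ContDiff ℝ ∞ f) (v : EuclideanSpace ℝ (Fin m)) :
    ‖fderiv ℝ (fderiv ℝ (graphMap e f)) v‖ ≤ ‖fderiv ℝ (fderiv ℝ f) v‖ := by
  have h1 : fderiv ℝ (graphMap e f) = fun v => incl e + (fderiv ℝ f v).smulRight (axis e) :=
    funext fun v => (hasFDerivAt_graphMap e hf v).fderiv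
  have h2 : HasFDerivAt (fderiv ℝ f) (fderiv ℝ (fderiv ℝ f) v) v :=
    ((hf.fderiv_right (m := ∞) (by simp)).differentiable (by simp) v).hasFDerivAt
  have h3 := (((ContinuousLinearMap.smulRightL ℝ (EuclideanSpace ℝ (Fin m))
    (EuclideanSpace ℝ (Fin (m + 1)))).flip (axis e)).hasFDerivAt.comp v h2).const_add (incl e)
  have h4 := HasFDerivAt.fderiv h3
  rw [h1]
  refine le_of_eq_of_le (congrArg norm h4) ?_
  refine ContinuousLinearMap.opNorm_le_bound _ (norm_nonneg (fderiv ℝ (fderiv ℝ f) v)) fun w => ?_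
  refine le_of_eq_of_le (norm_smulRight_axis_le (e := e) (fderiv ℝ (fderiv ℝ f) v w)) ?_
  exact ContinuousLinearMap.le_opNorm _ _

/-- The bounds for the boundary data in an arbitrary graph parametrization. -/
lemma LocalGraph.boundaryData_bounds (h : LocalGraph e f Ω U) (hΩ : IsBoundedSmoothDomain Ω)
    {g : EuclideanSpace ℝ (Fin (m + 1)) → EuclideanSpace ℝ (Fin 2)} {C : ℝ}
    (hg : HasBoundaryC2Bound Ω g C) {v : EuclideanSpace ℝ (Fin m)} (hv : graphMap e f v ∈ U)
    {Λ M : ℝ} (hΛ : ‖fderiv ℝ f v‖ ≤ Λ) (hM : ‖fderiv ℝ (fderiv ℝ f) v‖ ≤ M) :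
    ContDiffAt ℝ 2 (g ∘ graphMap e f) v ∧ ‖fderiv ℝ (g ∘ graphMap e f) v‖ ≤ C * (1 + Λ) ∧
      ‖fderiv ℝ (fderiv ℝ (g ∘ graphMap e f)) v‖ ≤ C * ((1 + Λ) ^ 2 + M) := by
  set q := graphMap e f v with hq
  obtain ⟨ν, φ, hφ⟩ := hΩ.smooth_boundary q (h.graphMap_mem hv)
  obtain ⟨hG, hGC⟩ := hg q (h.graphMap_mem hv) ν φ hφ
  obtain ⟨e', f', ρ, -, hρ, h', -, -, hch⟩ := hφ.exists_localGraph h.isOpen_domain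
  set G := g ∘ boundaryChart q ν φ with hGdef
  -- The tangent-plane parametrization at `q` forgets the normal component of its argument, so
  -- `boundaryChart` sends `graphMap e f w - q` back to `graphMap e f w`. The change of charts is
  -- thus explicit, and no inverse of a chart is needed.
  set κ : EuclideanSpace ℝ (Fin m) → EuclideanSpace ℝ (Fin (m + 1)) :=
    fun w => graphMap e f w - q with hκ
  have hκ0 : κ v = 0 := sub_self _
  have hκs : ContDiff ℝ ∞ κ := (contDiff_graphMap e h.smooth).sub contDiff_const
  have heq : g ∘ graphMap e f =ᶠ[𝓝 v] G ∘ κ := by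
    have hc := (contDiff_graphMap e h.smooth).continuous.continuousAt (x := v)
    filter_upwards [hc.eventually (h.isOpen_chart.mem_nhds hv),
      hc.eventually (ball_mem_nhds _ hρ)] with w hw hw'
    have h1 := (h'.frontier_iff hw').1 (h.graphMap_mem hw)
    simp only [Function.comp, hGdef, hκ]
    rw [hch, ← map_add, add_sub_cancel, graphMap_hor h1]
  have hκ1 : fderiv ℝ κ = fderiv ℝ (graphMap e f) := by
    funext w; simp only [hκ]; exact fderiv_sub_const q
  rw [← hκ0] at hG
  have hκ2 : ContDiffAt ℝ 2 κ v := contDiff_infty.1 hκs 2 |>.contDiffAt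
  have hcomp : ContDiffAt ℝ 2 (G ∘ κ) v := hG.comp v hκ2
  have n1 : ‖fderiv ℝ κ v‖ ≤ 1 + Λ := by
    rw [hκ1]; exact (norm_fderiv_graphMap_le h.smooth v).trans (by gcongr)
  have n2 : ‖fderiv ℝ (fderiv ℝ κ) v‖ ≤ M := by
    rw [hκ1]; exact (norm_fderiv_fderiv_graphMap_le h.smooth v).trans hM
  rw [← hκ0] at hGC
  have n3 : ‖fderiv ℝ (fderiv ℝ G) (κ v)‖ = ‖iteratedFDeriv ℝ 2 G (κ v)‖ := by
    rw [← norm_iteratedFDeriv_fderiv, norm_iteratedFDeriv_one]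
  have n4 := norm_nonneg (g q)
  have n5 := norm_nonneg (fderiv ℝ G (κ v))
  have n6 := norm_nonneg (iteratedFDeriv ℝ 2 G (κ v))
  have n7 := norm_nonneg (fderiv ℝ κ v)
  have n8 := norm_nonneg (fderiv ℝ (fderiv ℝ κ) v)
  have a1 : ‖fderiv ℝ G (κ v)‖ ≤ C := by linarith
  have hC : 0 ≤ C := by linarith
  refine ⟨hcomp.congr_of_eventuallyEq heq, ?_, ?_⟩
  · rw [heq.fderiv_eq, fderiv_comp v (hG.differentiableAt (by norm_num))
      (hκ2.differentiableAt (by norm_num))]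
    exact (ContinuousLinearMap.opNorm_comp_le _ _).trans (mul_le_mul a1 n1 n7 hC)
  · rw [heq.fderiv.fderiv_eq]
    refine (norm_fderiv_fderiv_comp_le hG hκ2).trans ?_
    rw [n3]
    calc _ ≤ ‖iteratedFDeriv ℝ 2 G (κ v)‖ * (1 + Λ) ^ 2
          + ‖fderiv ℝ G (κ v)‖ * M := by gcongr
      _ ≤ C * (1 + Λ) ^ 2 + C * M := by
          have : 0 ≤ M := n8.trans n2
          gcongr; linarith
      _ = _ := by ring

end BoundaryData


/-! ### A class of functions closed under the operations that build the test fields. -/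

section Tame

variable {E E' F G H : Type*} [NormedAddCommGroup E] [NormedSpace ℝ E]
  [NormedAddCommGroup E'] [NormedSpace ℝ E'] [NormedAddCommGroup F] [NormedSpace ℝ F]
  [NormedAddCommGroup G] [NormedSpace ℝ G] [NormedAddCommGroup H] [NormedSpace ℝ H]

/-- The map is continuous on `T`, differentiable on `S`, and bounded on `S` together with its
derivative. -/
structure Tame (S T : Set E) (φ : E → F) : Prop where
  continuousOn : ContinuousOn φ T
  differentiableAt : ∀ x ∈ S, DifferentiableAt ℝ φ x
  exists_bound : ∃ M, ∀ x ∈ S, ‖φ x‖ ≤ M ∧ ‖fderiv ℝ φ x‖ ≤ M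

variable {S T : Set E}

lemma Tame.bilin (L : F →L[ℝ] G →L[ℝ] H) {φ : E → F} {ψ : E → G} (hφ : Tame S T φ)
    (hψ : Tame S T ψ) : Tame S T fun x => L (φ x) (ψ x) := by
  obtain ⟨M, hM⟩ := hφ.exists_bound
  obtain ⟨N, hN⟩ := hψ.exists_bound
  have hd : ∀ x ∈ S, HasFDerivAt (fun x => L (φ x) (ψ x))
      (L.precompR E (φ x) (fderiv ℝ ψ x) + L.precompL E (fderiv ℝ φ x) (ψ x)) x := fun x hx =>
    L.hasFDerivAt_of_bilinear (hφ.differentiableAt x hx).hasFDerivAt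
      (hψ.differentiableAt x hx).hasFDerivAt
  refine ⟨L.continuous₂.comp_continuousOn (hφ.continuousOn.prodMk hψ.continuousOn),
    fun x hx => (hd x hx).differentiableAt,
    max (‖L‖ * M * N) (‖L‖ * M * N + ‖L‖ * M * N), fun x hx => ?_⟩
  obtain ⟨m1, m2⟩ := hM x hx
  obtain ⟨n1, n2⟩ := hN x hx
  have hM0 : 0 ≤ M := (norm_nonneg _).trans m1
  have hN0 : 0 ≤ N := (norm_nonneg _).trans n1
  constructor
  · refine (L.le_opNorm₂ _ _).trans ((?_ : _ ≤ ‖L‖ * M * N).trans (le_max_left _ _))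
    gcongr
  · rw [(hd x hx).fderiv]
    refine (norm_add_le _ _).trans ((add_le_add ?_ ?_).trans (le_max_right _ _))
    · refine (ContinuousLinearMap.le_opNorm₂ _ _ _).trans ?_
      have := ContinuousLinearMap.norm_precompR_le E L
      gcongr
    · refine (ContinuousLinearMap.le_opNorm₂ _ _ _).trans ?_
      have := ContinuousLinearMap.norm_precompL_le E L
      gcongr

lemma Tame.const (c : F) : Tame S T fun _ => c :=
  ⟨continuousOn_const, fun _ _ => differentiableAt_const c, ‖c‖, fun x _ => ⟨le_rfl, by simp⟩⟩

lemma Tame.add {φ ψ : E → F} (hφ : Tame S T φ) (hψ : Tame S T ψ) :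
    Tame S T fun x => φ x + ψ x := by
  obtain ⟨M, hM⟩ := hφ.exists_bound
  obtain ⟨N, hN⟩ := hψ.exists_bound
  refine ⟨hφ.continuousOn.add hψ.continuousOn,
    fun x hx => (hφ.differentiableAt x hx).add (hψ.differentiableAt x hx), M + N, fun x hx => ?_⟩
  refine ⟨(norm_add_le _ _).trans (add_le_add (hM x hx).1 (hN x hx).1), ?_⟩
  rw [fderiv_fun_add (hφ.differentiableAt x hx) (hψ.differentiableAt x hx)]
  exact (norm_add_le _ _).trans (add_le_add (hM x hx).2 (hN x hx).2)

lemma Tame.clm (L : F →L[ℝ] G) {φ : E → F} (hφ : Tame S T φ) : Tame S T fun x => L (φ x) :=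
  Tame.bilin (ContinuousLinearMap.id ℝ (F →L[ℝ] G)) (Tame.const L) hφ

lemma Tame.clm_apply {A : E → F →L[ℝ] G} {φ : E → F} (hA : Tame S T A) (hφ : Tame S T φ) :
    Tame S T fun x => A x (φ x) :=
  Tame.bilin (ContinuousLinearMap.id ℝ (F →L[ℝ] G)) hA hφ

lemma Tame.sub {φ ψ : E → F} (hφ : Tame S T φ) (hψ : Tame S T ψ) :
    Tame S T fun x => φ x - ψ x := by
  have := hφ.add (hψ.clm (-ContinuousLinearMap.id ℝ F))
  simpa [sub_eq_add_neg] using this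

lemma Tame.mul {φ ψ : E → ℝ} (hφ : Tame S T φ) (hψ : Tame S T ψ) :
    Tame S T fun x => φ x * ψ x :=
  Tame.bilin (ContinuousLinearMap.mul ℝ ℝ) hφ hψ

lemma Tame.inner {F : Type*} [NormedAddCommGroup F] [InnerProductSpace ℝ F] {φ ψ : E → F}
    (hφ : Tame S T φ) (hψ : Tame S T ψ) : Tame S T fun x => ⟪φ x, ψ x⟫_ℝ :=
  Tame.bilin (innerSL ℝ) hφ hψ

lemma Tame.sum {ι : Type*} {s : Finset ι} {φ : ι → E → F} (hφ : ∀ i ∈ s, Tame S T (φ i)) :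
    Tame S T fun x => ∑ i ∈ s, φ i x := by
  classical
  induction s using Finset.induction_on with
  | empty => simpa using Tame.const (0 : F)
  | insert i s hi ih =>
    simp only [Finset.sum_insert hi]
    exact (hφ i (Finset.mem_insert_self i s)).add
      (ih fun j hj => hφ j (Finset.mem_insert_of_mem hj))

lemma Tame.comp_clm (ℓ : E' →L[ℝ] E) {φ : E → F} (hφ : Tame S T φ) {S' T' : Set E'}
    (hS : MapsTo ℓ S' S) (hT : MapsTo ℓ T' T) : Tame S' T' fun x => φ (ℓ x) := by
  obtain ⟨M, hM⟩ := hφ.exists_bound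
  have hd : ∀ x ∈ S', HasFDerivAt (fun x => φ (ℓ x)) ((fderiv ℝ φ (ℓ x)).comp ℓ) x := fun x hx =>
    (hφ.differentiableAt _ (hS hx)).hasFDerivAt.comp x ℓ.hasFDerivAt
  refine ⟨hφ.continuousOn.comp ℓ.continuous.continuousOn hT, fun x hx => (hd x hx).differentiableAt,
    max M (M * ‖ℓ‖), fun x hx => ⟨((hM _ (hS hx)).1).trans (le_max_left _ _), ?_⟩⟩
  rw [(hd x hx).fderiv]
  refine (ContinuousLinearMap.opNorm_comp_le _ _).trans (le_trans ?_ (le_max_right _ _))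
  gcongr
  exact (hM _ (hS hx)).2

lemma Tame.of_contDiff [ProperSpace E] {φ : E → F} (hφ : ContDiff ℝ 1 φ)
    (hS : Bornology.IsBounded S) : Tame S T φ := by
  obtain ⟨M, hM⟩ := (hS.isCompact_closure.image hφ.continuous).isBounded.exists_norm_le
  obtain ⟨N, hN⟩ := (hS.isCompact_closure.image
    (hφ.continuous_fderiv (by norm_num))).isBounded.exists_norm_le
  exact ⟨hφ.continuous.continuousOn, fun x _ => hφ.differentiable (by norm_num) x, max M N,
    fun x hx => ⟨(hM _ ⟨x, subset_closure hx, rfl⟩).trans (le_max_left _ _),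
      (hN _ ⟨x, subset_closure hx, rfl⟩).trans (le_max_right _ _)⟩⟩

lemma Tame.mono {φ : E → F} (hφ : Tame S T φ) {S' T' : Set E} (hS : S' ⊆ S) (hT : T' ⊆ T) :
    Tame S' T' φ :=
  ⟨hφ.continuousOn.mono hT, fun x hx => hφ.differentiableAt x (hS hx),
    hφ.exists_bound.imp fun _ hM x hx => hM x (hS hx)⟩

end Tame

/-! ### The divergence theorem for vector fields and integration by parts against the Euler field.
-/

section Divergence

variable {m : ℕ} {e : Splitting m} {f : EuclideanSpace ℝ (Fin m) → ℝ}
  {Ω U : Set (EuclideanSpace ℝ (Fin (m + 1)))}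

lemma continuous_of_zero_off {E F : Type*} [TopologicalSpace E] [TopologicalSpace F]
    [Zero F] {K O : Set E} (hK : IsClosed K) (hO : IsOpen O) (hKO : K ⊆ O)
    {φ : E → F} (hφ : ContinuousOn φ O) (h0 : ∀ x ∉ K, φ x = 0) : Continuous φ := by
  refine continuous_iff_continuousAt.2 fun x => ?_
  by_cases hx : x ∈ K
  · exact hφ.continuousAt (hO.mem_nhds (hKO hx))
  · have : φ =ᶠ[𝓝 x] fun _ => 0 := by
      filter_upwards [hK.isOpen_compl.mem_nhds hx] with y hy using h0 y hy
    exact continuousAt_const.congr this.symm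

lemma fderiv_eq_zero_off {E F : Type*} [NormedAddCommGroup E] [NormedSpace ℝ E]
    [NormedAddCommGroup F] [NormedSpace ℝ F] {K : Set E} (hK : IsClosed K) {φ : E → F}
    (h0 : ∀ x ∉ K, φ x = 0) {x : E} (hx : x ∉ K) : fderiv ℝ φ x = 0 := by
  have : φ =ᶠ[𝓝 x] fun _ => 0 := by
    filter_upwards [hK.isOpen_compl.mem_nhds hx] with y hy using h0 y hy
  rw [this.fderiv_eq]; simp

lemma integrableOn_fderiv_apply {E : Type*} [NormedAddCommGroup E] [NormedSpace ℝ E]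
    [FiniteDimensional ℝ E] [MeasurableSpace E] [BorelSpace E] {μ : Measure E}
    [IsFiniteMeasureOnCompacts μ] {S K : Set E} (hS : MeasurableSet S) (hK : IsCompact K)
    {φ : E → ℝ} (h0 : ∀ x ∉ K, φ x = 0) {M : ℝ} (hM : ∀ x ∈ S ∩ K, ‖fderiv ℝ φ x‖ ≤ M) (a : E) :
    IntegrableOn (fun x => fderiv ℝ φ x a) S μ := by
  have hmeas : Measurable fun x => fderiv ℝ φ x a := measurable_fderiv_apply_const ℝ φ a
  have h1 : IntegrableOn (fun x => fderiv ℝ φ x a) (S ∩ K) μ := by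
    refine Measure.integrableOn_of_bounded (M := M * ‖a‖) ?_ hmeas.aestronglyMeasurable ?_
    · exact ((measure_mono inter_subset_right).trans_lt hK.measure_lt_top).ne
    · filter_upwards [ae_restrict_mem (hS.inter hK.measurableSet)] with x hx
      refine (ContinuousLinearMap.le_opNorm _ _).trans ?_
      gcongr
      exact hM x hx
  refine h1.of_forall_sdiff_eq_zero hS fun x hx => ?_
  rw [fderiv_eq_zero_off hK.isClosed h0 fun hxK => hx.2 ⟨hx.1, hxK⟩]; simp

lemma LocalGraph.integrableOn_sum_fderiv (h : LocalGraph e f Ω U)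
    {K : Set (EuclideanSpace ℝ (Fin (m + 1)))} (hK : IsCompact K) (hKU : K ⊆ U)
    {ζ : Fin (m + 1) → EuclideanSpace ℝ (Fin (m + 1)) → ℝ} (h0 : ∀ i, ∀ x ∉ K, ζ i x = 0)
    {T : Set (EuclideanSpace ℝ (Fin (m + 1)))} (ht : ∀ i, Tame (Ω ∩ U) T (ζ i)) :
    IntegrableOn (fun x => ∑ i, fderiv ℝ (ζ i) x (EuclideanSpace.single i 1)) Ω := by
  refine integrable_finsetSum _ fun i _ => ?_
  obtain ⟨M, hM⟩ := (ht i).exists_bound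
  exact integrableOn_fderiv_apply h.isOpen_domain.measurableSet hK (h0 i)
    (fun x hx => (hM x ⟨hx.1, hKU hx.2⟩).2) _

/-- The **divergence theorem** for the vector field with components `ζ i`. -/
lemma LocalGraph.integral_sum_fderiv (h : LocalGraph e f Ω U)
    {K : Set (EuclideanSpace ℝ (Fin (m + 1)))} (hK : IsCompact K) (hKU : K ⊆ U)
    {ζ : Fin (m + 1) → EuclideanSpace ℝ (Fin (m + 1)) → ℝ} (h0 : ∀ i, ∀ x ∉ K, ζ i x = 0)
    (ht : ∀ i, Tame (Ω ∩ U) {x | x ∈ U ∧ height e f x ≤ 0} (ζ i)) :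
    ∫ x in Ω, ∑ i, fderiv ℝ (ζ i) x (EuclideanSpace.single i 1) =
      ∫ v, ∑ i, ζ i (graphMap e f v) * ⟪EuclideanSpace.single i 1, graphNormal e f v⟫_ℝ := by
  have hγ := isClosedEmbedding_graphMap e h.smooth
  rw [integral_finsetSum, integral_finsetSum]
  · refine Finset.sum_congr rfl fun i _ => ?_
    obtain ⟨M, hM⟩ := (ht i).exists_bound
    exact integral_fderiv_subgraph e h.smooth h.isOpen_domain h.isOpen_chart h.mem_iff hK hKU
      (h0 i) (ht i).continuousOn (ht i).differentiableAt (fun x hx => (hM x hx).2) _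
  · intro i _
    have hc : Continuous fun v => ζ i (graphMap e f v) := by
      refine continuous_of_zero_off (hK.isClosed.preimage hγ.continuous)
        (h.isOpen_chart.preimage hγ.continuous) (preimage_mono hKU) ?_ fun v hv => h0 i _ hv
      exact (ht i).continuousOn.comp hγ.continuous.continuousOn
        fun v hv => ⟨hv, (height_graphMap v).le⟩
    have hN : Continuous (graphNormal e f) := by
      have := (contDiff_gradient h.smooth).continuous
      unfold graphNormal; fun_prop
    refine Continuous.integrable_of_hasCompactSupport (hc.mul (continuous_const.inner hN)) ?_
    refine HasCompactSupport.of_support_subset_isCompact (hγ.isCompact_preimage hK) fun v hv => ?_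
    by_contra hvK
    exact hv (by simp only [h0 i _ hvK, zero_mul])
  · intro i _
    obtain ⟨M, hM⟩ := (ht i).exists_bound
    exact integrableOn_fderiv_apply h.isOpen_domain.measurableSet hK (h0 i)
      (fun x hx => (hM x ⟨hx.1, hKU hx.2⟩).2) _

/-- Integration by parts against the Euler vector field centered at `v₀`. -/
lemma integral_fderiv_euler {φ : EuclideanSpace ℝ (Fin m) → ℝ}
    {K O : Set (EuclideanSpace ℝ (Fin m))} (hK : IsCompact K) (hKO : K ⊆ O)
    (h0 : ∀ v ∉ K, φ v = 0) (ht : Tame O O φ) (v₀ : EuclideanSpace ℝ (Fin m)) :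
    Integrable (fun v => fderiv ℝ φ v (v - v₀)) ∧
      ∫ v, fderiv ℝ φ v (v - v₀) = -(m * ∫ v, φ v) := by
  obtain ⟨M, hM⟩ := ht.exists_bound
  have hd : Differentiable ℝ φ := by
    intro v
    by_cases hv : v ∈ K
    · exact ht.differentiableAt v (hKO hv)
    · have : φ =ᶠ[𝓝 v] fun _ => 0 := by
        filter_upwards [hK.isClosed.isOpen_compl.mem_nhds hv] with y hy using h0 y hy
      exact (differentiableAt_const (0 : ℝ)).congr_of_eventuallyEq this
  have hcs : HasCompactSupport φ := HasCompactSupport.of_support_subset_isCompact hK fun v hv => by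
    by_contra hvK; exact hv (h0 v hvK)
  have hint : Integrable φ := hd.continuous.integrable_of_hasCompactSupport hcs
  have hexp : ∀ v, fderiv ℝ φ v (v - v₀) =
      ∑ i, (v i - v₀ i) * fderiv ℝ φ v (EuclideanSpace.single i 1) := by
    intro v
    have h1 : v - v₀ = ∑ i, (v i - v₀ i) • (EuclideanSpace.single i (1 : ℝ)) := by
      have := ((EuclideanSpace.basisFun (Fin m) ℝ).sum_repr (v - v₀)).symm
      simpa using this
    conv_lhs => rw [h1, map_sum]
    simp
  have hl' : ∀ (i : Fin m) v, HasFDerivAt (fun v : EuclideanSpace ℝ (Fin m) => v i - v₀ i)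
      (EuclideanSpace.proj (𝕜 := ℝ) i : EuclideanSpace ℝ (Fin m) →L[ℝ] ℝ) v := fun i v =>
    (EuclideanSpace.proj (𝕜 := ℝ) i).hasFDerivAt.sub_const _
  have hi1 : ∀ i : Fin m, Integrable fun v =>
      (v i - v₀ i) * fderiv ℝ φ v (EuclideanSpace.single i 1) := by
    intro i
    have a1 : Integrable (fun v => fderiv ℝ φ v (EuclideanSpace.single i 1)) := by
      rw [← integrableOn_univ]
      exact integrableOn_fderiv_apply MeasurableSet.univ hK h0 (fun x hx => (hM x (hKO hx.2)).2) _
    obtain ⟨R, hR⟩ := (hK.image (f := fun v : EuclideanSpace ℝ (Fin m) => v i - v₀ i)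
      (by fun_prop)).isBounded.exists_norm_le
    have a2 : IntegrableOn (fun v : EuclideanSpace ℝ (Fin m) =>
        (v i - v₀ i) * fderiv ℝ φ v (EuclideanSpace.single i 1)) K := by
      refine Integrable.bdd_mul (c := R) a1.integrableOn
        (by fun_prop : Continuous fun v : EuclideanSpace ℝ (Fin m) => v i - v₀ i).aestronglyMeasurable ?_
      filter_upwards [ae_restrict_mem hK.measurableSet] with v hv using hR _ ⟨v, hv, rfl⟩
    rw [← integrableOn_univ]
    refine a2.of_forall_sdiff_eq_zero MeasurableSet.univ fun v hv => ?_
    rw [fderiv_eq_zero_off hK.isClosed h0 hv.2]; simp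
  have hi2 : ∀ i : Fin m, Integrable fun v : EuclideanSpace ℝ (Fin m) => (v i - v₀ i) * φ v :=
    fun i => (by have := hd.continuous; fun_prop :
      Continuous fun v : EuclideanSpace ℝ (Fin m) => (v i - v₀ i) * φ v).integrable_of_hasCompactSupport
        hcs.mul_left
  have key : ∀ i : Fin m, ∫ v, (v i - v₀ i) * fderiv ℝ φ v (EuclideanSpace.single i 1)
      = -∫ v, φ v := by
    intro i
    rw [integral_mul_fderiv_eq_neg_fderiv_mul_of_integrable _ (hi1 i) (hi2 i)
      (fun v _ => (hl' i v).differentiableAt) (fun v _ => hd v)]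
    · simp only [(hl' i _).fderiv]; simp
    · simp only [(hl' i _).fderiv]; simpa using hint
  simp only [hexp]
  refine ⟨integrable_finsetSum _ fun i _ => hi1 i, ?_⟩
  rw [integral_finsetSum _ fun i _ => hi1 i, Finset.sum_congr rfl fun i _ => key i]
  simp

end Divergence


/-! ### Radial cutoffs with a prescribed derivative. -/

section Weight

/-- Continuous nonnegative functions vanishing outside `[a, b] ⊂ (0, r₀)`. -/
structure IsWeight (r₀ a b : ℝ) (w : ℝ → ℝ) : Prop where
  continuous : Continuous w
  nonneg : ∀ s, 0 ≤ w s
  pos : 0 < a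
  lt : a < b
  lt_radius : b < r₀
  eq_zero : ∀ s ∉ Icc a b, w s = 0

/-- The primitive of `-w` that vanishes at `r₀`. -/
noncomputable def tail (r₀ : ℝ) (w : ℝ → ℝ) (s : ℝ) : ℝ := ∫ t in s..r₀, w t

variable {r₀ a b : ℝ} {w : ℝ → ℝ}

lemma IsWeight.eq_zero_of_lt (hw : IsWeight r₀ a b w) {s : ℝ} (hs : s < a) : w s = 0 :=
  hw.eq_zero s fun h => absurd h.1 (not_le.2 hs)

lemma IsWeight.eq_zero_of_gt (hw : IsWeight r₀ a b w) {s : ℝ} (hs : b < s) : w s = 0 :=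
  hw.eq_zero s fun h => absurd h.2 (not_le.2 hs)

lemma IsWeight.hasDerivAt_tail (hw : IsWeight r₀ a b w) (s : ℝ) :
    HasDerivAt (tail r₀ w) (-w s) s :=
  intervalIntegral.integral_hasDerivAt_left (hw.continuous.intervalIntegrable _ _)
    hw.continuous.stronglyMeasurable.stronglyMeasurableAtFilter hw.continuous.continuousAt

lemma IsWeight.continuous_tail (hw : IsWeight r₀ a b w) : Continuous (tail r₀ w) :=
  continuous_iff_continuousAt.2 fun s => (hw.hasDerivAt_tail s).continuousAt

lemma IsWeight.antitone_tail (hw : IsWeight r₀ a b w) : Antitone (tail r₀ w) :=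
  antitone_of_hasDerivAt_nonpos (fun s => hw.hasDerivAt_tail s) fun s => by
    simpa using hw.nonneg s

lemma IsWeight.tail_eq_zero (hw : IsWeight r₀ a b w) {s : ℝ} (hs : b < s) : tail r₀ w s = 0 := by
  refine (intervalIntegral.integral_congr (g := fun _ => 0) fun t ht => ?_).trans (by simp)
  refine hw.eq_zero_of_gt (lt_of_lt_of_le (lt_min hs hw.lt_radius) ?_)
  exact ht.1

lemma IsWeight.tail_nonneg (hw : IsWeight r₀ a b w) (s : ℝ) : 0 ≤ tail r₀ w s := by
  rw [← hw.tail_eq_zero (lt_of_lt_of_le (lt_add_one b) (le_max_right s (b + 1)))]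
  exact hw.antitone_tail (le_max_left _ _)

lemma IsWeight.tail_eq_of_le (hw : IsWeight r₀ a b w) {s : ℝ} (hs : s ≤ a) :
    tail r₀ w s = tail r₀ w a := by
  have := intervalIntegral.integral_add_adjacent_intervals
    (hw.continuous.intervalIntegrable (μ := volume) s a) (hw.continuous.intervalIntegrable a r₀)
  rw [tail, tail, ← this, intervalIntegral.integral_of_le hs,
    setIntegral_eq_zero_of_forall_eq_zero, zero_add]
  intro t ht
  rcases ht.2.lt_or_eq with h | h
  · exact hw.eq_zero_of_lt h
  · rw [h]
    have hc := hw.continuous.tendsto a |>.mono_left (nhdsWithin_le_nhds (s := Iio a))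
    refine tendsto_nhds_unique hc (tendsto_const_nhds.congr' ?_)
    filter_upwards [self_mem_nhdsWithin] with x hx using (hw.eq_zero_of_lt hx).symm

lemma IsWeight.exists_bound (hw : IsWeight r₀ a b w) :
    ∃ M, ∀ s, |w s| ≤ M ∧ |tail r₀ w s| ≤ M := by
  obtain ⟨M, hM⟩ := (isCompact_Icc.image (s := Icc a b) hw.continuous).isBounded.exists_norm_le
  refine ⟨max (max M 0) (tail r₀ w a), fun s => ⟨?_, ?_⟩⟩
  · by_cases hs : s ∈ Icc a b
    · exact (hM _ ⟨s, hs, rfl⟩).trans ((le_max_left _ _).trans (le_max_left _ _))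
    · rw [hw.eq_zero s hs, abs_zero]; exact (le_max_right _ _).trans (le_max_left _ _)
  · rw [abs_of_nonneg (hw.tail_nonneg s)]
    refine le_trans ?_ (le_max_right _ _)
    rcases le_total s a with h | h
    · exact (hw.tail_eq_of_le h).le
    · exact hw.antitone_tail h

variable {E : Type*} [NormedAddCommGroup E] [InnerProductSpace ℝ E]

/-- The norm is not differentiable at the center, but `w` vanishes below `a > 0`, so the cutoff is
constant near `x₀`. The formula stays valid at `x = x₀` because `w 0 / 0 = 0`. -/
lemma IsWeight.hasFDerivAt_tail_norm (hw : IsWeight r₀ a b w) (x₀ x : E) :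
    HasFDerivAt (fun y => tail r₀ w ‖y - x₀‖)
      ((-(w ‖x - x₀‖ / ‖x - x₀‖)) • innerSL ℝ (x - x₀)) x := by
  rcases lt_or_ge ‖x - x₀‖ a with h | h
  · have h1 : (fun y => tail r₀ w ‖y - x₀‖) =ᶠ[𝓝 x] fun _ => tail r₀ w a := by
      have : ContinuousAt (fun y => ‖y - x₀‖) x := by fun_prop
      filter_upwards [this.eventually (Iio_mem_nhds h)] with y hy
      exact hw.tail_eq_of_le (le_of_lt hy)
    rw [hw.eq_zero_of_lt h, zero_div, neg_zero, zero_smul]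
    exact (hasFDerivAt_const _ x).congr_of_eventuallyEq h1
  · have hpos : 0 < ‖x - x₀‖ := hw.pos.trans_le h
    have h1 : HasFDerivAt (fun y : E => ‖y - x₀‖ ^ 2) (2 • (innerSL ℝ (x - x₀))) x := by
      exact ((hasFDerivAt_id x).sub_const x₀).norm_sq
    have h2 := h1.sqrt (by positivity)
    simp only [Real.sqrt_sq (norm_nonneg _)] at h2
    have h3 := HasDerivAt.comp_hasFDerivAt (f := fun y : E => ‖y - x₀‖) x
      (hw.hasDerivAt_tail ‖x - x₀‖) h2
    refine HasFDerivAt.congr_fderiv h3 ?_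
    ext y
    simp only [_root_.smul_apply, innerSL_apply_apply, smul_eq_mul, nsmul_eq_mul, Nat.cast_ofNat]
    field_simp

lemma IsWeight.tame_tail_norm (hw : IsWeight r₀ a b w) (x₀ : E) (S T : Set E) :
    Tame S T fun y => tail r₀ w ‖y - x₀‖ := by
  obtain ⟨M, hM⟩ := hw.exists_bound
  refine ⟨(hw.continuous_tail.comp (by fun_prop)).continuousOn,
    fun x _ => (hw.hasFDerivAt_tail_norm x₀ x).differentiableAt, M, fun x _ => ⟨(hM _).2, ?_⟩⟩
  rw [(hw.hasFDerivAt_tail_norm x₀ x).fderiv, norm_smul, norm_neg, innerSL_apply_norm, norm_div,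
    norm_norm]
  rcases eq_or_ne ‖x - x₀‖ 0 with h | h
  · rw [h, mul_zero]; exact (abs_nonneg _).trans (hM 0).1
  · rw [div_mul_cancel₀ _ h]; exact (hM _).1

end Weight

/-! ### Rotation of the plane and the identity that isolates the phase. -/

section Rotation

/-- The rotation of the plane by a right angle. -/
noncomputable def quarterTurn : EuclideanSpace ℝ (Fin 2) →L[ℝ] EuclideanSpace ℝ (Fin 2) :=
  LinearMap.toContinuousLinearMap
    { toFun := fun v => !₂[-v 1, v 0]
      map_add' := fun v w => by ext i; fin_cases i <;> simp; ring
      map_smul' := fun c v => by ext i; fin_cases i <;> simp }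

lemma quarterTurn_apply (v : EuclideanSpace ℝ (Fin 2)) : quarterTurn v = !₂[-v 1, v 0] := rfl

lemma inner_plane (v w : EuclideanSpace ℝ (Fin 2)) : ⟪v, w⟫_ℝ = v 0 * w 0 + v 1 * w 1 := by
  rw [PiLp.inner_apply]; simp [Fin.sum_univ_two, mul_comm]

lemma inner_quarterTurn_self (v : EuclideanSpace ℝ (Fin 2)) : ⟪v, quarterTurn v⟫_ℝ = 0 := by
  rw [inner_plane, quarterTurn_apply]; simp; ring

lemma norm_quarterTurn (v : EuclideanSpace ℝ (Fin 2)) : ‖quarterTurn v‖ = ‖v‖ := by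
  rw [← sq_eq_sq₀ (norm_nonneg _) (norm_nonneg _), ← real_inner_self_eq_norm_sq,
    ← real_inner_self_eq_norm_sq, inner_plane, inner_plane, quarterTurn_apply]
  simp; ring

/-- The tangential part of the pairing with the defect of a unit vector field. -/
lemma inner_sub_eq_of_unit {d g u : EuclideanSpace ℝ (Fin 2)} (hg : ‖g‖ = 1) (hd : ⟪d, g⟫_ℝ = 0) :
    ⟪d, u - g⟫_ℝ = ⟪d, quarterTurn g⟫_ℝ * ⟪u - g, quarterTurn u⟫_ℝ := by
  -- Since `d` is orthogonal to the unit vector `g`, it equals `⟨d, g^⊥⟩ g^⊥`. The claim then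
  -- follows from `⟨g^⊥, u - g⟩ = ⟨g^⊥, u⟩ = -⟨g, u^⊥⟩ = ⟨u - g, u^⊥⟩`.
  have hg' : g 0 * g 0 + g 1 * g 1 = 1 := by
    rw [← inner_plane, real_inner_self_eq_norm_sq, hg]; norm_num
  rw [inner_plane] at hd
  rw [inner_plane, inner_plane, inner_plane, quarterTurn_apply, quarterTurn_apply]
  simp
  linear_combination (-(d 0 * u 0 + d 1 * u 1)) * hg' + (g 0 * u 0 + g 1 * u 1 - 1) * hd

end Rotation

/-! ### Pointwise algebra of the two divergences. -/

section Contraction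

variable {n : ℕ}

lemma sum_inner_mul_apply (L : EuclideanSpace ℝ (Fin n) →L[ℝ] ℝ) (y : EuclideanSpace ℝ (Fin n)) :
    ∑ i, ⟪y, EuclideanSpace.single i 1⟫_ℝ * L (EuclideanSpace.single i 1) = L y := by
  have h1 := (EuclideanSpace.basisFun (Fin n) ℝ).sum_repr' y
  conv_rhs => rw [← h1, map_sum]
  refine Finset.sum_congr rfl fun i _ => ?_
  rw [map_smul, smul_eq_mul, real_inner_comm]; simp

/-- The sum of the squares of the entries of a linear map. -/
noncomputable def hsNormSq (P : EuclideanSpace ℝ (Fin n) →L[ℝ] EuclideanSpace ℝ (Fin 2)) : ℝ :=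
  ∑ i, ‖P (EuclideanSpace.single i 1)‖ ^ 2

lemma hsNormSq_nonneg (P : EuclideanSpace ℝ (Fin n) →L[ℝ] EuclideanSpace ℝ (Fin 2)) :
    0 ≤ hsNormSq P := Finset.sum_nonneg fun i _ => by positivity

lemma norm_apply_sq_le (P : EuclideanSpace ℝ (Fin n) →L[ℝ] EuclideanSpace ℝ (Fin 2))
    (y : EuclideanSpace ℝ (Fin n)) : ‖P y‖ ^ 2 ≤ hsNormSq P * ‖y‖ ^ 2 := by
  have h1 : ‖P y‖ ≤ ∑ i, |y i| * ‖P (EuclideanSpace.single i 1)‖ := by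
    have h2 := (EuclideanSpace.basisFun (Fin n) ℝ).sum_repr y
    conv_lhs => rw [← h2, map_sum]
    refine (norm_sum_le _ _).trans (Finset.sum_le_sum fun i _ => ?_)
    rw [map_smul, norm_smul]; simp
  have h3 := Finset.sum_mul_sq_le_sq_mul_sq Finset.univ (fun i => |y i|)
    (fun i => ‖P (EuclideanSpace.single i 1)‖)
  rw [EuclideanSpace.norm_sq_eq y, hsNormSq, mul_comm]
  refine (pow_le_pow_left₀ (norm_nonneg _) h1 2).trans (h3.trans (le_of_eq ?_))
  simp

lemma norm_apply_le (P : EuclideanSpace ℝ (Fin n) →L[ℝ] EuclideanSpace ℝ (Fin 2))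
    (y : EuclideanSpace ℝ (Fin n)) : ‖P y‖ ≤ √(hsNormSq P) * ‖y‖ := by
  refine abs_le_of_sq_le_sq' ?_ (by positivity) |>.2
  rw [mul_pow, Real.sq_sqrt (hsNormSq_nonneg P)]
  exact norm_apply_sq_le P y

lemma abs_inner_apply_le (P : EuclideanSpace ℝ (Fin n) →L[ℝ] EuclideanSpace ℝ (Fin 2))
    (y z : EuclideanSpace ℝ (Fin n)) : |⟪P y, P z⟫_ℝ| ≤ hsNormSq P * (‖y‖ * ‖z‖) := by
  refine (abs_real_inner_le_norm _ _).trans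
    ((mul_le_mul (norm_apply_le P y) (norm_apply_le P z) (norm_nonneg _) (by positivity)).trans
      (le_of_eq ?_))
  have := Real.mul_self_sqrt (hsNormSq_nonneg P)
  calc _ = (√(hsNormSq P) * √(hsNormSq P)) * (‖y‖ * ‖z‖) := by ring
    _ = _ := by rw [this]

variable (P : EuclideanSpace ℝ (Fin n) →L[ℝ] EuclideanSpace ℝ (Fin 2))
  (Q : EuclideanSpace ℝ (Fin n) →L[ℝ] EuclideanSpace ℝ (Fin n) →L[ℝ] EuclideanSpace ℝ (Fin 2))

/-- The pointwise computation of the divergence of the stress-energy vector field. -/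
lemma sum_stress_eq (hQ : ∀ y z, Q y z = Q z y) {u : EuclideanSpace ℝ (Fin 2)} {k : ℝ}
    (htr : ∑ i, Q (EuclideanSpace.single i 1) (EuclideanSpace.single i 1) = -(k • u))
    (Y y Z ν : EuclideanSpace ℝ (Fin n)) (hZ : ⟪Z, ν⟫_ℝ = 0) (c η d : ℝ) :
    ∑ i, (c * ⟪y, EuclideanSpace.single i 1⟫_ℝ * (d * ⟪Y, EuclideanSpace.single i 1⟫_ℝ
        - ⟪P Y, P (EuclideanSpace.single i 1)⟫_ℝ)
      + η * (((∑ j, ⟪Q (EuclideanSpace.single i 1) (EuclideanSpace.single j 1),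
            P (EuclideanSpace.single j 1)⟫_ℝ) - k * ⟪u, P (EuclideanSpace.single i 1)⟫_ℝ)
            * ⟪Y, EuclideanSpace.single i 1⟫_ℝ
        + d * ⟪EuclideanSpace.single i 1 + ⟪Z, EuclideanSpace.single i 1⟫_ℝ • ν,
            EuclideanSpace.single i 1⟫_ℝ
        - (⟪Q (EuclideanSpace.single i 1) Y + P (EuclideanSpace.single i 1
            + ⟪Z, EuclideanSpace.single i 1⟫_ℝ • ν), P (EuclideanSpace.single i 1)⟫_ℝ
          + ⟪P Y, Q (EuclideanSpace.single i 1) (EuclideanSpace.single i 1)⟫_ℝ)))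
      = c * (d * ⟪Y, y⟫_ℝ - ⟪P Y, P y⟫_ℝ) + η * (n * d - hsNormSq P - ⟪P ν, P Z⟫_ℝ) := by
  have s1 := sum_inner_mul_apply (innerSL ℝ Y) y
  have s2 := sum_inner_mul_apply ((innerSL ℝ (P Y)).comp P) y
  have s3 := sum_inner_mul_apply ((∑ j, (innerSL ℝ (P (EuclideanSpace.single j 1))).comp
    (Q.flip (EuclideanSpace.single j 1))) - k • (innerSL ℝ u).comp P) Y
  have s4 := sum_inner_mul_apply (innerSL ℝ ν) Z
  have s5 := sum_inner_mul_apply ((innerSL ℝ (P ν)).comp P) Z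
  have s6 : ∑ i : Fin n, ⟪EuclideanSpace.single i (1 : ℝ), EuclideanSpace.single i (1 : ℝ)⟫_ℝ = n := by
    simp
  have s7 : ∑ i, ⟪P Y, Q (EuclideanSpace.single i 1) (EuclideanSpace.single i 1)⟫_ℝ
      = -(k * ⟪u, P Y⟫_ℝ) := by
    rw [← inner_sum, htr, inner_neg_right, inner_smul_right, real_inner_comm]
  simp only [innerSL_apply_apply, ContinuousLinearMap.comp_apply, _root_.sub_apply,
    _root_.sum_apply, ContinuousLinearMap.flip_apply, _root_.smul_apply,
    smul_eq_mul] at s1 s2 s3 s4 s5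
  -- Symmetry of the Hessian cancels the second derivatives coming from the energy density against
  -- those of the quadratic term; the trace is replaced by the equation and cancels the derivative
  -- of the potential.
  have s8 : ∑ j, ⟪P (EuclideanSpace.single j 1), Q Y (EuclideanSpace.single j 1)⟫_ℝ
      = ∑ j, ⟪Q (EuclideanSpace.single j 1) Y, P (EuclideanSpace.single j 1)⟫_ℝ :=
    Finset.sum_congr rfl fun j _ => by rw [hQ, real_inner_comm]
  rw [s8] at s3
  have s9 : ∀ i, ∑ j, ⟪P (EuclideanSpace.single j 1),
      Q (EuclideanSpace.single i 1) (EuclideanSpace.single j 1)⟫_ℝ =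
      ∑ j, ⟪Q (EuclideanSpace.single i 1) (EuclideanSpace.single j 1),
        P (EuclideanSpace.single j 1)⟫_ℝ := fun i =>
    Finset.sum_congr rfl fun j _ => by rw [real_inner_comm]
  simp only [s9] at s3
  rw [real_inner_comm, hZ] at s4
  have e : ∀ i, (c * ⟪y, EuclideanSpace.single i 1⟫_ℝ * (d * ⟪Y, EuclideanSpace.single i 1⟫_ℝ
        - ⟪P Y, P (EuclideanSpace.single i 1)⟫_ℝ)
      + η * (((∑ j, ⟪Q (EuclideanSpace.single i 1) (EuclideanSpace.single j 1),
            P (EuclideanSpace.single j 1)⟫_ℝ) - k * ⟪u, P (EuclideanSpace.single i 1)⟫_ℝ)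
            * ⟪Y, EuclideanSpace.single i 1⟫_ℝ
        + d * ⟪EuclideanSpace.single i 1 + ⟪Z, EuclideanSpace.single i 1⟫_ℝ • ν,
            EuclideanSpace.single i 1⟫_ℝ
        - (⟪Q (EuclideanSpace.single i 1) Y + P (EuclideanSpace.single i 1
            + ⟪Z, EuclideanSpace.single i 1⟫_ℝ • ν), P (EuclideanSpace.single i 1)⟫_ℝ
          + ⟪P Y, Q (EuclideanSpace.single i 1) (EuclideanSpace.single i 1)⟫_ℝ)))
      = (c * d) * (⟪y, EuclideanSpace.single i 1⟫_ℝ * ⟪Y, EuclideanSpace.single i 1⟫_ℝ)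
        - c * (⟪y, EuclideanSpace.single i 1⟫_ℝ * ⟪P Y, P (EuclideanSpace.single i 1)⟫_ℝ)
        + η * (⟪Y, EuclideanSpace.single i 1⟫_ℝ *
          ((∑ j, ⟪Q (EuclideanSpace.single i 1) (EuclideanSpace.single j 1),
            P (EuclideanSpace.single j 1)⟫_ℝ) - k * ⟪u, P (EuclideanSpace.single i 1)⟫_ℝ))
        + (η * d) * ⟪EuclideanSpace.single i (1 : ℝ), EuclideanSpace.single i (1 : ℝ)⟫_ℝ
        + (η * d) * (⟪Z, EuclideanSpace.single i 1⟫_ℝ * ⟪ν, EuclideanSpace.single i 1⟫_ℝ)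
        - η * ⟪Q (EuclideanSpace.single i 1) Y, P (EuclideanSpace.single i 1)⟫_ℝ
        - η * ‖P (EuclideanSpace.single i 1)‖ ^ 2
        - η * (⟪Z, EuclideanSpace.single i 1⟫_ℝ * ⟪P ν, P (EuclideanSpace.single i 1)⟫_ℝ)
        - η * ⟪P Y, Q (EuclideanSpace.single i 1) (EuclideanSpace.single i 1)⟫_ℝ := by
    intro i
    rw [map_add, map_smul, inner_add_left, inner_add_left, inner_add_left, inner_smul_left,
      inner_smul_left, real_inner_self_eq_norm_sq (P _)]
    simp only [conj_trivial]
    ring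
  simp only [e, Finset.sum_add_distrib, Finset.sum_sub_distrib, ← Finset.mul_sum, s1, s2, s3, s4,
    s5, s6, s7]
  rw [hsNormSq]
  ring

/-- The pointwise computation of the divergence of the field testing the phase equation. -/
lemma sum_phase_eq {u : EuclideanSpace ℝ (Fin 2)} {k : ℝ}
    (htr : ∑ i, Q (EuclideanSpace.single i 1) (EuclideanSpace.single i 1) = -(k • u))
    (y Z : EuclideanSpace ℝ (Fin n)) (c η ψ : ℝ) :
    ∑ i, ((c * ⟪y, EuclideanSpace.single i 1⟫_ℝ * ψ + η * ⟪Z, EuclideanSpace.single i 1⟫_ℝ)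
        * ⟪P (EuclideanSpace.single i 1), quarterTurn u⟫_ℝ
      + η * ψ * (⟪Q (EuclideanSpace.single i 1) (EuclideanSpace.single i 1), quarterTurn u⟫_ℝ
        + ⟪P (EuclideanSpace.single i 1), quarterTurn (P (EuclideanSpace.single i 1))⟫_ℝ))
      = c * ψ * ⟪P y, quarterTurn u⟫_ℝ + η * ⟪P Z, quarterTurn u⟫_ℝ := by
  have s1 := sum_inner_mul_apply ((innerSL ℝ (quarterTurn u)).comp P) y
  have s2 := sum_inner_mul_apply ((innerSL ℝ (quarterTurn u)).comp P) Z
  -- The Laplacian is parallel to `u`, hence orthogonal to its rotation: the current is divergence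
  -- free.
  have s3 : ∑ i, ⟪Q (EuclideanSpace.single i 1) (EuclideanSpace.single i 1), quarterTurn u⟫_ℝ = 0 := by
    rw [← sum_inner, htr, inner_neg_left, inner_smul_left, inner_quarterTurn_self]; simp
  simp only [innerSL_apply_apply, ContinuousLinearMap.comp_apply] at s1 s2
  rw [real_inner_comm (quarterTurn u) (P y), real_inner_comm (quarterTurn u) (P Z), ← s1, ← s2,
    Finset.mul_sum, Finset.mul_sum, ← Finset.sum_add_distrib]
  rw [← sub_eq_zero, ← Finset.sum_sub_distrib]
  refine (Finset.sum_congr rfl fun i _ => ?_).trans ((Finset.mul_sum _ _ (η * ψ)).symm.trans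
    ((congrArg _ s3).trans (mul_zero _)))
  rw [inner_quarterTurn_self, real_inner_comm (P (EuclideanSpace.single i 1)) (quarterTurn u)]
  ring

end Contraction


/-! ### The radial field tilted to be tangent to the boundary. -/

section Correction

variable {m : ℕ} {e : Splitting m} {f : EuclideanSpace ℝ (Fin m) → ℝ}
  {v₀ : EuclideanSpace ℝ (Fin m)}

/-- The vertical correction that makes the radial field tangent to the graph. -/
noncomputable def tiltHeight (f : EuclideanSpace ℝ (Fin m) → ℝ) (v₀ v : EuclideanSpace ℝ (Fin m)) :
    ℝ := f v₀ - f v + fderiv ℝ f v (v - v₀)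

/-- The gradient of `tiltHeight`. -/
noncomputable def tiltGrad (f : EuclideanSpace ℝ (Fin m) → ℝ) (v₀ v : EuclideanSpace ℝ (Fin m)) :
    EuclideanSpace ℝ (Fin m) :=
  (InnerProductSpace.toDual ℝ (EuclideanSpace ℝ (Fin m))).symm
    ((fderiv ℝ (fderiv ℝ f) v).flip (v - v₀))

/-- A perturbation of the radial field centered at a boundary point which is tangent to the
boundary. -/
noncomputable def tiltedField (e : Splitting m) (f : EuclideanSpace ℝ (Fin m) → ℝ)
    (v₀ : EuclideanSpace ℝ (Fin m)) (x : EuclideanSpace ℝ (Fin (m + 1))) :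
    EuclideanSpace ℝ (Fin (m + 1)) :=
  (x - graphMap e f v₀) + tiltHeight f v₀ (hor e x) • axis e

lemma hasFDerivAt_fderiv (hf : ContDiff ℝ ∞ f) (v : EuclideanSpace ℝ (Fin m)) :
    HasFDerivAt (fderiv ℝ f) (fderiv ℝ (fderiv ℝ f) v) v :=
  ((hf.fderiv_right (m := ∞) (by simp)).differentiable (by simp) v).hasFDerivAt

lemma hasFDerivAt_tiltHeight (hf : ContDiff ℝ ∞ f) (v : EuclideanSpace ℝ (Fin m)) :
    HasFDerivAt (tiltHeight f v₀) ((fderiv ℝ (fderiv ℝ f) v).flip (v - v₀)) v := by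
  have h1 := ((hf.differentiable (by simp)) v).hasFDerivAt
  have h2 := (hasFDerivAt_fderiv hf v).clm_apply ((hasFDerivAt_id v).sub_const v₀)
  refine ((h1.const_sub (f v₀)).add h2).congr_fderiv ?_
  ext w
  simp

lemma inner_tiltGrad (v w : EuclideanSpace ℝ (Fin m)) :
    ⟪tiltGrad f v₀ v, w⟫_ℝ = fderiv ℝ (fderiv ℝ f) v w (v - v₀) := by
  rw [tiltGrad, InnerProductSpace.toDual_symm_apply, ContinuousLinearMap.flip_apply]

lemma norm_tiltGrad_le {M : ℝ} {v : EuclideanSpace ℝ (Fin m)}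
    (hM : ‖fderiv ℝ (fderiv ℝ f) v‖ ≤ M) : ‖tiltGrad f v₀ v‖ ≤ M * ‖v - v₀‖ := by
  rw [tiltGrad, LinearIsometryEquiv.norm_map]
  refine (ContinuousLinearMap.le_opNorm _ _).trans ?_
  rw [ContinuousLinearMap.opNorm_flip]
  gcongr

/-- The correction vanishes at `v₀`, and its gradient is the Hessian of `f` applied to `v - v₀`,
hence of first order. Being quadratic, the tilt only produces errors with an extra factor of the
distance. -/
lemma abs_tiltHeight_le (hf : ContDiff ℝ ∞ f) {M r : ℝ}
    (hM : ∀ v ∈ ball v₀ r, ‖fderiv ℝ (fderiv ℝ f) v‖ ≤ M) {v : EuclideanSpace ℝ (Fin m)}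
    (hv : v ∈ ball v₀ r) : |tiltHeight f v₀ v| ≤ M * ‖v - v₀‖ ^ 2 := by
  have hsub : closedBall v₀ ‖v - v₀‖ ⊆ ball v₀ r := closedBall_subset_ball (by
    rwa [mem_ball, dist_eq_norm] at hv)
  have h0 : tiltHeight f v₀ v₀ = 0 := by simp [tiltHeight]
  have hM0 : 0 ≤ M := (norm_nonneg (fderiv ℝ (fderiv ℝ f) v)).trans (hM v hv)
  have := (convex_closedBall v₀ ‖v - v₀‖).norm_image_sub_le_of_norm_hasFDerivWithin_le
    (f := tiltHeight f v₀) (C := M * ‖v - v₀‖)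
    (fun x _ => (hasFDerivAt_tiltHeight hf x).hasFDerivWithinAt) (fun x hx => ?_)
    (mem_closedBall_self (norm_nonneg _)) (y := v) (by simp [dist_eq_norm])
  · rw [h0, sub_zero] at this
    calc _ ≤ _ := this
      _ = _ := by ring
  · refine (ContinuousLinearMap.le_opNorm _ _).trans ?_
    rw [ContinuousLinearMap.opNorm_flip]
    rw [mem_closedBall, dist_eq_norm] at hx
    have := hM x (hsub (by simpa [dist_eq_norm] using hx))
    gcongr

lemma contDiff_tiltHeight (hf : ContDiff ℝ ∞ f) : ContDiff ℝ 1 (tiltHeight f v₀) := by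
  have h1 : ContDiff ℝ 1 (fderiv ℝ f) := (hf.fderiv_right (m := ∞) (by simp)).of_le (by simp)
  have h2 : ContDiff ℝ 1 f := hf.of_le (by simp)
  unfold tiltHeight
  exact (contDiff_const.sub h2).add (h1.clm_apply (contDiff_id.sub contDiff_const))

lemma contDiff_tiltedField (hf : ContDiff ℝ ∞ f) : ContDiff ℝ 1 (tiltedField e f v₀) := by
  unfold tiltedField
  exact (contDiff_id.sub contDiff_const).add
    (((contDiff_tiltHeight hf).comp (hor e).contDiff).smul contDiff_const)

/-- The correction is vertical and depends only on horizontal coordinates, so it changes the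
derivative by a trace-free term of rank at most one. The divergence of the field is exactly the
dimension. -/
lemma hasFDerivAt_tiltedField (hf : ContDiff ℝ ∞ f) (x : EuclideanSpace ℝ (Fin (m + 1))) :
    ∃ Y' : EuclideanSpace ℝ (Fin (m + 1)) →L[ℝ] EuclideanSpace ℝ (Fin (m + 1)),
      HasFDerivAt (tiltedField e f v₀) Y' x ∧
      ∀ a, Y' a = a + ⟪incl e (tiltGrad f v₀ (hor e x)), a⟫_ℝ • axis e := by
  refine ⟨_, ((hasFDerivAt_id x).sub_const _).add
    (((hasFDerivAt_tiltHeight hf (hor e x)).comp x (hor e).hasFDerivAt).smul_const (axis e)),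
    fun a => ?_⟩
  rw [inner_eq_coord e, hor_incl, ver_incl, inner_tiltGrad]
  simp

lemma tiltedField_graphMap (v : EuclideanSpace ℝ (Fin m)) :
    tiltedField e f v₀ (graphMap e f v) = incl e (v - v₀) + fderiv ℝ f v (v - v₀) • axis e := by
  apply ext_coord e
  · simp [tiltedField]
  · simp [tiltedField, tiltHeight]; ring

/-- This is the purpose of the tilt: the flux of the energy density through the boundary, for which
no bound would be available, disappears. -/
lemma inner_tiltedField_graphNormal (v : EuclideanSpace ℝ (Fin m)) :
    ⟪tiltedField e f v₀ (graphMap e f v), graphNormal e f v⟫_ℝ = 0 := by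
  rw [inner_graphNormal, tiltedField_graphMap]; simp

lemma norm_hor_sub_le (x : EuclideanSpace ℝ (Fin (m + 1))) :
    ‖hor e x - v₀‖ ≤ ‖x - graphMap e f v₀‖ := by
  have := norm_hor_le e (x - graphMap e f v₀)
  simpa using this

lemma inner_incl_axis (w : EuclideanSpace ℝ (Fin m)) : ⟪incl e w, axis e⟫_ℝ = 0 := by
  rw [inner_axis]; simp

end Correction

/-! ### Solutions near a boundary point, the test fields, and bounds for the phase of the data. -/

section Patch

variable {m : ℕ} {e : Splitting m} {f : EuclideanSpace ℝ (Fin m) → ℝ}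
  {Ω U : Set (EuclideanSpace ℝ (Fin (m + 1)))} {v₀ : EuclideanSpace ℝ (Fin m)}
  {r₀ Λ M ε lam C : ℝ}
  {g u : EuclideanSpace ℝ (Fin (m + 1)) → EuclideanSpace ℝ (Fin 2)}

/-- A solution near the boundary point `graphMap e f v₀`. -/
structure Patch (e : Splitting m) (f : EuclideanSpace ℝ (Fin m) → ℝ)
    (Ω U : Set (EuclideanSpace ℝ (Fin (m + 1)))) (v₀ : EuclideanSpace ℝ (Fin m))
    (r₀ Λ M ε lam C : ℝ)
    (g u : EuclideanSpace ℝ (Fin (m + 1)) → EuclideanSpace ℝ (Fin 2)) : Prop where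
  domain : IsBoundedSmoothDomain Ω
  graph : LocalGraph e f Ω U
  radius_pos : 0 < r₀
  ball_subset : ball (graphMap e f v₀) r₀ ⊆ U
  graphMap_mem : ∀ v ∈ ball v₀ r₀, graphMap e f v ∈ U
  norm_fderiv_le : ∀ v ∈ ball v₀ r₀, ‖fderiv ℝ f v‖ ≤ Λ
  norm_hessian_le : ∀ v ∈ ball v₀ r₀, ‖fderiv ℝ (fderiv ℝ f) v‖ ≤ M
  eps_pos : 0 < ε
  lam_pos : 0 < lam
  solution : IsSolution Ω ε lam g u
  unit : ∀ p ∈ frontier Ω, ‖g p‖ = 1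
  data : HasBoundaryC2Bound Ω g C

/-- The Ginzburg-Landau energy density in terms of the derivative up to the boundary. -/
noncomputable def glDensity (Ω : Set (EuclideanSpace ℝ (Fin (m + 1)))) (ε : ℝ)
    (u : EuclideanSpace ℝ (Fin (m + 1)) → EuclideanSpace ℝ (Fin 2))
    (x : EuclideanSpace ℝ (Fin (m + 1))) : ℝ :=
  hsNormSq (bdryDeriv Ω u x) / 2 + (1 - ‖u x‖ ^ 2) ^ 2 / (4 * ε ^ 2)

/-- The components of the stress-energy vector field. -/
noncomputable def stressField (e : Splitting m) (f : EuclideanSpace ℝ (Fin m) → ℝ)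
    (Ω : Set (EuclideanSpace ℝ (Fin (m + 1)))) (v₀ : EuclideanSpace ℝ (Fin m)) (r₀ ε : ℝ)
    (u : EuclideanSpace ℝ (Fin (m + 1)) → EuclideanSpace ℝ (Fin 2)) (w : ℝ → ℝ)
    (i : Fin (m + 1)) (x : EuclideanSpace ℝ (Fin (m + 1))) : ℝ :=
  tail r₀ w ‖x - graphMap e f v₀‖ * (glDensity Ω ε u x *
    ⟪tiltedField e f v₀ x, EuclideanSpace.single i 1⟫_ℝ -
    ⟪bdryDeriv Ω u x (tiltedField e f v₀ x), bdryDeriv Ω u x (EuclideanSpace.single i 1)⟫_ℝ)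

/-- The rate at which the phase of the boundary data changes along the Euler field. -/
noncomputable def phaseRate (e : Splitting m) (f : EuclideanSpace ℝ (Fin m) → ℝ)
    (g : EuclideanSpace ℝ (Fin (m + 1)) → EuclideanSpace ℝ (Fin 2))
    (v₀ v : EuclideanSpace ℝ (Fin m)) : ℝ :=
  ⟪fderiv ℝ (g ∘ graphMap e f) v (v - v₀), quarterTurn (g (graphMap e f v))⟫_ℝ

/-- The components of the field testing the equation for the phase. -/
noncomputable def phaseField (e : Splitting m) (f : EuclideanSpace ℝ (Fin m) → ℝ)
    (Ω : Set (EuclideanSpace ℝ (Fin (m + 1)))) (v₀ : EuclideanSpace ℝ (Fin m)) (r₀ : ℝ)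
    (g u : EuclideanSpace ℝ (Fin (m + 1)) → EuclideanSpace ℝ (Fin 2)) (w : ℝ → ℝ)
    (i : Fin (m + 1)) (x : EuclideanSpace ℝ (Fin (m + 1))) : ℝ :=
  tail r₀ w ‖x - graphMap e f v₀‖ * phaseRate e f g v₀ (hor e x) *
    ⟪bdryDeriv Ω u x (EuclideanSpace.single i 1), quarterTurn (u x)⟫_ℝ

/-- The anchoring energy density in the graph parametrization, with respect to surface measure. -/
noncomputable def anchorDensity (e : Splitting m) (f : EuclideanSpace ℝ (Fin m) → ℝ) (lam : ℝ)
    (g u : EuclideanSpace ℝ (Fin (m + 1)) → EuclideanSpace ℝ (Fin 2))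
    (v : EuclideanSpace ℝ (Fin m)) : ℝ :=
  lam / 2 * ‖u (graphMap e f v) - g (graphMap e f v)‖ ^ 2

/-- The localized anchoring energy density with respect to Lebesgue measure. -/
noncomputable def anchorWeight (e : Splitting m) (f : EuclideanSpace ℝ (Fin m) → ℝ)
    (v₀ : EuclideanSpace ℝ (Fin m)) (r₀ lam : ℝ)
    (g u : EuclideanSpace ℝ (Fin (m + 1)) → EuclideanSpace ℝ (Fin 2)) (w : ℝ → ℝ)
    (v : EuclideanSpace ℝ (Fin m)) : ℝ :=
  tail r₀ w ‖graphMap e f v - graphMap e f v₀‖ * (graphJac f v * anchorDensity e f lam g u v)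

/-- The part of the parameter domain that is mapped into the ball. -/
def paramBall (e : Splitting m) (f : EuclideanSpace ℝ (Fin m) → ℝ)
    (v₀ : EuclideanSpace ℝ (Fin m)) (r₀ : ℝ) : Set (EuclideanSpace ℝ (Fin m)) :=
  graphMap e f ⁻¹' ball (graphMap e f v₀) r₀

lemma hor_mem_ball {x : EuclideanSpace ℝ (Fin (m + 1))} (hx : x ∈ ball (graphMap e f v₀) r₀) :
    hor e x ∈ ball v₀ r₀ := by
  rw [mem_ball, dist_eq_norm] at hx ⊢
  exact (norm_hor_sub_le x).trans_lt hx

lemma paramBall_subset : paramBall e f v₀ r₀ ⊆ ball v₀ r₀ := fun v hv => by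
  have := hor_mem_ball (e := e) (f := f) hv
  rwa [hor_graphMap] at this

namespace Patch

variable (p : Patch e f Ω U v₀ r₀ Λ M ε lam C g u)
include p

lemma bounds_nonneg : 0 ≤ Λ ∧ 0 ≤ M ∧ 0 ≤ C := by
  have h0 := mem_ball_self (x := v₀) p.radius_pos
  refine ⟨(norm_nonneg _).trans (p.norm_fderiv_le _ h0),
    (norm_nonneg (fderiv ℝ (fderiv ℝ f) v₀)).trans (p.norm_hessian_le _ h0), ?_⟩
  have hq := p.graph.graphMap_mem (p.graphMap_mem _ h0)
  obtain ⟨ν, φ, hφ⟩ := p.domain.smooth_boundary _ hq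
  have := (p.data _ hq ν φ hφ).2
  exact le_trans (by positivity) this

lemma isOpen_paramBall : IsOpen (paramBall e f v₀ r₀) :=
  isOpen_ball.preimage (contDiff_graphMap e p.graph.smooth).continuous

lemma ballGraph : LocalGraph e f Ω (ball (graphMap e f v₀) r₀) :=
  p.graph.mono isOpen_ball p.ball_subset

lemma mem_frontier {v : EuclideanSpace ℝ (Fin m)} (hv : v ∈ ball v₀ r₀) :
    graphMap e f v ∈ frontier Ω := p.graph.graphMap_mem (p.graphMap_mem v hv)

lemma norm_le_one {x : EuclideanSpace ℝ (Fin (m + 1))} (hx : x ∈ closure Ω) : ‖u x‖ ≤ 1 :=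
  p.solution.norm_le_one p.domain p.eps_pos p.lam_pos p.unit hx

lemma data_bounds {v : EuclideanSpace ℝ (Fin m)} (hv : v ∈ ball v₀ r₀) :
    ContDiffAt ℝ 2 (g ∘ graphMap e f) v ∧ ‖fderiv ℝ (g ∘ graphMap e f) v‖ ≤ C * (1 + Λ) ∧
      ‖fderiv ℝ (fderiv ℝ (g ∘ graphMap e f)) v‖ ≤ C * ((1 + Λ) ^ 2 + M) :=
  p.graph.boundaryData_bounds p.domain p.data (p.graphMap_mem v hv) (p.norm_fderiv_le v hv)
    (p.norm_hessian_le v hv)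

lemma tame_data : Tame (ball v₀ r₀) (ball v₀ r₀) fun v => g (graphMap e f v) := by
  refine ⟨fun v hv => ((p.data_bounds hv).1.continuousAt).continuousWithinAt,
    fun v hv => (p.data_bounds hv).1.differentiableAt (by norm_num), max 1 (C * (1 + Λ)),
    fun v hv => ⟨?_, (p.data_bounds hv).2.1.trans (le_max_right _ _)⟩⟩
  rw [p.unit _ (p.mem_frontier hv)]; exact le_max_left _ _

lemma tame_fderiv_data : Tame (ball v₀ r₀) (ball v₀ r₀) (fderiv ℝ (g ∘ graphMap e f)) := by
  have h : ∀ v ∈ ball v₀ r₀, DifferentiableAt ℝ (fderiv ℝ (g ∘ graphMap e f)) v := fun v hv =>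
    ((p.data_bounds hv).1.fderiv_right (m := 1) (by norm_num)).differentiableAt (by norm_num)
  exact ⟨fun v hv => (h v hv).continuousAt.continuousWithinAt, h,
    max (C * (1 + Λ)) (C * ((1 + Λ) ^ 2 + M)),
    fun v hv => ⟨(p.data_bounds hv).2.1.trans (le_max_left _ _),
      (p.data_bounds hv).2.2.trans (le_max_right _ _)⟩⟩

lemma tame_phaseRate : Tame (ball v₀ r₀) (ball v₀ r₀) (phaseRate e f g v₀) :=
  (p.tame_fderiv_data.clm_apply (Tame.of_contDiff (contDiff_id.sub contDiff_const)
    isBounded_ball)).inner (p.tame_data.clm quarterTurn)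

lemma fderiv_data_orthogonal {v : EuclideanSpace ℝ (Fin m)} (hv : v ∈ ball v₀ r₀)
    (a : EuclideanSpace ℝ (Fin m)) :
    ⟪fderiv ℝ (g ∘ graphMap e f) v a, g (graphMap e f v)⟫_ℝ = 0 := by
  have h1 := ((p.data_bounds hv).1.differentiableAt (by norm_num)).hasFDerivAt.norm_sq
  have h2 : (fun v => ‖(g ∘ graphMap e f) v‖ ^ 2) =ᶠ[𝓝 v] fun _ => 1 := by
    filter_upwards [isOpen_ball.mem_nhds hv] with y hy
    simp [p.unit _ (p.mem_frontier hy)]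
  have h3 := congrArg (fun L => L a) ((h1.congr_of_eventuallyEq h2.symm).unique
    (hasFDerivAt_const (1 : ℝ) v))
  simp only [_root_.smul_apply, ContinuousLinearMap.comp_apply, innerSL_apply_apply,
    _root_.zero_apply, nsmul_eq_mul, Function.comp_apply] at h3
  rw [real_inner_comm]
  simpa using h3

lemma abs_phaseRate_le {v : EuclideanSpace ℝ (Fin m)} (hv : v ∈ ball v₀ r₀) :
    |phaseRate e f g v₀ v| ≤ C * (1 + Λ) * ‖v - v₀‖ := by
  refine (abs_real_inner_le_norm _ _).trans ?_
  rw [norm_quarterTurn, p.unit _ (p.mem_frontier hv), mul_one]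
  refine (ContinuousLinearMap.le_opNorm _ _).trans ?_
  gcongr
  exact (p.data_bounds hv).2.1

/-- Three terms of the product rule: the derivative of `v - v₀` leaves `∇g`; the Hessian of `g`, and
the square of `∇g` from the rotated data, both carry `|v - v₀| ≤ r₀`. Here the second-order part of
the bound on the data is used. -/
lemma norm_fderiv_phaseRate_le {v : EuclideanSpace ℝ (Fin m)} (hv : v ∈ ball v₀ r₀) :
    ‖fderiv ℝ (phaseRate e f g v₀) v‖ ≤
      C * (1 + Λ) + (C * ((1 + Λ) ^ 2 + M) + (C * (1 + Λ)) ^ 2) * r₀ := by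
  obtain ⟨hs, h1, h2⟩ := p.data_bounds hv
  have d1 : HasFDerivAt (g ∘ graphMap e f) (fderiv ℝ (g ∘ graphMap e f) v) v :=
    (hs.differentiableAt (by norm_num)).hasFDerivAt
  have d2 : HasFDerivAt (fderiv ℝ (g ∘ graphMap e f)) (fderiv ℝ (fderiv ℝ (g ∘ graphMap e f)) v) v :=
    ((hs.fderiv_right (m := 1) (by norm_num)).differentiableAt (by norm_num)).hasFDerivAt
  have d3 := (d2.clm_apply ((hasFDerivAt_id v).sub_const v₀)).inner ℝ
    (quarterTurn.hasFDerivAt.comp v d1)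
  have d4 : HasFDerivAt (phaseRate e f g v₀) _ v := d3
  obtain ⟨hΛ, hM, hC⟩ := p.bounds_nonneg
  have hr : ‖v - v₀‖ ≤ r₀ := by rw [mem_ball, dist_eq_norm] at hv; exact hv.le
  have hr0 := p.radius_pos
  have hgn : ‖g (graphMap e f v)‖ = 1 := p.unit _ (p.mem_frontier hv)
  rw [d4.fderiv]
  refine ContinuousLinearMap.opNorm_le_bound _ (by positivity) fun a => ?_
  have e1 : ‖fderiv ℝ (g ∘ graphMap e f) v a‖ ≤ C * (1 + Λ) * ‖a‖ :=
    (ContinuousLinearMap.le_opNorm _ _).trans (by gcongr)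
  have e2 : ‖fderiv ℝ (g ∘ graphMap e f) v (v - v₀)‖ ≤ C * (1 + Λ) * r₀ :=
    (ContinuousLinearMap.le_opNorm _ _).trans (by gcongr)
  have e3 : ‖fderiv ℝ (fderiv ℝ (g ∘ graphMap e f)) v a (v - v₀)‖ ≤
      C * ((1 + Λ) ^ 2 + M) * ‖a‖ * r₀ :=
    (ContinuousLinearMap.le_opNorm₂ _ _ _).trans (by gcongr)
  have e4 := abs_real_inner_le_norm (fderiv ℝ (g ∘ graphMap e f) v (v - v₀))
    (quarterTurn (fderiv ℝ (g ∘ graphMap e f) v a))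
  have e5 := abs_real_inner_le_norm (fderiv ℝ (g ∘ graphMap e f) v a
    + fderiv ℝ (fderiv ℝ (g ∘ graphMap e f)) v a (v - v₀)) (quarterTurn (g (graphMap e f v)))
  rw [norm_quarterTurn] at e4 e5
  rw [hgn, mul_one] at e5
  have e6 : ‖fderiv ℝ (g ∘ graphMap e f) v (v - v₀)‖ * ‖fderiv ℝ (g ∘ graphMap e f) v a‖ ≤
      (C * (1 + Λ) * r₀) * (C * (1 + Λ) * ‖a‖) := by gcongr
  have e7 := norm_add_le (fderiv ℝ (g ∘ graphMap e f) v a)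
    (fderiv ℝ (fderiv ℝ (g ∘ graphMap e f)) v a (v - v₀))
  rw [Real.norm_eq_abs]
  refine le_trans (le_of_eq_of_le ?_ (abs_add_le (⟪fderiv ℝ (g ∘ graphMap e f) v (v - v₀),
    quarterTurn (fderiv ℝ (g ∘ graphMap e f) v a)⟫_ℝ) (⟪fderiv ℝ (g ∘ graphMap e f) v a
    + fderiv ℝ (fderiv ℝ (g ∘ graphMap e f)) v a (v - v₀), quarterTurn (g (graphMap e f v))⟫_ℝ))) ?_
  · simp [fderivInnerCLM_apply]
  · nlinarith [e1, e3, e4, e5, e6, e7]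

end Patch

end Patch


lemma Tame.comp {E E' F : Type*} [NormedAddCommGroup E] [NormedSpace ℝ E]
    [NormedAddCommGroup E'] [NormedSpace ℝ E'] [NormedAddCommGroup F] [NormedSpace ℝ F]
    {S T : Set E} {S' T' : Set E'} {φ : E → F} {κ : E' → E} (hφ : Tame S T φ) (hκ : Tame S' T' κ)
    (hS : MapsTo κ S' S) (hT : MapsTo κ T' T) : Tame S' T' fun x => φ (κ x) := by
  obtain ⟨M, hM⟩ := hφ.exists_bound
  obtain ⟨N, hN⟩ := hκ.exists_bound
  have hd : ∀ x ∈ S', HasFDerivAt (fun x => φ (κ x)) ((fderiv ℝ φ (κ x)).comp (fderiv ℝ κ x)) x :=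
    fun x hx => (hφ.differentiableAt _ (hS hx)).hasFDerivAt.comp x
      (hκ.differentiableAt x hx).hasFDerivAt
  refine ⟨hφ.continuousOn.comp hκ.continuousOn hT, fun x hx => (hd x hx).differentiableAt,
    max M (M * N), fun x hx => ⟨((hM _ (hS hx)).1).trans (le_max_left _ _), ?_⟩⟩
  rw [(hd x hx).fderiv]
  refine (ContinuousLinearMap.opNorm_comp_le _ _).trans (le_trans ?_ (le_max_right _ _))
  have := hM _ (hS hx)
  have h0 : 0 ≤ M := (norm_nonneg _).trans this.1
  exact mul_le_mul this.2 (hN x hx).2 (norm_nonneg _) h0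

lemma IsWeight.continuous_div {r₀ a b : ℝ} {w : ℝ → ℝ} (hw : IsWeight r₀ a b w) :
    Continuous fun s => w s / s := by
  refine continuous_iff_continuousAt.2 fun s => ?_
  rcases lt_or_ge s a with h | h
  · have : (fun s => w s / s) =ᶠ[𝓝 s] fun _ => 0 := by
      filter_upwards [Iio_mem_nhds h] with t ht
      rw [hw.eq_zero_of_lt ht, zero_div]
    exact continuousAt_const.congr this.symm
  · exact hw.continuous.continuousAt.div continuousAt_id (hw.pos.trans_le h).ne'

section Calculus

variable {m : ℕ} {Ω : Set (EuclideanSpace ℝ (Fin (m + 1)))} {ε : ℝ}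
  {u : EuclideanSpace ℝ (Fin (m + 1)) → EuclideanSpace ℝ (Fin 2)}

lemma hasFDerivAt_glDensity {x : EuclideanSpace ℝ (Fin (m + 1))}
    {P : EuclideanSpace ℝ (Fin (m + 1)) →L[ℝ] EuclideanSpace ℝ (Fin 2)}
    {Q : EuclideanSpace ℝ (Fin (m + 1)) →L[ℝ] EuclideanSpace ℝ (Fin (m + 1)) →L[ℝ]
      EuclideanSpace ℝ (Fin 2)}
    (hu : HasFDerivAt u P x) (hP : HasFDerivAt (bdryDeriv Ω u) Q x) (hPx : bdryDeriv Ω u x = P) :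
    ∃ D : EuclideanSpace ℝ (Fin (m + 1)) →L[ℝ] ℝ, HasFDerivAt (glDensity Ω ε u) D x ∧
      ∀ a, D a = (∑ j, ⟪Q a (EuclideanSpace.single j 1), P (EuclideanSpace.single j 1)⟫_ℝ)
        - (1 / ε ^ 2 * (1 - ‖u x‖ ^ 2)) * ⟪u x, P a⟫_ℝ := by
  have h1 : HasFDerivAt (fun x => hsNormSq (bdryDeriv Ω u x)) _ x :=
    HasFDerivAt.fun_sum fun j (_ : j ∈ Finset.univ) =>
      (hP.clm_apply (hasFDerivAt_const (EuclideanSpace.single j (1 : ℝ)) x)).norm_sq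
  have h2 := ((hu.norm_sq.const_sub 1).pow 2).mul_const (1 / (4 * ε ^ 2))
  refine ⟨_, ((h1.mul_const (1 / 2)).add h2).congr_of_eventuallyEq
    (Filter.Eventually.of_forall fun y => ?_), fun a => ?_⟩
  · simp [glDensity, div_eq_mul_inv]
  · simp only [_root_.add_apply, _root_.smul_apply, _root_.sum_apply, _root_.neg_apply,
      ContinuousLinearMap.comp_apply, innerSL_apply_apply, hPx, smul_eq_mul, nsmul_eq_mul,
      ContinuousLinearMap.flip_apply, _root_.zero_apply, map_zero, zero_add,
      Nat.cast_ofNat]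
    rw [← Finset.mul_sum]
    simp only [real_inner_comm (P (EuclideanSpace.single _ 1)) (Q a _)]
    ring

end Calculus

/-! ### The divergence of the test fields in the interior. -/

section Patch

variable {m : ℕ} {e : Splitting m} {f : EuclideanSpace ℝ (Fin m) → ℝ}
  {Ω U : Set (EuclideanSpace ℝ (Fin (m + 1)))} {v₀ : EuclideanSpace ℝ (Fin m)}
  {r₀ Λ M ε lam C : ℝ}
  {g u : EuclideanSpace ℝ (Fin (m + 1)) → EuclideanSpace ℝ (Fin 2)} {a b : ℝ} {w : ℝ → ℝ}

/-- The gradient of `phaseRate` as a horizontal vector. -/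
noncomputable def phaseGrad (e : Splitting m) (f : EuclideanSpace ℝ (Fin m) → ℝ)
    (g : EuclideanSpace ℝ (Fin (m + 1)) → EuclideanSpace ℝ (Fin 2))
    (v₀ v : EuclideanSpace ℝ (Fin m)) : EuclideanSpace ℝ (Fin m) :=
  gradient (phaseRate e f g v₀) v

/-- The divergence of the sum of the stress-energy field and the phase field. -/
noncomputable def fieldDivergence (e : Splitting m) (f : EuclideanSpace ℝ (Fin m) → ℝ)
    (Ω : Set (EuclideanSpace ℝ (Fin (m + 1)))) (v₀ : EuclideanSpace ℝ (Fin m)) (r₀ ε : ℝ)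
    (g u : EuclideanSpace ℝ (Fin (m + 1)) → EuclideanSpace ℝ (Fin 2)) (w : ℝ → ℝ)
    (x : EuclideanSpace ℝ (Fin (m + 1))) : ℝ :=
  let y := x - graphMap e f v₀
  let P := bdryDeriv Ω u x
  let Y := tiltedField e f v₀ x
  (-(w ‖y‖ / ‖y‖) * (glDensity Ω ε u x * ⟪Y, y⟫_ℝ - ⟪P Y, P y⟫_ℝ)
    + tail r₀ w ‖y‖ * (((m + 1 : ℕ) : ℝ) * glDensity Ω ε u x - hsNormSq P
      - ⟪P (axis e), P (incl e (tiltGrad f v₀ (hor e x)))⟫_ℝ))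
  + (-(w ‖y‖ / ‖y‖) * phaseRate e f g v₀ (hor e x) * ⟪P y, quarterTurn (u x)⟫_ℝ
    + tail r₀ w ‖y‖ * ⟪P (incl e (phaseGrad e f g v₀ (hor e x))), quarterTurn (u x)⟫_ℝ)

/-- The error terms on the boundary. -/
noncomputable def anchorError (e : Splitting m) (f : EuclideanSpace ℝ (Fin m) → ℝ)
    (v₀ : EuclideanSpace ℝ (Fin m)) (r₀ lam : ℝ)
    (g u : EuclideanSpace ℝ (Fin (m + 1)) → EuclideanSpace ℝ (Fin 2)) (w : ℝ → ℝ)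
    (v : EuclideanSpace ℝ (Fin m)) : ℝ :=
  let y := graphMap e f v - graphMap e f v₀
  anchorDensity e f lam g u v * (graphJac f v * (w ‖y‖ / ‖y‖ *
    ⟪y, tiltedField e f v₀ (graphMap e f v)⟫_ℝ)
    - tail r₀ w ‖y‖ * fderiv ℝ (graphJac f) v (v - v₀))

namespace Patch

variable (p : Patch e f Ω U v₀ r₀ Λ M ε lam C g u)
include p

lemma closure_of_height {x : EuclideanSpace ℝ (Fin (m + 1))}
    (hx : x ∈ {x | x ∈ ball (graphMap e f v₀) r₀ ∧ height e f x ≤ 0}) : x ∈ closure Ω :=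
  (p.ballGraph.closure_iff hx.1).2 hx.2

lemma contDiffAt {x : EuclideanSpace ℝ (Fin (m + 1))} (hx : x ∈ Ω) : ContDiffAt ℝ 2 u x :=
  p.solution.contDiffOn.contDiffAt (closure_mem_nhds p.domain.isOpen hx)

lemma hasFDerivAt {x : EuclideanSpace ℝ (Fin (m + 1))} (hx : x ∈ Ω) :
    HasFDerivAt u (bdryDeriv Ω u x) x := by
  rw [bdryDeriv_eq p.domain.isOpen hx]
  exact ((p.contDiffAt hx).differentiableAt (by norm_num)).hasFDerivAt

lemma tame_solution : Tame (Ω ∩ ball (graphMap e f v₀) r₀)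
    {x | x ∈ ball (graphMap e f v₀) r₀ ∧ height e f x ≤ 0} u := by
  obtain ⟨B, -, hB, -⟩ := exists_bound_deriv p.domain.isOpen p.domain.isBounded
    p.domain.uniqueDiffOn p.solution.contDiffOn
  refine ⟨p.solution.contDiffOn.continuousOn.mono fun x hx => p.closure_of_height hx,
    fun x hx => (p.hasFDerivAt hx.1).differentiableAt, max 1 B, fun x hx =>
    ⟨(p.norm_le_one (subset_closure hx.1)).trans (le_max_left _ _), ?_⟩⟩
  rw [(p.hasFDerivAt hx.1).fderiv]
  exact (hB x (subset_closure hx.1)).trans (le_max_right _ _)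

lemma tame_bdryDeriv : Tame (Ω ∩ ball (graphMap e f v₀) r₀)
    {x | x ∈ ball (graphMap e f v₀) r₀ ∧ height e f x ≤ 0} (bdryDeriv Ω u) := by
  obtain ⟨B, -, hB, hB'⟩ := exists_bound_deriv p.domain.isOpen p.domain.isBounded
    p.domain.uniqueDiffOn p.solution.contDiffOn
  have hd : ∀ x ∈ Ω, HasFDerivAt (bdryDeriv Ω u) (fderiv ℝ (fderiv ℝ u) x) x := fun x hx =>
    hasFDerivAt_bdryDeriv p.domain.isOpen p.solution.contDiffOn hx
  refine ⟨(continuousOn_bdryDeriv p.domain.uniqueDiffOn p.solution.contDiffOn).mono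
    fun x hx => p.closure_of_height hx, fun x hx => (hd x hx.1).differentiableAt, B,
    fun x hx => ⟨hB x (subset_closure hx.1), ?_⟩⟩
  rw [(hd x hx.1).fderiv]
  exact hB' x hx.1

lemma tame_hsNormSq : Tame (Ω ∩ ball (graphMap e f v₀) r₀)
    {x | x ∈ ball (graphMap e f v₀) r₀ ∧ height e f x ≤ 0} fun x => hsNormSq (bdryDeriv Ω u x) := by
  have hi : ∀ i : Fin (m + 1), Tame (Ω ∩ ball (graphMap e f v₀) r₀)
      {x | x ∈ ball (graphMap e f v₀) r₀ ∧ height e f x ≤ 0}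
      fun x => bdryDeriv Ω u x (EuclideanSpace.single i 1) := fun i =>
    p.tame_bdryDeriv.clm_apply (Tame.const _)
  simp only [hsNormSq, ← real_inner_self_eq_norm_sq]
  exact Tame.sum fun i _ => (hi i).inner (hi i)

lemma tame_potential : Tame (Ω ∩ ball (graphMap e f v₀) r₀)
    {x | x ∈ ball (graphMap e f v₀) r₀ ∧ height e f x ≤ 0}
    fun x => (1 - ‖u x‖ ^ 2) ^ 2 / (4 * ε ^ 2) := by
  have hq := (Tame.const (1 : ℝ)).sub (p.tame_solution.inner p.tame_solution)
  have h1 : (fun x => (1 - ‖u x‖ ^ 2) ^ 2 / (4 * ε ^ 2)) =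
      fun x => (1 - ⟪u x, u x⟫_ℝ) * (1 - ⟪u x, u x⟫_ℝ) * (1 / (4 * ε ^ 2)) := by
    funext x; rw [real_inner_self_eq_norm_sq]; ring
  rw [h1]
  exact (hq.mul hq).mul (Tame.const _)

lemma tame_glDensity : Tame (Ω ∩ ball (graphMap e f v₀) r₀)
    {x | x ∈ ball (graphMap e f v₀) r₀ ∧ height e f x ≤ 0} (glDensity Ω ε u) := by
  have h1 : glDensity Ω ε u = fun x => hsNormSq (bdryDeriv Ω u x) * (1 / 2)
      + (1 - ‖u x‖ ^ 2) ^ 2 / (4 * ε ^ 2) := by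
    funext x; rw [glDensity]; ring
  rw [h1]
  exact (p.tame_hsNormSq.mul (Tame.const _)).add p.tame_potential

lemma tame_stressField (hw : IsWeight r₀ a b w) (i : Fin (m + 1)) :
    Tame (Ω ∩ ball (graphMap e f v₀) r₀)
    {x | x ∈ ball (graphMap e f v₀) r₀ ∧ height e f x ≤ 0}
    (stressField e f Ω v₀ r₀ ε u w i) := by
  have hY : Tame (Ω ∩ ball (graphMap e f v₀) r₀)
      {x | x ∈ ball (graphMap e f v₀) r₀ ∧ height e f x ≤ 0} (tiltedField e f v₀) :=
    Tame.of_contDiff (contDiff_tiltedField p.graph.smooth) (isBounded_ball.subset inter_subset_right)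
  exact (hw.tame_tail_norm _ _ _).mul ((p.tame_glDensity.mul (hY.inner (Tame.const _))).sub
    ((p.tame_bdryDeriv.clm_apply hY).inner (p.tame_bdryDeriv.clm_apply (Tame.const _))))

lemma tame_phaseField (hw : IsWeight r₀ a b w) (i : Fin (m + 1)) :
    Tame (Ω ∩ ball (graphMap e f v₀) r₀)
    {x | x ∈ ball (graphMap e f v₀) r₀ ∧ height e f x ≤ 0}
    (phaseField e f Ω v₀ r₀ g u w i) := by
  have hψ : Tame (Ω ∩ ball (graphMap e f v₀) r₀)
      {x | x ∈ ball (graphMap e f v₀) r₀ ∧ height e f x ≤ 0}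
      (fun x => phaseRate e f g v₀ (hor e x)) :=
    p.tame_phaseRate.comp_clm (hor e) (fun x hx => hor_mem_ball hx.2) fun x hx => hor_mem_ball hx.1
  exact ((hw.tame_tail_norm _ _ _).mul hψ).mul
    ((p.tame_bdryDeriv.clm_apply (Tame.const _)).inner (p.tame_solution.clm quarterTurn))

lemma trace_hessian {x : EuclideanSpace ℝ (Fin (m + 1))} (hx : x ∈ Ω) :
    ∑ i, fderiv ℝ (fderiv ℝ u) x (EuclideanSpace.single i 1) (EuclideanSpace.single i 1)
      = -((1 / ε ^ 2 * (1 - ‖u x‖ ^ 2)) • u x) := by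
  rw [← laplacian_eq_sum]
  exact eq_neg_of_add_eq_zero_left (p.solution.equation x hx)

/-- No second derivative of `u` survives: `sum_stress_eq` removes those of the stress field through
the equation and the symmetry of the Hessian, `sum_phase_eq` those of the phase field. What remains
is first order and can be compared with energy. -/
lemma sum_fderiv_field (hw : IsWeight r₀ a b w) {x : EuclideanSpace ℝ (Fin (m + 1))} (hx : x ∈ Ω)
    (hxB : x ∈ ball (graphMap e f v₀) r₀) :
    ∑ i, fderiv ℝ (fun x => stressField e f Ω v₀ r₀ ε u w i x + phaseField e f Ω v₀ r₀ g u w i x) x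
      (EuclideanSpace.single i 1) = fieldDivergence e f Ω v₀ r₀ ε g u w x := by
  set y := x - graphMap e f v₀ with hy
  set P := bdryDeriv Ω u x with hP
  set Q := fderiv ℝ (fderiv ℝ u) x with hQ
  have dη := hw.hasFDerivAt_tail_norm (graphMap e f v₀) x
  have du : HasFDerivAt u P x := p.hasFDerivAt hx
  have dP : HasFDerivAt (bdryDeriv Ω u) Q x :=
    hasFDerivAt_bdryDeriv p.domain.isOpen p.solution.contDiffOn hx
  obtain ⟨D, dD, hD⟩ := hasFDerivAt_glDensity (ε := ε) du dP rfl
  obtain ⟨Y', dY, hY'⟩ := hasFDerivAt_tiltedField (e := e) (v₀ := v₀) p.graph.smooth x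
  have dψ : HasFDerivAt (fun x => phaseRate e f g v₀ (hor e x)) _ x :=
    ((p.tame_phaseRate.differentiableAt _ (hor_mem_ball hxB)).hasFDerivAt).comp x
      (hor e).hasFDerivAt
  have hψ' : ∀ a, fderiv ℝ (phaseRate e f g v₀) (hor e x) (hor e a) =
      ⟪incl e (phaseGrad e f g v₀ (hor e x)), a⟫_ℝ := fun a => by
    rw [inner_eq_coord e, hor_incl, ver_incl, zero_mul, add_zero, phaseGrad, inner_gradient_left]
  have hsymm : ∀ y z, Q y z = Q z y := fun y z =>
    ((p.contDiffAt hx).isSymmSndFDerivAt (by simp)).eq y z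
  have hderiv : ∀ i, fderiv ℝ (fun x => stressField e f Ω v₀ r₀ ε u w i x
      + phaseField e f Ω v₀ r₀ g u w i x) x (EuclideanSpace.single i 1) = _ := fun i =>
    congrArg (fun L => L (EuclideanSpace.single i 1)) (HasFDerivAt.fderiv
      ((dη.mul ((dD.mul (dY.inner ℝ (hasFDerivAt_const (EuclideanSpace.single i (1 : ℝ)) x))).sub
        ((dP.clm_apply dY).inner ℝ
          (dP.clm_apply (hasFDerivAt_const (EuclideanSpace.single i (1 : ℝ)) x))))).add
      ((dη.mul dψ).mul ((dP.clm_apply (hasFDerivAt_const (EuclideanSpace.single i (1 : ℝ)) x)).inner ℝ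
        (quarterTurn.hasFDerivAt.comp x du)))))
  have s1 := sum_stress_eq P Q hsymm (p.trace_hessian hx) (tiltedField e f v₀ x) y
    (incl e (tiltGrad f v₀ (hor e x))) (axis e) (inner_incl_axis _) (-(w ‖y‖ / ‖y‖))
    (tail r₀ w ‖y‖) (glDensity Ω ε u x)
  have s2 := sum_phase_eq P Q (p.trace_hessian hx) y (incl e (phaseGrad e f g v₀ (hor e x)))
    (-(w ‖y‖ / ‖y‖)) (tail r₀ w ‖y‖) (phaseRate e f g v₀ (hor e x))
  refine Eq.trans ?_ (congrArg₂ (· + ·) s1 s2)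
  rw [← Finset.sum_add_distrib]
  refine Finset.sum_congr rfl fun i _ => ?_
  rw [hderiv i]
  simp only [_root_.add_apply, _root_.smul_apply, _root_.sub_apply,
    ContinuousLinearMap.comp_apply, innerSL_apply_apply, smul_eq_mul, ContinuousLinearMap.prod_apply,
    ContinuousLinearMap.flip_apply, _root_.zero_apply, map_zero, zero_add,
    fderivInnerCLM_apply, Pi.mul_apply, Pi.sub_apply, hD, hY', hψ', inner_zero_right,
    Function.comp_apply, ← hy, ← hP]
  rw [add_comm (P _) (Q _ (tiltedField e f v₀ x))]
  ring

end Patch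

end Patch


/-! ### The boundary flux and the first variation identity. -/

section Patch

variable {m : ℕ} {e : Splitting m} {f : EuclideanSpace ℝ (Fin m) → ℝ}
  {Ω U : Set (EuclideanSpace ℝ (Fin (m + 1)))} {v₀ : EuclideanSpace ℝ (Fin m)}
  {r₀ Λ M ε lam C : ℝ}
  {g u : EuclideanSpace ℝ (Fin (m + 1)) → EuclideanSpace ℝ (Fin 2)} {a b : ℝ} {w : ℝ → ℝ}

lemma anchorError_zero_off (hw : IsWeight r₀ a b w) {v : EuclideanSpace ℝ (Fin m)}
    (hv : v ∉ graphMap e f ⁻¹' closedBall (graphMap e f v₀) b) :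
    anchorError e f v₀ r₀ lam g u w v = 0 ∧ anchorWeight e f v₀ r₀ lam g u w v = 0 := by
  rw [mem_preimage, mem_closedBall, dist_eq_norm, not_le] at hv
  simp [anchorError, anchorWeight, hw.eq_zero_of_gt hv, hw.tail_eq_zero hv]

namespace Patch

variable (p : Patch e f Ω U v₀ r₀ Λ M ε lam C g u)
include p

/-- The anchoring condition for the normal that is not normalized; its length is the area density,
so the flux is already expressed with respect to Lebesgue measure in the parameter. -/
lemma bdryDeriv_graphNormal {v : EuclideanSpace ℝ (Fin m)} (hv : v ∈ ball v₀ r₀) :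
    bdryDeriv Ω u (graphMap e f v) (graphNormal e f v) =
      -((lam * graphJac f v) • (u (graphMap e f v) - g (graphMap e f v))) := by
  obtain ⟨ν, hν⟩ := p.domain.smooth_boundary _ (p.mem_frontier hv)
  have h1 := IsOutwardNormal.eq_graphNormal p.graph (p.graphMap_mem v hv) hν
  have h2 : bdryDeriv Ω u (graphMap e f v) ν = -(lam • (u (graphMap e f v) - g (graphMap e f v))) :=
    eq_neg_of_add_eq_zero_left (p.solution.boundary _ (p.mem_frontier hv) ν hν)
  rw [← h1, map_smul, h2, smul_neg, smul_smul, mul_comm]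

lemma hasFDerivAt_trace {v : EuclideanSpace ℝ (Fin m)} (hv : v ∈ ball v₀ r₀) :
    HasFDerivAt (fun v => u (graphMap e f v))
      ((bdryDeriv Ω u (graphMap e f v)).comp (incl e + (fderiv ℝ f v).smulRight (axis e))) v := by
  refine (hasFDerivWithinAt_bdryDeriv p.solution.contDiffOn
    (frontier_subset_closure (p.mem_frontier hv))).comp_hasFDerivAt v
    (hasFDerivAt_graphMap e p.graph.smooth v) ?_
  filter_upwards [isOpen_ball.mem_nhds hv] with y hy using
    frontier_subset_closure (p.mem_frontier hy)

lemma tame_trace : Tame (paramBall e f v₀ r₀) (paramBall e f v₀ r₀)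
    fun v => u (graphMap e f v) := by
  obtain ⟨B, hB0, hB, -⟩ := exists_bound_deriv p.domain.isOpen p.domain.isBounded
    p.domain.uniqueDiffOn p.solution.contDiffOn
  have hd : ∀ v ∈ paramBall e f v₀ r₀, HasFDerivAt (fun v => u (graphMap e f v))
      ((bdryDeriv Ω u (graphMap e f v)).comp (fderiv ℝ (graphMap e f) v)) v := fun v hv => by
    rw [(hasFDerivAt_graphMap e p.graph.smooth v).fderiv]
    exact p.hasFDerivAt_trace (paramBall_subset hv)
  refine ⟨fun v hv => (hd v hv).continuousAt.continuousWithinAt, fun v hv =>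
    (hd v hv).differentiableAt, max 1 (B * (1 + Λ)), fun v hv => ?_⟩
  have hcl : graphMap e f v ∈ closure Ω :=
    frontier_subset_closure (p.mem_frontier (paramBall_subset hv))
  refine ⟨(p.norm_le_one hcl).trans (le_max_left _ _), ?_⟩
  rw [(hd v hv).fderiv]
  refine (ContinuousLinearMap.opNorm_comp_le _ _).trans (le_trans ?_ (le_max_right _ _))
  refine mul_le_mul (hB _ hcl) ?_ (norm_nonneg _) hB0
  exact (norm_fderiv_graphMap_le p.graph.smooth v).trans
    (by have := p.norm_fderiv_le v (paramBall_subset hv); linarith)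

lemma tame_anchorDensity : Tame (paramBall e f v₀ r₀) (paramBall e f v₀ r₀)
    (anchorDensity e f lam g u) := by
  have h1 : anchorDensity e f lam g u = fun v => lam / 2 *
      ⟪u (graphMap e f v) - g (graphMap e f v), u (graphMap e f v) - g (graphMap e f v)⟫_ℝ := by
    funext v; rw [real_inner_self_eq_norm_sq]; rfl
  have h2 := p.tame_trace.sub (p.tame_data.mono paramBall_subset paramBall_subset)
  rw [h1]
  exact (Tame.const (lam / 2)).mul (h2.inner h2)

lemma tame_graphJac : Tame (paramBall e f v₀ r₀) (paramBall e f v₀ r₀) (graphJac f) :=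
  Tame.of_contDiff ((contDiff_graphJac p.graph.smooth).of_le (by simp))
    (isBounded_ball.subset paramBall_subset)

lemma tame_anchorWeight (hw : IsWeight r₀ a b w) :
    Tame (paramBall e f v₀ r₀) (paramBall e f v₀ r₀) (anchorWeight e f v₀ r₀ lam g u w) := by
  have h1 : Tame (paramBall e f v₀ r₀) (paramBall e f v₀ r₀) (graphMap e f) :=
    Tame.of_contDiff ((contDiff_graphMap e p.graph.smooth).of_le (by simp))
      (isBounded_ball.subset paramBall_subset)
  exact ((hw.tame_tail_norm (graphMap e f v₀) univ univ).comp h1 (mapsTo_univ _ _)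
    (mapsTo_univ _ _)).mul (p.tame_graphJac.mul p.tame_anchorDensity)

/-- The decisive cancellation. The stress field has flux `η λ J ⟨∂_Y u, u - g⟩`, the phase field `-η
ψ λ J ⟨u - g, u^⊥⟩`, and by `inner_sub_eq_of_unit` the latter is `-η λ J ⟨∂_Y g, u - g⟩`. The sum is
`η J` times the derivative of the anchoring density, so `λ` enters only through the anchoring
energy; completing it to the derivative of a product leaves `anchorError`. -/
lemma sum_field_normal (hw : IsWeight r₀ a b w) {v : EuclideanSpace ℝ (Fin m)}
    (hv : v ∈ paramBall e f v₀ r₀) :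
    ∑ i, (stressField e f Ω v₀ r₀ ε u w i (graphMap e f v)
        + phaseField e f Ω v₀ r₀ g u w i (graphMap e f v))
        * ⟪EuclideanSpace.single i 1, graphNormal e f v⟫_ℝ =
      fderiv ℝ (anchorWeight e f v₀ r₀ lam g u w) v (v - v₀)
        + anchorError e f v₀ r₀ lam g u w v := by
  have hvb := paramBall_subset hv
  set x := graphMap e f v with hx
  set P := bdryDeriv Ω u x with hP
  set Y := tiltedField e f v₀ x with hY
  set η := tail r₀ w ‖x - graphMap e f v₀‖ with hη
  have hYγ : Y = incl e (v - v₀) + fderiv ℝ f v (v - v₀) • axis e := tiltedField_graphMap v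
  have s1 := sum_inner_mul_apply (η • (glDensity Ω ε u x • innerSL ℝ Y - (innerSL ℝ (P Y)).comp P)
    + (η * phaseRate e f g v₀ v) • (innerSL ℝ (quarterTurn (u x))).comp P) (graphNormal e f v)
  simp only [_root_.add_apply, _root_.smul_apply, _root_.sub_apply,
    ContinuousLinearMap.comp_apply, innerSL_apply_apply, smul_eq_mul] at s1
  have hl : ∑ i, (stressField e f Ω v₀ r₀ ε u w i x + phaseField e f Ω v₀ r₀ g u w i x)
        * ⟪EuclideanSpace.single i 1, graphNormal e f v⟫_ℝ =
      η * (glDensity Ω ε u x * ⟪Y, graphNormal e f v⟫_ℝ - ⟪P Y, P (graphNormal e f v)⟫_ℝ)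
      + η * phaseRate e f g v₀ v * ⟪quarterTurn (u x), P (graphNormal e f v)⟫_ℝ := by
    rw [← s1]
    refine Finset.sum_congr rfl fun i _ => ?_
    have hh : hor e x = v := hor_graphMap e v
    rw [stressField, phaseField, hh, real_inner_comm (graphNormal e f v) (EuclideanSpace.single i 1),
      ← hP, ← hY, ← hη, real_inner_comm (quarterTurn (u x)) (P _)]
    ring
  rw [hl, inner_tiltedField_graphNormal, p.bdryDeriv_graphNormal hvb]
  have du := p.hasFDerivAt_trace hvb
  have dg : HasFDerivAt (fun v => g (graphMap e f v)) (fderiv ℝ (g ∘ graphMap e f) v) v :=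
    ((p.data_bounds hvb).1.differentiableAt (by norm_num)).hasFDerivAt
  have dh : HasFDerivAt (anchorDensity e f lam g u) _ v := ((du.sub dg).norm_sq).const_mul (lam / 2)
  have dJ : HasFDerivAt (graphJac f) (fderiv ℝ (graphJac f) v) v :=
    ((contDiff_graphJac p.graph.smooth).differentiable (by simp) v).hasFDerivAt
  have dη : HasFDerivAt (fun v => tail r₀ w ‖graphMap e f v - graphMap e f v₀‖) _ v :=
    HasFDerivAt.comp v (hw.hasFDerivAt_tail_norm (graphMap e f v₀) (graphMap e f v))
      (hasFDerivAt_graphMap e p.graph.smooth v)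
  have dW : HasFDerivAt (anchorWeight e f v₀ r₀ lam g u w) _ v := dη.mul (dJ.mul dh)
  rw [dW.fderiv]
  have hγ : (incl e + (fderiv ℝ f v).smulRight (axis e)) (v - v₀) = Y := by rw [hYγ]; rfl
  have hgu := p.unit _ (p.mem_frontier hvb)
  have hkey := inner_sub_eq_of_unit (u := u x) hgu (p.fderiv_data_orthogonal hvb (v - v₀))
  rw [← hx] at hkey
  simp only [_root_.add_apply (_ • _), _root_.smul_apply,
    ContinuousLinearMap.comp_apply, _root_.sub_apply, innerSL_apply_apply, smul_eq_mul, hγ,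
    nsmul_eq_mul, Nat.cast_ofNat, inner_neg_right, inner_smul_right, Pi.sub_apply, inner_sub_right (_ - _)]
  simp only [anchorError, ← hx, ← hP, ← hY, ← hη]
  rw [real_inner_comm (u x - g x)] at hkey
  rw [hkey, real_inner_comm (u x - g x) (quarterTurn _), real_inner_comm (u x - g x) (P Y)]
  simp only [phaseRate, ← hx]
  ring

lemma isCompact_paramClosedBall (hw : IsWeight r₀ a b w) :
    IsCompact (graphMap e f ⁻¹' closedBall (graphMap e f v₀) b) ∧
      graphMap e f ⁻¹' closedBall (graphMap e f v₀) b ⊆ paramBall e f v₀ r₀ :=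
  ⟨(isClosedEmbedding_graphMap e p.graph.smooth).isCompact_preimage (isCompact_closedBall _ _),
    preimage_mono (closedBall_subset_ball hw.lt_radius)⟩

lemma integrable_anchorError (hw : IsWeight r₀ a b w) :
    Integrable (anchorError e f v₀ r₀ lam g u w) := by
  obtain ⟨hK, hKA⟩ := p.isCompact_paramClosedBall hw
  have hγ := (contDiff_graphMap e p.graph.smooth).continuous
  have hJ := (contDiff_graphJac p.graph.smooth).continuous
  have hJ' : Continuous (fderiv ℝ (graphJac f)) :=
    (contDiff_graphJac p.graph.smooth).continuous_fderiv (by simp)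
  have hY := (contDiff_tiltedField (e := e) (v₀ := v₀) p.graph.smooth).continuous
  have hη := hw.continuous_tail
  have hq := hw.continuous_div
  have hn : Continuous fun v => ‖graphMap e f v - graphMap e f v₀‖ := (hγ.sub continuous_const).norm
  refine Continuous.integrable_of_hasCompactSupport (continuous_of_zero_off hK.isClosed
    p.isOpen_paramBall hKA ?_ fun v hv => (anchorError_zero_off hw hv).1)
    (HasCompactSupport.of_support_subset_isCompact hK fun v hv => by
      by_contra hvK; exact hv (anchorError_zero_off hw hvK).1)
  refine p.tame_anchorDensity.continuousOn.mul (Continuous.continuousOn ?_)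
  exact (hJ.mul ((hq.comp hn).mul ((hγ.sub continuous_const).inner (hY.comp hγ)))).sub
    ((hη.comp hn).mul (hJ'.clm_apply (continuous_id.sub continuous_const)))

/-- The **first variation identity** for the tilted radial field. -/
theorem first_variation (hw : IsWeight r₀ a b w) :
    IntegrableOn (fieldDivergence e f Ω v₀ r₀ ε g u w) (Ω ∩ ball (graphMap e f v₀) r₀) ∧
    ∫ x in Ω ∩ ball (graphMap e f v₀) r₀, fieldDivergence e f Ω v₀ r₀ ε g u w x =
      -(m * ∫ v in paramBall e f v₀ r₀, anchorWeight e f v₀ r₀ lam g u w v)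
        + ∫ v in paramBall e f v₀ r₀, anchorError e f v₀ r₀ lam g u w v := by
  obtain ⟨hK, hKA⟩ := p.isCompact_paramClosedBall hw
  set ζ : Fin (m + 1) → EuclideanSpace ℝ (Fin (m + 1)) → ℝ := fun i x =>
    stressField e f Ω v₀ r₀ ε u w i x + phaseField e f Ω v₀ r₀ g u w i x with hζ
  have hB : IsCompact (closedBall (graphMap e f v₀) b) := isCompact_closedBall _ _
  have hBU : closedBall (graphMap e f v₀) b ⊆ ball (graphMap e f v₀) r₀ :=
    closedBall_subset_ball hw.lt_radius
  have h0 : ∀ i, ∀ x ∉ closedBall (graphMap e f v₀) b, ζ i x = 0 := fun i x hx => by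
    rw [mem_closedBall, dist_eq_norm, not_le] at hx
    simp [hζ, stressField, phaseField, hw.tail_eq_zero hx]
  have ht := fun i => (p.tame_stressField hw i).add (p.tame_phaseField hw i)
  have hm : MeasurableSet (Ω ∩ ball (graphMap e f v₀) r₀) :=
    (p.domain.isOpen.inter isOpen_ball).measurableSet
  have hi := p.ballGraph.integrableOn_sum_fderiv hB hBU h0 ht
  have hdiv := p.ballGraph.integral_sum_fderiv hB hBU h0 ht
  have hD : EqOn (fun x => ∑ i, fderiv ℝ (ζ i) x (EuclideanSpace.single i 1))
      (fieldDivergence e f Ω v₀ r₀ ε g u w) (Ω ∩ ball (graphMap e f v₀) r₀) :=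
    fun x hx => p.sum_fderiv_field hw hx.1 hx.2
  refine ⟨(hi.mono_set inter_subset_left).congr_fun hD hm, ?_⟩
  rw [← setIntegral_congr_fun hm hD]
  have e1 : ∫ x in Ω ∩ ball (graphMap e f v₀) r₀,
      ∑ i, fderiv ℝ (ζ i) x (EuclideanSpace.single i 1) =
      ∫ x in Ω, ∑ i, fderiv ℝ (ζ i) x (EuclideanSpace.single i 1) := by
    refine (setIntegral_eq_of_subset_of_forall_sdiff_eq_zero p.domain.isOpen.measurableSet
      inter_subset_left fun x hx => ?_).symm
    refine Finset.sum_eq_zero fun i _ => ?_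
    rw [fderiv_eq_zero_off isClosed_closedBall (h0 i) fun hxK => hx.2 ⟨hx.1, hBU hxK⟩]
    simp
  -- In the parameter domain the tilted field is the Euler field, whose divergence `m = n - 1`
  -- becomes the coefficient of the anchoring energy.
  obtain ⟨hE1, hE2⟩ := integral_fderiv_euler hK hKA
    (fun v hv => (anchorError_zero_off (lam := lam) (g := g) (u := u) hw hv).2)
    (p.tame_anchorWeight hw) v₀
  have e2 : ∀ v, ∑ i, ζ i (graphMap e f v) * ⟪EuclideanSpace.single i 1, graphNormal e f v⟫_ℝ =
      fderiv ℝ (anchorWeight e f v₀ r₀ lam g u w) v (v - v₀)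
        + anchorError e f v₀ r₀ lam g u w v := by
    intro v
    by_cases hv : v ∈ paramBall e f v₀ r₀
    · exact p.sum_field_normal hw hv
    · have hvK : v ∉ graphMap e f ⁻¹' closedBall (graphMap e f v₀) b := fun h => hv (hKA h)
      rw [(anchorError_zero_off hw hvK).1, fderiv_eq_zero_off hK.isClosed
        (fun v hv => (anchorError_zero_off (lam := lam) (g := g) (u := u) hw hv).2) hvK]
      simp [h0 _ _ hvK]
  have e3 : ∀ φ : EuclideanSpace ℝ (Fin m) → ℝ,
      (∀ v ∉ graphMap e f ⁻¹' closedBall (graphMap e f v₀) b, φ v = 0) →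
      ∫ v in paramBall e f v₀ r₀, φ v = ∫ v, φ v := fun φ hφ =>
    setIntegral_eq_integral_of_forall_compl_eq_zero fun v hv => hφ v fun h => hv (hKA h)
  rw [e1, hdiv, integral_congr_ae (Filter.Eventually.of_forall e2),
    integral_add hE1 (p.integrable_anchorError hw), hE2,
    e3 _ fun v hv => (anchorError_zero_off hw hv).2,
    e3 _ fun v hv => (anchorError_zero_off hw hv).1]

end Patch

end Patch


/-! ### Error estimates for the bulk and boundary terms. -/

section GraphJac

variable {m : ℕ} {f : EuclideanSpace ℝ (Fin m) → ℝ}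

/-- Differentiating the square root leaves the factor `|∇f| / J`, which is at most `1`; hence the
Hessian bound passes to `J` without any dependence on the slope. -/
lemma abs_fderiv_graphJac_le (hf : ContDiff ℝ ∞ f) {v : EuclideanSpace ℝ (Fin m)} {M : ℝ}
    (hM : ‖fderiv ℝ (fderiv ℝ f) v‖ ≤ M) (a : EuclideanSpace ℝ (Fin m)) :
    |fderiv ℝ (graphJac f) v a| ≤ M * ‖a‖ := by
  have hM0 : 0 ≤ M := (norm_nonneg (fderiv ℝ (fderiv ℝ f) v)).trans hM
  have d1 : HasFDerivAt (gradient f) _ v :=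
    (InnerProductSpace.toDual ℝ (EuclideanSpace ℝ
      (Fin m))).symm.toContinuousLinearEquiv.toContinuousLinearMap.hasFDerivAt.comp v
      (hasFDerivAt_fderiv hf v)
  have d2 : HasFDerivAt (graphJac f) _ v := (d1.norm_sq.const_add 1).sqrt (by positivity)
  have hJ : graphJac f v = √(1 + ‖gradient f v‖ ^ 2) := rfl
  have hJ1 := one_le_graphJac (f := f) v
  have hg : ‖gradient f v‖ ≤ graphJac f v := Real.le_sqrt_of_sq_le (by linarith)
  have hn : ∀ ℓ : EuclideanSpace ℝ (Fin m) →L[ℝ] ℝ,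
      ‖(InnerProductSpace.toDual ℝ (EuclideanSpace ℝ (Fin m))).symm ℓ‖ = ‖ℓ‖ := fun ℓ =>
    LinearIsometryEquiv.norm_map _ _
  have h1 : |⟪gradient f v, (InnerProductSpace.toDual ℝ (EuclideanSpace ℝ (Fin m))).symm
      (fderiv ℝ (fderiv ℝ f) v a)⟫_ℝ| ≤ graphJac f v * (M * ‖a‖) := by
    refine (abs_real_inner_le_norm _ _).trans ?_
    rw [hn]
    have := (fderiv ℝ (fderiv ℝ f) v).le_opNorm a
    gcongr
    exact this.trans (by gcongr)
  rw [d2.fderiv]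
  have h2 : ∀ t : ℝ, (1 / (2 * graphJac f v)) * (2 * t) = t / graphJac f v := fun t => by
    field_simp
  refine le_trans (le_of_eq (congrArg abs ((?_ : _ = _).trans (h2 (⟪gradient f v,
    (InnerProductSpace.toDual ℝ (EuclideanSpace ℝ (Fin m))).symm
      (fderiv ℝ (fderiv ℝ f) v a)⟫_ℝ))))) ?_
  · rw [← hJ]
    simp only [_root_.smul_apply, ContinuousLinearMap.comp_apply, innerSL_apply_apply, smul_eq_mul,
      nsmul_eq_mul, Nat.cast_ofNat]
    rfl
  · rw [abs_div, abs_of_pos (by linarith : 0 < graphJac f v), div_le_iff₀ (by linarith)]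
    linarith

end GraphJac

/-- The numerical core of `abs_bulk_sub_le`: `β` and `η` are the weight and its primitive at
distance `r`, `z` is the tilt, `ψ` the phase rate, `h = s²` the square of the gradient, and `D` the
modified density. Tilt terms are quadratic in the gradient and carry an extra `r`; phase terms are
linear in it and are split by Young's inequality. -/
lemma abs_bulk_terms_le {r M η β c1 c2 d D h s z ψ q0 q1 q2 q3 q4 : ℝ} (hr : 0 < r) (hM : 0 ≤ M)
    (hη0 : 0 ≤ η) (hβ0 : 0 ≤ β) (hc1 : 0 ≤ c1) (hd0 : 0 ≤ d) (hdD : d ≤ D)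
    (hhD : h ≤ 2 * D) (hs : s ^ 2 = h) (hz : |z| ≤ M * r ^ 2)
    (hψ : |ψ| ≤ c1 * r) (b0 : |q0| ≤ r) (b1 : |q1| ≤ h * r) (b2 : |q2| ≤ h * (M * r))
    (b3 : |q3| ≤ s * r) (b4 : |q4| ≤ s * c2) :
    |β / r * (z * (d * q0 - q1)) + η * q2 + β / r * (ψ * q3) - η * q4| ≤
      (3 * M + 1) * ((r * η + r ^ 2 * β) * D) + (c1 ^ 2 / 2 + c2 ^ 2 / 2) * (β + η / r) := by
  have hD0 : 0 ≤ D := by linarith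
  have hq : 0 ≤ β / r := by positivity
  have t1 : |β / r * (z * (d * q0 - q1))| ≤ 3 * M * (r ^ 2 * β * D) := by
    rw [abs_mul, abs_mul, abs_of_nonneg hq]
    have c1 : |d * q0 - q1| ≤ 3 * D * r := by
      refine (abs_sub _ _).trans ?_
      rw [abs_mul, abs_of_nonneg hd0]
      calc _ ≤ D * r + 2 * D * r := by
            refine add_le_add (mul_le_mul hdD b0 (abs_nonneg _) hD0) (b1.trans ?_)
            gcongr
        _ = _ := by ring
    calc _ ≤ β / r * ((M * r ^ 2) * (3 * D * r)) := by gcongr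
      _ = _ := by field_simp
  have t2 : |η * q2| ≤ 2 * M * (r * η * D) := by
    rw [abs_mul, abs_of_nonneg hη0]
    calc _ ≤ η * (2 * D * (M * r)) := by
          refine mul_le_mul_of_nonneg_left (b2.trans ?_) hη0
          gcongr
      _ = _ := by ring
  -- The constant part of this splitting carries no energy; it is the source of the additive terms
  -- in the theorem.
  have amgm : ∀ c : ℝ, c * (r * s) ≤ r ^ 2 * D + c ^ 2 / 2 := fun c => by
    have q1 := two_mul_le_add_sq c (r * s)
    have q2 : (r * s) ^ 2 ≤ r ^ 2 * (2 * D) := by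
      rw [mul_pow, hs]; gcongr
    linarith
  have t3 : |β / r * (ψ * q3)| ≤ r ^ 2 * β * D + c1 ^ 2 / 2 * β := by
    rw [abs_mul, abs_mul, abs_of_nonneg hq]
    calc _ ≤ β / r * ((c1 * r) * (s * r)) := by gcongr
      _ = β * (c1 * (r * s)) := by field_simp
      _ ≤ β * (r ^ 2 * D + c1 ^ 2 / 2) := mul_le_mul_of_nonneg_left (amgm c1) hβ0
      _ = _ := by ring
  have t4 : |η * q4| ≤ r * η * D + c2 ^ 2 / 2 * (η / r) := by
    rw [abs_mul, abs_of_nonneg hη0]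
    calc _ ≤ η * (s * c2) := by gcongr
      _ = η / r * (c2 * (r * s)) := by field_simp
      _ ≤ η / r * (r ^ 2 * D + c2 ^ 2 / 2) := mul_le_mul_of_nonneg_left (amgm c2) (by positivity)
      _ = _ := by field_simp
  have x1 : 0 ≤ c1 ^ 2 / 2 * (η / r) := by positivity
  have x2 : 0 ≤ c2 ^ 2 / 2 * β := by positivity
  have x3 : 0 ≤ M * (r * η * D) := by positivity
  refine (abs_sub _ _).trans ((add_le_add ((abs_add_three _ _ _).trans
    (add_le_add (add_le_add t1 t2) t3)) t4).trans ?_)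
  linarith

section Patch

variable {m : ℕ} {e : Splitting m} {f : EuclideanSpace ℝ (Fin m) → ℝ}
  {Ω U : Set (EuclideanSpace ℝ (Fin (m + 1)))} {v₀ : EuclideanSpace ℝ (Fin m)}
  {r₀ Λ M ε lam C : ℝ}
  {g u : EuclideanSpace ℝ (Fin (m + 1)) → EuclideanSpace ℝ (Fin 2)} {a b : ℝ} {w : ℝ → ℝ}

/-- The integrand of the weighted bulk term, without its weight. -/
noncomputable def radialDensity {n : ℕ} (ε : ℝ)
    (u : EuclideanSpace ℝ (Fin n) → EuclideanSpace ℝ (Fin 2)) (x₀ x : EuclideanSpace ℝ (Fin n)) : ℝ :=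
  ‖radialDeriv u x₀ x‖ ^ 2 + (1 - ‖u x‖ ^ 2) ^ 2 / (2 * ((n : ℝ) - 2) * ε ^ 2)

/-- The constant in front of the terms that come from the boundary data. -/
noncomputable def dataConst (r₀ Λ M C : ℝ) : ℝ :=
  ((C * (1 + Λ)) ^ 2 + (C * (1 + Λ) + (C * ((1 + Λ) ^ 2 + M) + (C * (1 + Λ)) ^ 2) * r₀) ^ 2) / 2

lemma dataConst_nonneg : 0 ≤ dataConst r₀ Λ M C := by unfold dataConst; positivity

lemma modifiedDensity_eq (hΩ : IsOpen Ω) {x : EuclideanSpace ℝ (Fin (m + 1))} (hx : x ∈ Ω) :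
    modifiedDensity ε u x = hsNormSq (bdryDeriv Ω u x) / 2
      + ((m + 1 : ℕ) : ℝ) / (((m + 1 : ℕ) : ℝ) - 2) * ((1 - ‖u x‖ ^ 2) ^ 2 / (4 * ε ^ 2)) := by
  rw [modifiedDensity, gradSq, bdryDeriv_eq hΩ hx, hsNormSq]

namespace Patch

variable (p : Patch e f Ω U v₀ r₀ Λ M ε lam C g u)
include p

/-- For the untilted field without phase the difference would be zero: `n e - |∇u|²` is `n - 2`
times the modified density, and the modified density minus the radial one is `e` minus the squared
radial derivative, since `n / (n - 2) - 2 / (n - 2) = 1`. Only tilt and phase terms remain. -/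
lemma abs_bulk_sub_le (hm : 2 ≤ m) (hw : IsWeight r₀ a b w) {x : EuclideanSpace ℝ (Fin (m + 1))}
    (hx : x ∈ Ω) (hxB : x ∈ ball (graphMap e f v₀) r₀) :
    |tail r₀ w ‖x - graphMap e f v₀‖ * ((((m + 1 : ℕ) : ℝ) - 2) * modifiedDensity ε u x)
      - ‖x - graphMap e f v₀‖ * w ‖x - graphMap e f v₀‖ *
        (modifiedDensity ε u x - radialDensity ε u (graphMap e f v₀) x)
      - fieldDivergence e f Ω v₀ r₀ ε g u w x| ≤
    (3 * M + 1) * ((‖x - graphMap e f v₀‖ * tail r₀ w ‖x - graphMap e f v₀‖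
        + ‖x - graphMap e f v₀‖ ^ 2 * w ‖x - graphMap e f v₀‖) * modifiedDensity ε u x)
      + dataConst r₀ Λ M C * (w ‖x - graphMap e f v₀‖
        + tail r₀ w ‖x - graphMap e f v₀‖ / ‖x - graphMap e f v₀‖) := by
  obtain ⟨hΛ, hM, hC⟩ := p.bounds_nonneg
  have hr0 := p.radius_pos
  have hvb := hor_mem_ball (e := e) (f := f) hxB
  have hxne : x ≠ graphMap e f v₀ := by
    rintro rfl
    have h1 := p.mem_frontier (mem_ball_self hr0)
    rw [p.domain.isOpen.frontier_eq] at h1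
    exact h1.2 hx
  set y := x - graphMap e f v₀ with hy
  have hr : 0 < ‖y‖ := norm_pos_iff.2 (sub_ne_zero.2 hxne)
  set r := ‖y‖ with hrdef
  set P := bdryDeriv Ω u x with hP
  set h := hsNormSq P with hh
  have hh0 : 0 ≤ h := hsNormSq_nonneg P
  set W := (1 - ‖u x‖ ^ 2) ^ 2 / (4 * ε ^ 2) with hW
  have hW0 : 0 ≤ W := by positivity
  set k : ℝ := ((m + 1 : ℕ) : ℝ) - 2 with hk
  have hm' : (2 : ℝ) ≤ m := by exact_mod_cast hm
  have hk1 : 1 ≤ k := by rw [hk]; push_cast; linarith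
  have hnk : ((m + 1 : ℕ) : ℝ) = k + 2 := by rw [hk]; ring
  set D := modifiedDensity ε u x with hD
  have hDe : D = h / 2 + (k + 2) / k * W := by
    rw [hD, modifiedDensity_eq p.domain.isOpen hx, hnk, add_sub_cancel_right]
  have hWk : (k + 2) / k * W = W + 2 / k * W := by field_simp
  have h2k : 0 ≤ 2 / k * W := by positivity
  have hd : glDensity Ω ε u x = h / 2 + W := rfl
  have hdD : h / 2 + W ≤ D := by rw [hDe, hWk]; linarith
  have hhD : h ≤ 2 * D := by linarith
  have hD0 : 0 ≤ D := by linarith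
  have hNd : radialDensity ε u (graphMap e f v₀) x = ‖P y‖ ^ 2 / r ^ 2 + 2 / k * W := by
    rw [radialDensity, radialDeriv, ← bdryDeriv_eq p.domain.isOpen hx, map_smul, norm_smul, mul_pow,
      norm_inv, norm_norm, ← hy, ← hP, ← hk, ← hrdef, hW]
    have := p.eps_pos
    field_simp
    ring
  set ψ := phaseRate e f g v₀ (hor e x) with hψ
  set z := tiltHeight f v₀ (hor e x) with hz
  have hwn : ‖hor e x - v₀‖ ≤ r := norm_hor_sub_le x
  have hzb : |z| ≤ M * r ^ 2 := (abs_tiltHeight_le p.graph.smooth p.norm_hessian_le hvb).trans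
    (by gcongr)
  have hψb : |ψ| ≤ C * (1 + Λ) * r := (p.abs_phaseRate_le hvb).trans (by gcongr)
  have hZb : ‖incl e (tiltGrad f v₀ (hor e x))‖ ≤ M * r := by
    rw [norm_incl]
    exact (norm_tiltGrad_le (p.norm_hessian_le _ hvb)).trans (by gcongr)
  set c2 := C * (1 + Λ) + (C * ((1 + Λ) ^ 2 + M) + (C * (1 + Λ)) ^ 2) * r₀ with hc2
  set c1 := C * (1 + Λ) with hc1
  have hc10 : 0 ≤ c1 := by positivity
  have hZ2b : ‖incl e (phaseGrad e f g v₀ (hor e x))‖ ≤ c2 := by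
    rw [norm_incl, phaseGrad, gradient, LinearIsometryEquiv.norm_map]
    exact p.norm_fderiv_phaseRate_le hvb
  have hu1 : ‖quarterTurn (u x)‖ ≤ 1 := by
    rw [norm_quarterTurn]; exact p.norm_le_one (subset_closure hx)
  set η := tail r₀ w r with hη
  have hη0 : 0 ≤ η := hw.tail_nonneg r
  have hβ0 : 0 ≤ w r := hw.nonneg r
  have hs := Real.sq_sqrt hh0
  set s := √h with hsdef
  have b1 : |ver e y| ≤ r := abs_ver_le e y
  have b2 : |⟪P (axis e), P y⟫_ℝ| ≤ h * r := by
    have := abs_inner_apply_le P (axis e) y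
    rwa [norm_axis, one_mul] at this
  have b3 : |⟪P (axis e), P (incl e (tiltGrad f v₀ (hor e x)))⟫_ℝ| ≤ h * (M * r) := by
    refine (abs_inner_apply_le P _ _).trans ?_
    rw [norm_axis, one_mul]
    gcongr
  have b4 : |⟪P y, quarterTurn (u x)⟫_ℝ| ≤ s * r := by
    refine (abs_real_inner_le_norm _ _).trans ?_
    refine (mul_le_of_le_one_right (norm_nonneg _) hu1).trans (norm_apply_le P y)
  have b5 : |⟪P (incl e (phaseGrad e f g v₀ (hor e x))), quarterTurn (u x)⟫_ℝ| ≤ s * c2 := by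
    refine (abs_real_inner_le_norm _ _).trans ?_
    refine (mul_le_of_le_one_right (norm_nonneg _) hu1).trans ((norm_apply_le P _).trans ?_)
    gcongr
  have hYe : tiltedField e f v₀ x = y + z • axis e := rfl
  have hYy : ⟪tiltedField e f v₀ x, y⟫_ℝ = r ^ 2 + z * ver e y := by
    rw [hYe, inner_add_left, real_inner_self_eq_norm_sq, inner_smul_left, real_inner_comm,
      inner_axis]
    simp [hrdef]
  have hPY : ⟪P (tiltedField e f v₀ x), P y⟫_ℝ = ‖P y‖ ^ 2 + z * ⟪P (axis e), P y⟫_ℝ := by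
    rw [hYe, map_add, map_smul, inner_add_left, real_inner_self_eq_norm_sq, inner_smul_left]
    simp
  have key : η * (k * D) - r * w r * (D - radialDensity ε u (graphMap e f v₀) x)
      - fieldDivergence e f Ω v₀ r₀ ε g u w x =
      w r / r * (z * ((h / 2 + W) * ver e y - ⟪P (axis e), P y⟫_ℝ))
      + η * ⟪P (axis e), P (incl e (tiltGrad f v₀ (hor e x)))⟫_ℝ
      + w r / r * (ψ * ⟪P y, quarterTurn (u x)⟫_ℝ)
      - η * ⟪P (incl e (phaseGrad e f g v₀ (hor e x))), quarterTurn (u x)⟫_ℝ := by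
    simp only [fieldDivergence, ← hy, ← hP, ← hrdef, ← hψ, ← hη, hYy, hPY, hd, ← hh]
    rw [hNd, hDe, hnk]
    field_simp
    ring
  have hB : dataConst r₀ Λ M C = c1 ^ 2 / 2 + c2 ^ 2 / 2 := by rw [dataConst, hc2, hc1]; ring
  rw [key, hB]
  exact abs_bulk_terms_le hr hM hη0 hβ0 hc10 (by positivity) hdD hhD hs hzb hψb b1 b2
    b3 b4 b5

/-- Two deviations from the flat case, the tilt in `⟨y, Y⟩ = |y|² + O(|y|³)` and the radial
derivative of the area density. Both gain a factor `M |y|` against the anchoring density. -/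
lemma abs_anchorError_sub_le (hw : IsWeight r₀ a b w) {v : EuclideanSpace ℝ (Fin m)}
    (hv : v ∈ paramBall e f v₀ r₀) :
    |anchorError e f v₀ r₀ lam g u w v - ‖graphMap e f v - graphMap e f v₀‖
        * w ‖graphMap e f v - graphMap e f v₀‖ * (graphJac f v * anchorDensity e f lam g u v)| ≤
    M * ((‖graphMap e f v - graphMap e f v₀‖ * tail r₀ w ‖graphMap e f v - graphMap e f v₀‖
        + ‖graphMap e f v - graphMap e f v₀‖ ^ 2 * w ‖graphMap e f v - graphMap e f v₀‖)
        * (graphJac f v * anchorDensity e f lam g u v)) := by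
  obtain ⟨-, hM, -⟩ := p.bounds_nonneg
  have hvb := paramBall_subset hv
  set y := graphMap e f v - graphMap e f v₀ with hy
  set r := ‖y‖ with hrdef
  set H := anchorDensity e f lam g u v with hH
  have hH0 : 0 ≤ H := by have := p.lam_pos; rw [hH, anchorDensity]; positivity
  have hJ := one_le_graphJac (f := f) v
  have hη0 : 0 ≤ tail r₀ w r := hw.tail_nonneg r
  have hβ0 : 0 ≤ w r := hw.nonneg r
  have hwn : ‖v - v₀‖ ≤ r := by
    have := norm_hor_sub_le (e := e) (f := f) (v₀ := v₀) (graphMap e f v)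
    rwa [hor_graphMap] at this
  set z := tiltHeight f v₀ v with hz
  have hzb : |z| ≤ M * r ^ 2 := (abs_tiltHeight_le p.graph.smooth p.norm_hessian_le hvb).trans
    (by gcongr)
  have hY : ⟪y, tiltedField e f v₀ (graphMap e f v)⟫_ℝ = r ^ 2 + z * ver e y := by
    rw [tiltedField, hor_graphMap, inner_add_right, inner_smul_right, inner_axis,
      real_inner_self_eq_norm_sq]
  have b1 : |ver e y| ≤ r := abs_ver_le e y
  have b2 : |fderiv ℝ (graphJac f) v (v - v₀)| ≤ M * r :=
    (abs_fderiv_graphJac_le p.graph.smooth (p.norm_hessian_le v hvb) _).trans (by gcongr)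
  have hwr : w r / r * r ^ 2 = r * w r := by
    rcases eq_or_ne r 0 with h | h
    · simp [h]
    · field_simp
  have key : anchorError e f v₀ r₀ lam g u w v - r * w r * (graphJac f v * H) =
      H * (graphJac f v * (w r / r * (z * ver e y)) -
        tail r₀ w r * fderiv ℝ (graphJac f) v (v - v₀)) := by
    simp only [anchorError, ← hy, ← hrdef, ← hH, hY]
    rw [mul_add, hwr]; ring
  have t1 : |w r / r * (z * ver e y)| ≤ M * (r ^ 2 * w r) := by
    have hr : 0 ≤ r := norm_nonneg y
    rw [abs_mul, abs_mul, abs_of_nonneg (by positivity : 0 ≤ w r / r)]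
    calc _ ≤ w r / r * (M * r ^ 2 * r) := by gcongr
      _ = M * r * (w r / r * r ^ 2) := by ring
      _ = _ := by rw [hwr]; ring
  have t2 : |tail r₀ w r * fderiv ℝ (graphJac f) v (v - v₀)| ≤
      graphJac f v * (M * (r * tail r₀ w r)) := by
    have hr : 0 ≤ r := norm_nonneg y
    rw [abs_mul, abs_of_nonneg hη0]
    calc _ ≤ tail r₀ w r * (M * r) := by gcongr
      _ = 1 * (M * (r * tail r₀ w r)) := by ring
      _ ≤ _ := by gcongr
  rw [key, abs_mul, abs_of_nonneg hH0]
  calc _ ≤ H * (graphJac f v * (M * (r ^ 2 * w r)) + graphJac f v * (M * (r * tail r₀ w r))) := by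
        refine mul_le_mul_of_nonneg_left ((abs_sub _ _).trans (add_le_add ?_ t2)) hH0
        rw [abs_mul, abs_of_nonneg (by linarith)]
        gcongr
    _ = _ := by ring

end Patch

end Patch


/-! ### Pushing energies forward to the half-line. -/

section RadialMeasure

variable {S : Type*} [MeasurableSpace S] {κ : Measure S} {ρ d : S → ℝ}

/-- The distribution of `ρ` under the measure with density `d`. -/
noncomputable def radialMeasure (κ : Measure S) (ρ d : S → ℝ) : Measure ℝ :=
  (κ.withDensity fun s => ENNReal.ofReal (d s)).map ρ

lemma isFiniteMeasure_radialMeasure (hd : Integrable d κ) :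
    IsFiniteMeasure (radialMeasure κ ρ d) := by
  have := isFiniteMeasure_withDensity_ofReal hd.hasFiniteIntegral
  exact Measure.isFiniteMeasure_map _ _

lemma setIntegral_radialMeasure (hd : Integrable d κ) (h0 : 0 ≤ᵐ[κ] d) (hρ : Measurable ρ)
    {φ : ℝ → ℝ} (hφ : Measurable φ) {T : Set ℝ} (hT : MeasurableSet T) :
    ∫ s in T, φ s ∂(radialMeasure κ ρ d) = ∫ x in ρ ⁻¹' T, φ (ρ x) * d x ∂κ := by
  rw [radialMeasure, setIntegral_map hT hφ.aestronglyMeasurable hρ.aemeasurable,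
    restrict_withDensity (hρ hT), integral_withDensity_eq_integral_toReal_smul₀
    (hd.aemeasurable.restrict.ennreal_ofReal) (by simp)]
  refine integral_congr_ae ?_
  filter_upwards [ae_restrict_of_ae h0] with x hx
  rw [ENNReal.toReal_ofReal hx, smul_eq_mul, mul_comm]

lemma integral_radialMeasure (hd : Integrable d κ) (h0 : 0 ≤ᵐ[κ] d) (hρ : Measurable ρ)
    {φ : ℝ → ℝ} (hφ : Measurable φ) :
    ∫ s, φ s ∂(radialMeasure κ ρ d) = ∫ x, φ (ρ x) * d x ∂κ := by
  have := setIntegral_radialMeasure hd h0 hρ hφ MeasurableSet.univ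
  simpa using this

lemma integrableOn_radialMeasure (hd : Integrable d κ) (h0 : 0 ≤ᵐ[κ] d) (hρ : Measurable ρ)
    {φ : ℝ → ℝ} (hφ : Measurable φ) {T : Set ℝ} (hT : MeasurableSet T) :
    IntegrableOn φ T (radialMeasure κ ρ d) ↔ IntegrableOn (fun x => φ (ρ x) * d x) (ρ ⁻¹' T) κ := by
  rw [IntegrableOn, radialMeasure, Measure.restrict_map hρ hT,
    integrable_map_measure hφ.aestronglyMeasurable hρ.aemeasurable, restrict_withDensity (hρ hT),
    integrable_withDensity_iff_integrable_smul₀' hd.aemeasurable.restrict.ennreal_ofReal (by simp)]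
  refine integrable_congr ?_
  filter_upwards [ae_restrict_of_ae h0] with x hx
  rw [ENNReal.toReal_ofReal hx, smul_eq_mul, mul_comm, Function.comp_apply]

lemma ae_radialMeasure (hρ : Measurable ρ) {T : Set ℝ} (hT : MeasurableSet T)
    (h : ∀ᵐ x ∂κ, ρ x ∈ T) : ∀ᵐ s ∂(radialMeasure κ ρ d), s ∈ T := by
  refine (ae_map_iff hρ.aemeasurable hT).2 ?_
  exact (withDensity_absolutelyContinuous κ _).ae_le h

lemma radialMeasure_le {d' : S → ℝ} (hρ : Measurable ρ) (h : d ≤ᵐ[κ] fun x => 2 * d' x) :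
    radialMeasure κ ρ d ≤ 2 • radialMeasure κ ρ d' := by
  have h1 : κ.withDensity (fun s => ENNReal.ofReal (d s)) ≤
      (2 : ENNReal) • κ.withDensity (fun s => ENNReal.ofReal (d' s)) := by
    rw [← withDensity_smul' _ _ ENNReal.ofNat_ne_top]
    refine withDensity_mono ?_
    filter_upwards [h] with x hx
    refine (ENNReal.ofReal_le_ofReal hx).trans ?_
    rw [ENNReal.ofReal_mul zero_le_two]
    simp
  refine (Measure.map_mono h1 hρ).trans (le_of_eq ?_)
  rw [Measure.map_smul, radialMeasure]
  ext s; simp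

end RadialMeasure

/-! ### Polar coordinates for the error terms without energy. -/

section Polar

/-- The surface area of the unit sphere in dimension `k`. -/
noncomputable def sphereConst (k : ℕ) : ℝ :=
  k * volume.real (ball (0 : EuclideanSpace ℝ (Fin k)) 1)

lemma sphereConst_nonneg (k : ℕ) : 0 ≤ sphereConst k := by unfold sphereConst; positivity

lemma integral_ball_radial {k : ℕ} (hk : 1 ≤ k) {r₀ : ℝ} (hr₀ : 0 ≤ r₀) (φ : ℝ → ℝ)
    (x₀ : EuclideanSpace ℝ (Fin k)) :
    ∫ x in ball x₀ r₀, φ ‖x - x₀‖ = sphereConst k * ∫ s in (0 : ℝ)..r₀, s ^ (k - 1) * φ s := by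
  have : Nonempty (Fin k) := ⟨⟨0, hk⟩⟩
  have h1 := integral_fun_norm_addHaar (volume : Measure (EuclideanSpace ℝ (Fin k)))
    ((Iio r₀).indicator φ)
  rw [← integral_sub_right_eq_self _ x₀] at h1
  have h2 : ∀ x : EuclideanSpace ℝ (Fin k), (Iio r₀).indicator φ ‖x - x₀‖ =
      (ball x₀ r₀).indicator (fun x => φ ‖x - x₀‖) x := fun x => by
    simp [indicator, dist_eq_norm]
  simp only [h2] at h1
  rw [integral_indicator measurableSet_ball] at h1
  have h3 : ∀ y : ℝ, y ^ (k - 1) • (Iio r₀).indicator φ y =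
      (Iio r₀).indicator (fun s => s ^ (k - 1) * φ s) y := fun y => by
    simp [indicator]
  rw [h1, finrank_euclideanSpace_fin]
  simp only [h3]
  rw [setIntegral_indicator measurableSet_Iio, Ioi_inter_Iio, intervalIntegral.integral_of_le hr₀,
    ← integral_Ioc_eq_integral_Ioo, sphereConst, nsmul_eq_mul, smul_eq_mul]
  ring

lemma integrableOn_ball_radial {k : ℕ} (hk : 1 ≤ k) {r₀ : ℝ} {φ : ℝ → ℝ}
    (x₀ : EuclideanSpace ℝ (Fin k)) (h : IntegrableOn (fun s => s ^ (k - 1) * φ s) (Ioo 0 r₀)) :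
    IntegrableOn (fun x => φ ‖x - x₀‖) (ball x₀ r₀) := by
  have : Nonempty (Fin k) := ⟨⟨0, hk⟩⟩
  have h1 := (integrableOn_fun_norm_addHaar (volume : Measure (EuclideanSpace ℝ (Fin k)))
    (f := φ) (r := r₀)).2 (by simpa using h)
  rw [← integrable_indicator_iff measurableSet_ball] at h1 ⊢
  have h2 := h1.comp_sub_right x₀
  refine h2.congr (Filter.Eventually.of_forall fun x => ?_)
  simp [indicator, dist_eq_norm]

variable {r₀ a b : ℝ} {w : ℝ → ℝ}

/-- Integration by parts; the boundary terms vanish because the primitive vanishes at `r₀` and `s ^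
k` at `0`. -/
lemma IsWeight.integral_pow_mul_tail (hw : IsWeight r₀ a b w) {k : ℕ} (hk : 1 ≤ k) :
    ∫ s in (0 : ℝ)..r₀, s ^ (k - 1) * tail r₀ w s = (1 / k) * ∫ s in (0 : ℝ)..r₀, s ^ k * w s := by
  have hk0 : (k : ℝ) ≠ 0 := by positivity
  have h1 := intervalIntegral.integral_mul_deriv_eq_deriv_mul (a := 0) (b := r₀)
    (u := tail r₀ w) (v := fun s => s ^ k) (fun s _ => hw.hasDerivAt_tail s)
    (fun s _ => hasDerivAt_pow k s) (hw.continuous.neg.intervalIntegrable _ _)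
    ((by fun_prop : Continuous fun s : ℝ => (k : ℝ) * s ^ (k - 1)).intervalIntegrable _ _)
  rw [hw.tail_eq_zero hw.lt_radius, zero_pow (by omega), zero_mul, mul_zero, sub_zero, zero_sub,
    ← intervalIntegral.integral_neg] at h1
  have h2 : ∀ s, tail r₀ w s * (k * s ^ (k - 1)) = k * (s ^ (k - 1) * tail r₀ w s) := fun s => by
    ring
  have h3 : ∀ s, -(-w s * s ^ k) = s ^ k * w s := fun s => by ring
  simp only [h2, h3, intervalIntegral.integral_const_mul] at h1
  rw [← h1]; field_simp

lemma IsWeight.integrableOn_ball (hw : IsWeight r₀ a b w) {m : ℕ} (hm : 1 ≤ m)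
    (x₀ : EuclideanSpace ℝ (Fin (m + 1))) :
    IntegrableOn (fun x => w ‖x - x₀‖ + tail r₀ w ‖x - x₀‖ / ‖x - x₀‖) (ball x₀ r₀) := by
  refine integrableOn_ball_radial (by omega) (φ := fun s => w s + tail r₀ w s / s) x₀ ?_
  have hc : Continuous fun s => s ^ m * w s + s ^ (m - 1) * tail r₀ w s := by
    have := hw.continuous; have := hw.continuous_tail; fun_prop
  refine ((hc.integrableOn_Icc (a := 0) (b := r₀)).mono_set Ioo_subset_Icc_self).congr_fun
    (fun s hs => ?_) measurableSet_Ioo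
  have : s ≠ 0 := hs.1.ne'
  obtain ⟨k, rfl⟩ : ∃ k, m = k + 1 := ⟨m - 1, by omega⟩
  simp only [Nat.add_sub_cancel]
  field_simp
  ring

/-- In polar coordinates the singular factor `1 / |x - x₀|` lowers the power of the Jacobian by one,
and integrating by parts trades the primitive for `w` with the power restored. So the constants from
Young's inequality become the last term of `FirstVariationIneq`. -/
lemma IsWeight.integral_ball (hw : IsWeight r₀ a b w) {m : ℕ} (hm : 1 ≤ m)
    (x₀ : EuclideanSpace ℝ (Fin (m + 1))) :
    ∫ x in ball x₀ r₀, (w ‖x - x₀‖ + tail r₀ w ‖x - x₀‖ / ‖x - x₀‖) ≤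
      2 * sphereConst (m + 1) * ∫ s in (0 : ℝ)..r₀, s ^ m * w s := by
  have hr₀ : 0 ≤ r₀ := (hw.pos.trans (hw.lt.trans hw.lt_radius)).le
  rw [integral_ball_radial (by omega) hr₀ (fun s => w s + tail r₀ w s / s) x₀]
  have h1 : ∫ s in (0 : ℝ)..r₀, s ^ (m + 1 - 1) * (w s + tail r₀ w s / s) =
      ∫ s in (0 : ℝ)..r₀, (s ^ m * w s + s ^ (m - 1) * tail r₀ w s) := by
    refine intervalIntegral.integral_congr_ae ?_
    refine Filter.Eventually.of_forall fun s hs => ?_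
    rw [uIoc_of_le hr₀] at hs
    have : s ≠ 0 := hs.1.ne'
    obtain ⟨k, rfl⟩ : ∃ k, m = k + 1 := ⟨m - 1, by omega⟩
    simp only [Nat.add_sub_cancel]
    field_simp
    ring
  have hc1 : Continuous fun s => s ^ m * w s := by have := hw.continuous; fun_prop
  have hc2 : Continuous fun s => s ^ (m - 1) * tail r₀ w s := by
    have := hw.continuous_tail; fun_prop
  rw [h1, intervalIntegral.integral_add (hc1.intervalIntegrable _ _) (hc2.intervalIntegrable _ _),
    hw.integral_pow_mul_tail hm]
  have hI : 0 ≤ ∫ s in (0 : ℝ)..r₀, s ^ m * w s :=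
    intervalIntegral.integral_nonneg hr₀ fun s hs => mul_nonneg (pow_nonneg hs.1 _) (hw.nonneg s)
  have hm1 : (1 : ℝ) / m ≤ 1 := by
    rw [div_le_one (by positivity)]; exact_mod_cast hm
  have := sphereConst_nonneg (m + 1)
  nlinarith [mul_le_mul_of_nonneg_left (mul_le_mul_of_nonneg_right hm1 hI) this]

end Polar


lemma integrable_comp_mul {S : Type*} [MeasurableSpace S] {κ : Measure S} {ρ d : S → ℝ} {r₀ : ℝ}
    (hd : Integrable d κ) (hρ : Measurable ρ) (hmem : ∀ᵐ x ∂κ, ρ x ∈ Ico 0 r₀) {φ : ℝ → ℝ}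
    (hφ : Continuous φ) : Integrable (fun x => φ (ρ x) * d x) κ := by
  obtain ⟨M, hM⟩ := (isCompact_Icc.image (s := Icc 0 r₀) hφ).isBounded.exists_norm_le
  refine hd.bdd_mul (c := M) (hφ.measurable.comp hρ).aestronglyMeasurable ?_
  filter_upwards [hmem] with x hx using hM _ ⟨_, Ico_subset_Icc_self hx, rfl⟩

lemma integral_radialMeasure_add {S S' : Type*} [MeasurableSpace S] [MeasurableSpace S']
    {κ : Measure S} {κ' : Measure S'} {ρ d : S → ℝ} {ρ' d' : S' → ℝ} {r₀ : ℝ}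
    (hd : Integrable d κ) (h0 : 0 ≤ᵐ[κ] d) (hρ : Measurable ρ) (hmem : ∀ᵐ x ∂κ, ρ x ∈ Ico 0 r₀)
    (hd' : Integrable d' κ') (h0' : 0 ≤ᵐ[κ'] d') (hρ' : Measurable ρ')
    (hmem' : ∀ᵐ x ∂κ', ρ' x ∈ Ico 0 r₀) {φ : ℝ → ℝ} (hφ : Continuous φ) :
    ∫ s, φ s ∂(radialMeasure κ ρ d + radialMeasure κ' ρ' d') =
      (∫ x, φ (ρ x) * d x ∂κ) + ∫ x, φ (ρ' x) * d' x ∂κ' := by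
  rw [integral_add_measure, integral_radialMeasure hd h0 hρ hφ.measurable,
    integral_radialMeasure hd' h0' hρ' hφ.measurable]
  · rw [← integrableOn_univ, integrableOn_radialMeasure hd h0 hρ hφ.measurable .univ]
    simpa using integrable_comp_mul hd hρ hmem hφ
  · rw [← integrableOn_univ, integrableOn_radialMeasure hd' h0' hρ' hφ.measurable .univ]
    simpa using integrable_comp_mul hd' hρ' hmem' hφ

lemma Tame.integrableOn {E : Type*} [NormedAddCommGroup E] [NormedSpace ℝ E] [MeasurableSpace E]
    [BorelSpace E] {μ : Measure E} {S T : Set E} {φ : E → ℝ} (hφ : Tame S T φ) (hST : S ⊆ T)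
    (hS : MeasurableSet S) (hfin : μ S ≠ ⊤) : IntegrableOn φ S μ := by
  obtain ⟨M, hM⟩ := hφ.exists_bound
  refine ⟨(hφ.continuousOn.mono hST).aestronglyMeasurable hS,
    .restrict_of_bounded (C := M) hfin.lt_top ?_⟩
  filter_upwards [ae_restrict_mem hS] with x hx using (hM x hx).1

/-! ### The first variation inequality for the radial energy distributions. -/

section Patch

variable {m : ℕ} {e : Splitting m} {f : EuclideanSpace ℝ (Fin m) → ℝ}
  {Ω U : Set (EuclideanSpace ℝ (Fin (m + 1)))} {v₀ : EuclideanSpace ℝ (Fin m)}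
  {r₀ Λ M ε lam C : ℝ}
  {g u : EuclideanSpace ℝ (Fin (m + 1)) → EuclideanSpace ℝ (Fin 2)} {a b : ℝ} {w : ℝ → ℝ}

/-- The anchoring energy density in the graph parametrization, with respect to Lebesgue measure. -/
noncomputable def anchorJac (e : Splitting m) (f : EuclideanSpace ℝ (Fin m) → ℝ) (lam : ℝ)
    (g u : EuclideanSpace ℝ (Fin (m + 1)) → EuclideanSpace ℝ (Fin 2))
    (v : EuclideanSpace ℝ (Fin m)) : ℝ := graphJac f v * anchorDensity e f lam g u v

/-- The distance of a boundary point from the center, in the graph parametrization. -/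
noncomputable def paramDist (e : Splitting m) (f : EuclideanSpace ℝ (Fin m) → ℝ)
    (v₀ v : EuclideanSpace ℝ (Fin m)) : ℝ := ‖graphMap e f v - graphMap e f v₀‖

/-- The radial distribution of an energy with a density in the domain and the density `c` times the
anchoring energy density on the boundary. -/
noncomputable def energyMeasure (e : Splitting m) (f : EuclideanSpace ℝ (Fin m) → ℝ)
    (Ω : Set (EuclideanSpace ℝ (Fin (m + 1)))) (v₀ : EuclideanSpace ℝ (Fin m)) (r₀ lam : ℝ)
    (g u : EuclideanSpace ℝ (Fin (m + 1)) → EuclideanSpace ℝ (Fin 2))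
    (d : EuclideanSpace ℝ (Fin (m + 1)) → ℝ) (c : ℝ) : Measure ℝ :=
  radialMeasure (volume.restrict (Ω ∩ ball (graphMap e f v₀) r₀)) (fun x => ‖x - graphMap e f v₀‖) d
    + radialMeasure (volume.restrict (paramBall e f v₀ r₀)) (paramDist e f v₀)
      fun v => c * anchorJac e f lam g u v

lemma volume_inter_ball_ne_top : volume (Ω ∩ ball (graphMap e f v₀) r₀) ≠ ⊤ :=
  ((measure_mono inter_subset_right).trans_lt measure_ball_lt_top).ne

lemma volume_paramBall_ne_top : volume (paramBall e f v₀ r₀) ≠ ⊤ :=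
  ((measure_mono paramBall_subset).trans_lt measure_ball_lt_top).ne

lemma measurable_dist_graphMap : Measurable fun x : EuclideanSpace ℝ (Fin (m + 1)) =>
    ‖x - graphMap e f v₀‖ := by fun_prop

namespace Patch

variable (p : Patch e f Ω U v₀ r₀ Λ M ε lam C g u)
include p

lemma measurableSet_bulk : MeasurableSet (Ω ∩ ball (graphMap e f v₀) r₀) :=
  (p.domain.isOpen.inter isOpen_ball).measurableSet

lemma measurableSet_paramBall : MeasurableSet (paramBall e f v₀ r₀) :=
  p.isOpen_paramBall.measurableSet

lemma bulk_subset : Ω ∩ ball (graphMap e f v₀) r₀ ⊆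
    {x | x ∈ ball (graphMap e f v₀) r₀ ∧ height e f x ≤ 0} := fun x hx =>
  ⟨hx.2, ((p.ballGraph.mem_iff x hx.2).1 hx.1).le⟩

lemma ne_center {x : EuclideanSpace ℝ (Fin (m + 1))} (hx : x ∈ Ω) : x ≠ graphMap e f v₀ := by
  rintro rfl
  have h1 := p.mem_frontier (mem_ball_self p.radius_pos)
  rw [p.domain.isOpen.frontier_eq] at h1
  exact h1.2 hx

lemma integrable_hsNormSq : IntegrableOn (fun x => hsNormSq (bdryDeriv Ω u x))
    (Ω ∩ ball (graphMap e f v₀) r₀) :=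
  p.tame_hsNormSq.integrableOn p.bulk_subset p.measurableSet_bulk volume_inter_ball_ne_top

lemma integrable_potential : IntegrableOn (fun x => (1 - ‖u x‖ ^ 2) ^ 2 / (4 * ε ^ 2))
    (Ω ∩ ball (graphMap e f v₀) r₀) :=
  p.tame_potential.integrableOn p.bulk_subset p.measurableSet_bulk volume_inter_ball_ne_top

lemma integrable_modifiedDensity : IntegrableOn (modifiedDensity ε u)
    (Ω ∩ ball (graphMap e f v₀) r₀) := by
  have := (p.integrable_hsNormSq.div_const 2).add (p.integrable_potential.const_mul
    (((m + 1 : ℕ) : ℝ) / (((m + 1 : ℕ) : ℝ) - 2)))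
  refine IntegrableOn.congr_fun this (fun x hx => ?_) p.measurableSet_bulk
  exact (modifiedDensity_eq p.domain.isOpen hx.1).symm

lemma radialDeriv_le {x : EuclideanSpace ℝ (Fin (m + 1))} (hx : x ∈ Ω) :
    ‖radialDeriv u (graphMap e f v₀) x‖ ^ 2 ≤ hsNormSq (bdryDeriv Ω u x) := by
  rw [radialDeriv, ← bdryDeriv_eq p.domain.isOpen hx]
  refine (norm_apply_sq_le _ _).trans ?_
  rw [norm_smul, norm_inv, norm_norm, inv_mul_cancel₀ (norm_ne_zero_iff.2
    (sub_ne_zero.2 (p.ne_center hx))), one_pow, mul_one]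

lemma radialDensity_eq (x : EuclideanSpace ℝ (Fin (m + 1))) :
    radialDensity ε u (graphMap e f v₀) x = ‖radialDeriv u (graphMap e f v₀) x‖ ^ 2 +
      2 / (((m + 1 : ℕ) : ℝ) - 2) * ((1 - ‖u x‖ ^ 2) ^ 2 / (4 * ε ^ 2)) := by
  rw [radialDensity]
  have := p.eps_pos
  congr 1
  rw [div_mul_div_comm, show 2 * (((m + 1 : ℕ) : ℝ) - 2) * ε ^ 2
    = ((((m + 1 : ℕ) : ℝ) - 2) * (4 * ε ^ 2)) / 2 by ring, div_div_eq_mul_div, mul_comm 2]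

lemma densities_nonneg (hm : 2 ≤ m) {x : EuclideanSpace ℝ (Fin (m + 1))} (hx : x ∈ Ω) :
    0 ≤ modifiedDensity ε u x ∧ 0 ≤ radialDensity ε u (graphMap e f v₀) x ∧
      radialDensity ε u (graphMap e f v₀) x ≤ 2 * modifiedDensity ε u x := by
  have h1 := p.radialDeriv_le hx
  have h2 := hsNormSq_nonneg (bdryDeriv Ω u x)
  have hm' : (2 : ℝ) ≤ m := by exact_mod_cast hm
  have hk : (1 : ℝ) ≤ ((m + 1 : ℕ) : ℝ) - 2 := by push_cast; linarith
  have h3 : 0 ≤ (1 - ‖u x‖ ^ 2) ^ 2 / (4 * ε ^ 2) := by positivity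
  have h4 : 2 / (((m + 1 : ℕ) : ℝ) - 2) ≤ 2 * (((m + 1 : ℕ) : ℝ) / (((m + 1 : ℕ) : ℝ) - 2)) := by
    rw [← mul_div_assoc]
    gcongr
    push_cast; linarith
  have h5 : 0 ≤ 2 / (((m + 1 : ℕ) : ℝ) - 2) := by positivity
  have h6 := mul_le_mul_of_nonneg_right h4 h3
  have h7 := mul_nonneg h5 h3
  rw [p.radialDensity_eq, modifiedDensity_eq p.domain.isOpen hx]
  refine ⟨?_, by positivity, ?_⟩ <;> nlinarith [sq_nonneg ‖radialDeriv u (graphMap e f v₀) x‖]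

lemma measurable_paramDist : Measurable (paramDist e f v₀) := by
  have := (contDiff_graphMap e p.graph.smooth).continuous
  unfold paramDist; fun_prop

lemma dist_mem : ∀ᵐ x ∂(volume.restrict (Ω ∩ ball (graphMap e f v₀) r₀)),
    ‖x - graphMap e f v₀‖ ∈ Ico 0 r₀ := by
  filter_upwards [ae_restrict_mem p.measurableSet_bulk] with x hx
  exact ⟨norm_nonneg _, by simpa [dist_eq_norm] using hx.2⟩

lemma paramDist_mem : ∀ᵐ v ∂(volume.restrict (paramBall e f v₀ r₀)),
    paramDist e f v₀ v ∈ Ico 0 r₀ := by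
  filter_upwards [ae_restrict_mem p.measurableSet_paramBall] with v hv
  refine ⟨norm_nonneg _, ?_⟩
  have h1 : graphMap e f v ∈ ball (graphMap e f v₀) r₀ := hv
  rwa [mem_ball, dist_eq_norm] at h1

lemma aestronglyMeasurable_radialDeriv : AEStronglyMeasurable
    (fun x => ‖radialDeriv u (graphMap e f v₀) x‖ ^ 2)
    (volume.restrict (Ω ∩ ball (graphMap e f v₀) r₀)) := by
  have h1 : ContinuousOn (fun x =>
      ‖bdryDeriv Ω u x (‖x - graphMap e f v₀‖⁻¹ • (x - graphMap e f v₀))‖ ^ 2)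
      (Ω ∩ ball (graphMap e f v₀) r₀) := by
    have hP : ContinuousOn (bdryDeriv Ω u) (Ω ∩ ball (graphMap e f v₀) r₀) :=
      p.tame_bdryDeriv.continuousOn.mono p.bulk_subset
    have hs : ContinuousOn (fun x => x - graphMap e f v₀) (Ω ∩ ball (graphMap e f v₀) r₀) := by
      fun_prop
    have hi : ContinuousOn (fun x => ‖x - graphMap e f v₀‖⁻¹) (Ω ∩ ball (graphMap e f v₀) r₀) :=
      hs.norm.inv₀ fun x hx => norm_ne_zero_iff.2 (sub_ne_zero.2 (p.ne_center hx.1))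
    exact (hP.clm_apply (hi.smul hs)).norm.pow 2
  refine (h1.aestronglyMeasurable p.measurableSet_bulk).congr ?_
  filter_upwards [ae_restrict_mem p.measurableSet_bulk] with x hx
  rw [radialDeriv, bdryDeriv_eq p.domain.isOpen hx.1]

lemma integrable_radialDensity : IntegrableOn (radialDensity ε u (graphMap e f v₀))
    (Ω ∩ ball (graphMap e f v₀) r₀) := by
  have h1 : IntegrableOn (fun x => ‖radialDeriv u (graphMap e f v₀) x‖ ^ 2)
      (Ω ∩ ball (graphMap e f v₀) r₀) := by
    refine Integrable.mono' p.integrable_hsNormSq p.aestronglyMeasurable_radialDeriv ?_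
    filter_upwards [ae_restrict_mem p.measurableSet_bulk] with x hx
    rw [Real.norm_of_nonneg (by positivity)]
    exact p.radialDeriv_le hx.1
  have h2 := h1.add (p.integrable_potential.const_mul (2 / (((m + 1 : ℕ) : ℝ) - 2)))
  exact IntegrableOn.congr_fun h2 (fun x _ => (p.radialDensity_eq x).symm) p.measurableSet_bulk

lemma tame_anchorJac : Tame (paramBall e f v₀ r₀) (paramBall e f v₀ r₀)
    (anchorJac e f lam g u) := p.tame_graphJac.mul p.tame_anchorDensity

lemma integrable_anchorJac : IntegrableOn (anchorJac e f lam g u) (paramBall e f v₀ r₀) :=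
  p.tame_anchorJac.integrableOn Subset.rfl p.measurableSet_paramBall volume_paramBall_ne_top

lemma anchorJac_nonneg (v : EuclideanSpace ℝ (Fin m)) : 0 ≤ anchorJac e f lam g u v := by
  have := p.lam_pos
  have := one_le_graphJac (f := f) v
  unfold anchorJac anchorDensity; positivity

lemma integral_energyMeasure {d : EuclideanSpace ℝ (Fin (m + 1)) → ℝ} {c : ℝ}
    (hd : IntegrableOn d (Ω ∩ ball (graphMap e f v₀) r₀)) (h0 : ∀ x ∈ Ω, 0 ≤ d x) (hc : 0 ≤ c)
    {φ : ℝ → ℝ} (hφ : Continuous φ) :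
    ∫ s, φ s ∂(energyMeasure e f Ω v₀ r₀ lam g u d c) =
      (∫ x in Ω ∩ ball (graphMap e f v₀) r₀, φ ‖x - graphMap e f v₀‖ * d x)
        + c * ∫ v in paramBall e f v₀ r₀, φ (paramDist e f v₀ v) * anchorJac e f lam g u v := by
  have h0' : 0 ≤ᵐ[volume.restrict (Ω ∩ ball (graphMap e f v₀) r₀)] d := by
    filter_upwards [ae_restrict_mem p.measurableSet_bulk] with x hx using h0 x hx.1
  have h1' : 0 ≤ᵐ[volume.restrict (paramBall e f v₀ r₀)] fun v => c * anchorJac e f lam g u v :=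
    Filter.Eventually.of_forall fun v => mul_nonneg hc (p.anchorJac_nonneg v)
  rw [energyMeasure, integral_radialMeasure_add hd h0' measurable_dist_graphMap p.dist_mem
    (p.integrable_anchorJac.const_mul c) h1' p.measurable_paramDist p.paramDist_mem hφ,
    ← integral_const_mul]
  congr 2 with v
  ring

/-- The first variation inequality for the radial distributions of the two energies. -/
theorem firstVariationIneq (hm : 2 ≤ m) (hw : IsWeight r₀ a b w) :
    FirstVariationIneq (m + 1) (3 * M + 1) (dataConst r₀ Λ M C * (2 * sphereConst (m + 1))) r₀
      (energyMeasure e f Ω v₀ r₀ lam g u (modifiedDensity ε u)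
        ((((m + 1 : ℕ) : ℝ) - 1) / (((m + 1 : ℕ) : ℝ) - 2)))
      (energyMeasure e f Ω v₀ r₀ lam g u (radialDensity ε u (graphMap e f v₀))
        (1 / (((m + 1 : ℕ) : ℝ) - 2))) w := by
  obtain ⟨-, hM, -⟩ := p.bounds_nonneg
  have hm' : (2 : ℝ) ≤ m := by exact_mod_cast hm
  set k : ℝ := ((m + 1 : ℕ) : ℝ) - 2 with hk
  have hmk : (m : ℝ) = k + 1 := by rw [hk]; push_cast; ring
  have hk1 : 1 ≤ k := by linarith
  have hc : (((m + 1 : ℕ) : ℝ) - 1) / k = 1 + 1 / k := by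
    rw [show ((m + 1 : ℕ) : ℝ) - 1 = k + 1 by rw [hk]; ring]; field_simp
  have hk0 : 0 ≤ 1 / k := by positivity
  have iD := p.integrable_modifiedDensity
  have iN := p.integrable_radialDensity
  have iH := p.integrable_anchorJac
  have D0 : ∀ x ∈ Ω, 0 ≤ modifiedDensity ε u x := fun x hx => (p.densities_nonneg hm hx).1
  have N0 : ∀ x ∈ Ω, 0 ≤ radialDensity ε u (graphMap e f v₀) x := fun x hx =>
    (p.densities_nonneg hm hx).2.1
  have cη := hw.continuous_tail
  have cβ := hw.continuous
  have c1 : Continuous fun s => s * w s := by fun_prop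
  have c2 : Continuous fun s => s * tail r₀ w s := by fun_prop
  have c3 : Continuous fun s => s ^ 2 * w s := by fun_prop
  obtain ⟨iF, hF⟩ := p.first_variation hw
  have iB := (hw.integrableOn_ball (by omega : 1 ≤ m) (graphMap e f v₀)).mono_set
    (inter_subset_right (s := Ω))
  unfold FirstVariationIneq
  change |k * (∫ s, tail r₀ w s ∂_) - _ + _| ≤ _ * ((∫ s, s * tail r₀ w s ∂_) + _) + _
  rw [hc, p.integral_energyMeasure iD D0 (by linarith) cη,
    p.integral_energyMeasure iD D0 (by linarith) c1, p.integral_energyMeasure iN N0 hk0 c1,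
    p.integral_energyMeasure iD D0 (by linarith) c2, p.integral_energyMeasure iD D0 (by linarith) c3]
  have j1 := integrable_comp_mul iD measurable_dist_graphMap p.dist_mem cη
  have j2 := integrable_comp_mul iD measurable_dist_graphMap p.dist_mem c1
  have j3 := integrable_comp_mul iN measurable_dist_graphMap p.dist_mem c1
  have j4 := integrable_comp_mul iD measurable_dist_graphMap p.dist_mem c2
  have j5 := integrable_comp_mul iD measurable_dist_graphMap p.dist_mem c3
  have q2 := integrable_comp_mul iH p.measurable_paramDist p.paramDist_mem c1
  have q4 := integrable_comp_mul iH p.measurable_paramDist p.paramDist_mem c2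
  have q5 := integrable_comp_mul iH p.measurable_paramDist p.paramDist_mem c3
  have iE := (p.integrable_anchorError hw).integrableOn (s := paramBall e f v₀ r₀)
  have b1 := norm_integral_le_of_norm_le
    (((j4.add j5).const_mul (3 * M + 1)).add (iB.const_mul (dataConst r₀ Λ M C)))
    (f := fun x => k * (tail r₀ w ‖x - graphMap e f v₀‖ * modifiedDensity ε u x)
      - ‖x - graphMap e f v₀‖ * w ‖x - graphMap e f v₀‖ * modifiedDensity ε u x
      + ‖x - graphMap e f v₀‖ * w ‖x - graphMap e f v₀‖ * radialDensity ε u (graphMap e f v₀) x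
      - fieldDivergence e f Ω v₀ r₀ ε g u w x) (by
      filter_upwards [ae_restrict_mem p.measurableSet_bulk] with x hx
      refine le_of_eq_of_le (congrArg abs ?_) ((p.abs_bulk_sub_le hm hw hx.1 hx.2).trans
        (le_of_eq ?_))
      · rw [← hk]; ring
      · simp only [Pi.add_apply]; ring)
  have b2 := norm_integral_le_of_norm_le ((q4.add q5).const_mul M)
    (f := fun v => anchorError e f v₀ r₀ lam g u w v
      - paramDist e f v₀ v * w (paramDist e f v₀ v) * anchorJac e f lam g u v) (by
      filter_upwards [ae_restrict_mem p.measurableSet_paramBall] with v hv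
      refine (p.abs_anchorError_sub_le hw hv).trans (le_of_eq ?_)
      simp only [Pi.add_apply, anchorJac, paramDist]; ring)
  have e1 := integral_sub (((j1.const_mul k).sub j2).add j3) iF
  have e2 := integral_add ((j1.const_mul k).sub j2) j3
  have e3 := integral_sub (j1.const_mul k) j2
  have e4 := integral_sub iE q2
  have e5 := integral_add ((j4.add j5).const_mul (3 * M + 1)) (iB.const_mul (dataConst r₀ Λ M C))
  have e6 := integral_add j4 j5
  have e7 := integral_add q4 q5
  simp only [Pi.add_apply, Pi.sub_apply, integral_const_mul] at b1 b2 e1 e2 e3 e4 e5 e6 e7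
  rw [e1, e2, e3, e5, e6, Real.norm_eq_abs] at b1
  rw [e4, e7, Real.norm_eq_abs] at b2
  have hball : ∫ x in Ω ∩ ball (graphMap e f v₀) r₀, (w ‖x - graphMap e f v₀‖
      + tail r₀ w ‖x - graphMap e f v₀‖ / ‖x - graphMap e f v₀‖) ≤
      2 * sphereConst (m + 1) * ∫ s in (0 : ℝ)..r₀, s ^ m * w s := by
    refine le_trans (setIntegral_mono_set (hw.integrableOn_ball (by omega : 1 ≤ m) _)
      (Filter.Eventually.of_forall fun x => ?_) inter_subset_right.eventuallyLE)
      (hw.integral_ball (by omega) _)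
    exact add_nonneg (hw.nonneg _) (div_nonneg (hw.tail_nonneg _) (norm_nonneg _))
  have hK := mul_le_mul_of_nonneg_left hball (dataConst_nonneg (r₀ := r₀) (Λ := Λ) (M := M) (C := C))
  have z3 : 0 ≤ ∫ v in paramBall e f v₀ r₀, paramDist e f v₀ v * tail r₀ w (paramDist e f v₀ v)
      * anchorJac e f lam g u v := integral_nonneg fun v =>
    mul_nonneg (mul_nonneg (norm_nonneg _) (hw.tail_nonneg _)) (p.anchorJac_nonneg v)
  have z5 : 0 ≤ ∫ v in paramBall e f v₀ r₀, paramDist e f v₀ v ^ 2 * w (paramDist e f v₀ v)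
      * anchorJac e f lam g u v := integral_nonneg fun v =>
    mul_nonneg (mul_nonneg (sq_nonneg _) (hw.nonneg _)) (p.anchorJac_nonneg v)
  have hAW : ∫ v in paramBall e f v₀ r₀, anchorWeight e f v₀ r₀ lam g u w v =
    ∫ v in paramBall e f v₀ r₀, tail r₀ w (paramDist e f v₀ v) * anchorJac e f lam g u v := rfl
  rw [hF, hAW] at b1
  generalize (∫ x in Ω ∩ ball (graphMap e f v₀) r₀, tail r₀ w ‖x - graphMap e f v₀‖
    * modifiedDensity ε u x) = X1 at *
  generalize (∫ x in Ω ∩ ball (graphMap e f v₀) r₀, ‖x - graphMap e f v₀‖ * w ‖x - graphMap e f v₀‖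
    * modifiedDensity ε u x) = X2 at *
  generalize (∫ x in Ω ∩ ball (graphMap e f v₀) r₀, ‖x - graphMap e f v₀‖ * w ‖x - graphMap e f v₀‖
    * radialDensity ε u (graphMap e f v₀) x) = X3 at *
  generalize (∫ x in Ω ∩ ball (graphMap e f v₀) r₀, ‖x - graphMap e f v₀‖
    * tail r₀ w ‖x - graphMap e f v₀‖ * modifiedDensity ε u x) = X4 at *
  generalize (∫ x in Ω ∩ ball (graphMap e f v₀) r₀, ‖x - graphMap e f v₀‖ ^ 2
    * w ‖x - graphMap e f v₀‖ * modifiedDensity ε u x) = X5 at *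
  generalize (∫ v in paramBall e f v₀ r₀, tail r₀ w (paramDist e f v₀ v)
    * anchorJac e f lam g u v) = Y1 at *
  generalize (∫ v in paramBall e f v₀ r₀, paramDist e f v₀ v * w (paramDist e f v₀ v)
    * anchorJac e f lam g u v) = Y2 at *
  generalize (∫ v in paramBall e f v₀ r₀, paramDist e f v₀ v * tail r₀ w (paramDist e f v₀ v)
    * anchorJac e f lam g u v) = Y4 at *
  generalize (∫ v in paramBall e f v₀ r₀, paramDist e f v₀ v ^ 2 * w (paramDist e f v₀ v)
    * anchorJac e f lam g u v) = Y5 at *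
  generalize (∫ v in paramBall e f v₀ r₀, anchorError e f v₀ r₀ lam g u w v) = E at *
  generalize (∫ x in Ω ∩ ball (graphMap e f v₀) r₀, (w ‖x - graphMap e f v₀‖
      + tail r₀ w ‖x - graphMap e f v₀‖ / ‖x - graphMap e f v₀‖)) = I at *
  -- With `k = n - 2` the weights `1 + 1 / k` and `1 / k` are exactly those for which `k (1 + 1 / k)
  -- = m` matches the Euler divergence and the terms with `Y2` combine to `-Y2`. The bulk and
  -- boundary defects then appear separately.
  have hsum : k * (X1 + (1 + 1 / k) * Y1) - (X2 + (1 + 1 / k) * Y2) + (X3 + 1 / k * Y2) =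
      (k * X1 - X2 + X3 - (-(m * Y1) + E)) + (E - Y2) := by
    rw [hmk]; field_simp; ring
  rw [hsum]
  refine (abs_add_le _ _).trans ((add_le_add b1 b2).trans ?_)
  have y1 : 0 ≤ 1 / k * (Y4 + Y5) := by positivity
  have y2 : 0 ≤ (3 * M + 1) * (1 / k * (Y4 + Y5)) := by positivity
  have y3 : 0 ≤ M * (Y4 + Y5) := by positivity
  rw [Nat.add_sub_cancel]
  nlinarith [hK, y2, y3, z3, z5]

end Patch

end Patch


/-! ### Translation into integrals over the domain and its boundary, and the monotonicity formulas.
-/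

section Sets

variable {n : ℕ} (Ω : Set (EuclideanSpace ℝ (Fin n))) (x₀ : EuclideanSpace ℝ (Fin n)) (r R : ℝ)

lemma ballPlus_eq : ballPlus Ω x₀ R = {x | x ∈ Ω ∧ ‖x - x₀‖ ∈ Iio R} := by
  ext x; simp [ballPlus, dist_eq_norm, and_comm]

lemma bdryPart_eq : bdryPart Ω x₀ R = {x | x ∈ frontier Ω ∧ ‖x - x₀‖ ∈ Iio R} := by
  ext x; simp [bdryPart, dist_eq_norm]

lemma ballPlus_diff :
    ballPlus Ω x₀ R \ ballPlus Ω x₀ r = {x | x ∈ Ω ∧ ‖x - x₀‖ ∈ Ico r R} := by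
  ext x
  simp only [ballPlus_eq, Set.mem_sdiff, mem_ofPred_eq, mem_Ico, mem_Iio]
  grind

lemma bdryPart_diff :
    bdryPart Ω x₀ R \ bdryPart Ω x₀ r = {x | x ∈ frontier Ω ∧ ‖x - x₀‖ ∈ Ico r R} := by
  ext x
  simp only [bdryPart_eq, Set.mem_sdiff, mem_ofPred_eq, mem_Ico, mem_Iio]
  grind

end Sets

section Patch

variable {m : ℕ} {e : Splitting m} {f : EuclideanSpace ℝ (Fin m) → ℝ}
  {Ω U : Set (EuclideanSpace ℝ (Fin (m + 1)))} {v₀ : EuclideanSpace ℝ (Fin m)}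
  {r₀ Λ M ε lam C : ℝ}
  {g u : EuclideanSpace ℝ (Fin (m + 1)) → EuclideanSpace ℝ (Fin 2)}

lemma isFiniteMeasure_energyMeasure {d : EuclideanSpace ℝ (Fin (m + 1)) → ℝ} {c : ℝ}
    (hd : IntegrableOn d (Ω ∩ ball (graphMap e f v₀) r₀))
    (hJ : IntegrableOn (anchorJac e f lam g u) (paramBall e f v₀ r₀)) :
    IsFiniteMeasure (energyMeasure e f Ω v₀ r₀ lam g u d c) := by
  have h1 := isFiniteMeasure_radialMeasure (ρ := fun x => ‖x - graphMap e f v₀‖) hd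
  have h2 := isFiniteMeasure_radialMeasure (ρ := paramDist e f v₀) (hJ.const_mul c)
  unfold energyMeasure
  infer_instance

lemma norm_sub_le_paramDist (v : EuclideanSpace ℝ (Fin m)) : ‖v - v₀‖ ≤ paramDist e f v₀ v := by
  have := norm_hor_le e (graphMap e f v - graphMap e f v₀)
  simpa [paramDist] using this

lemma integrableOn_zpow_dist (x₀ : EuclideanSpace ℝ (Fin (m + 1))) :
    IntegrableOn (fun x => ‖x - x₀‖ ^ (2 - ((m + 1 : ℕ) : ℤ))) (ball x₀ r₀) := by
  refine integrableOn_ball_radial (by omega) (φ := fun s => s ^ (2 - ((m + 1 : ℕ) : ℤ))) x₀ ?_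
  refine ((continuous_id.integrableOn_Icc (a := 0) (b := r₀)).mono_set Ioo_subset_Icc_self).congr_fun
    (fun s hs => ?_) measurableSet_Ioo
  simp only [id, Nat.add_sub_cancel]
  rw [← zpow_natCast, ← zpow_add₀ hs.1.ne', show (m : ℤ) + (2 - ((m + 1 : ℕ) : ℤ)) = 1 by
    push_cast; ring, zpow_one]

/-- Projecting the graph to the horizontal plane does not increase distances, so the weight is
dominated by `|v - v₀| ^ (2 - n)`. In dimension `n - 1` the polar Jacobian cancels this power. -/
lemma integrableOn_zpow_paramDist (hm : 2 ≤ m) (hf : ContDiff ℝ ∞ f) :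
    IntegrableOn (fun v => paramDist e f v₀ v ^ (2 - ((m + 1 : ℕ) : ℤ))) (ball v₀ r₀) := by
  have h1 : IntegrableOn (fun v => ‖v - v₀‖ ^ (2 - ((m + 1 : ℕ) : ℤ))) (ball v₀ r₀) := by
    refine integrableOn_ball_radial (by omega) (φ := fun s => s ^ (2 - ((m + 1 : ℕ) : ℤ))) v₀ ?_
    refine ((continuous_const.integrableOn_Icc (a := 0) (b := r₀) (f := fun _ => (1 : ℝ))).mono_set
      Ioo_subset_Icc_self).congr_fun (fun s hs => ?_) measurableSet_Ioo
    obtain ⟨k, rfl⟩ : ∃ k, m = k + 1 := ⟨m - 1, by omega⟩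
    simp only [Nat.add_sub_cancel]
    rw [← zpow_natCast, ← zpow_add₀ hs.1.ne', show (k : ℤ) + (2 - ((k + 1 + 1 : ℕ) : ℤ)) = 0 by
      push_cast; ring, zpow_zero]
  have hc : Continuous (paramDist e f v₀) := by
    have := (contDiff_graphMap e hf).continuous
    unfold paramDist; fun_prop
  refine Integrable.mono' h1 (hc.measurable.pow_const _).aestronglyMeasurable
    (Filter.Eventually.of_forall fun v => ?_)
  have h2 := norm_sub_le_paramDist (e := e) (f := f) (v₀ := v₀) v
  have h3 : 0 ≤ paramDist e f v₀ v := norm_nonneg _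
  rw [Real.norm_of_nonneg (zpow_nonneg h3 _)]
  rcases eq_or_ne v v₀ with rfl | hne
  · simp [paramDist]
  · obtain ⟨k, rfl⟩ : ∃ k, m = k + 1 := ⟨m - 1, by omega⟩
    rw [show 2 - ((k + 1 + 1 : ℕ) : ℤ) = -(k : ℤ) by push_cast; ring, zpow_neg, zpow_neg,
      zpow_natCast, zpow_natCast]
    have : 0 < ‖v - v₀‖ := norm_pos_iff.2 (sub_ne_zero.2 hne)
    gcongr

namespace Patch

variable (p : Patch e f Ω U v₀ r₀ Λ M ε lam C g u)
include p

lemma ae_energyMeasure (d : EuclideanSpace ℝ (Fin (m + 1)) → ℝ) (c : ℝ) :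
    ∀ᵐ s ∂(energyMeasure e f Ω v₀ r₀ lam g u d c), s ∈ Ico 0 r₀ := by
  rw [energyMeasure, ae_add_measure_iff]
  exact ⟨ae_radialMeasure measurable_dist_graphMap measurableSet_Ico p.dist_mem,
    ae_radialMeasure p.measurable_paramDist measurableSet_Ico p.paramDist_mem⟩

/-- Supplies `ν ≤ 2 μ`, the input of `exp_mul_energy_mono` for radii that are not small. -/
lemma energyMeasure_le {d d' : EuclideanSpace ℝ (Fin (m + 1)) → ℝ} {c c' : ℝ}
    (hd : ∀ x ∈ Ω, d x ≤ 2 * d' x) (hc : c ≤ 2 * c') (s : Set ℝ) :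
    energyMeasure e f Ω v₀ r₀ lam g u d c s ≤ 2 * energyMeasure e f Ω v₀ r₀ lam g u d' c' s := by
  have h1 : d ≤ᵐ[volume.restrict (Ω ∩ ball (graphMap e f v₀) r₀)] fun x => 2 * d' x := by
    filter_upwards [ae_restrict_mem p.measurableSet_bulk] with x hx using hd x hx.1
  have h2 : (fun v => c * anchorJac e f lam g u v) ≤ᵐ[volume.restrict (paramBall e f v₀ r₀)]
      fun v => 2 * (c' * anchorJac e f lam g u v) := Filter.Eventually.of_forall fun v => by
    have := mul_le_mul_of_nonneg_right hc (p.anchorJac_nonneg v)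
    simp only; linarith
  have h3 := radialMeasure_le (measurable_dist_graphMap (e := e) (f := f) (v₀ := v₀)) h1 s
  have h4 := radialMeasure_le p.measurable_paramDist h2 s
  simp only [energyMeasure, Measure.add_apply, mul_add]
  refine (add_le_add h3 h4).trans (le_of_eq ?_)
  simp [two_mul, two_smul]

/-- Inside the ball the whole frontier is the graph over `paramBall`, so the parametrized anchoring
term becomes a surface integral by `setIntegral_graph`. Integrability is required because the
integral is split over a sum of two measures. -/
lemma setIntegral_energyMeasure {d : EuclideanSpace ℝ (Fin (m + 1)) → ℝ} {c : ℝ}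
    (hd : IntegrableOn d (Ω ∩ ball (graphMap e f v₀) r₀)) (h0 : ∀ x ∈ Ω, 0 ≤ d x) (hc : 0 ≤ c)
    {φ : ℝ → ℝ} (hφ : Measurable φ) {T : Set ℝ} (hT : MeasurableSet T) (hTr : T ⊆ Iio r₀)
    (hφT : IntegrableOn φ T (energyMeasure e f Ω v₀ r₀ lam g u d c)) :
    ∫ s in T, φ s ∂(energyMeasure e f Ω v₀ r₀ lam g u d c) =
      (∫ x in {x | x ∈ Ω ∧ ‖x - graphMap e f v₀‖ ∈ T}, φ ‖x - graphMap e f v₀‖ * d x)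
        + ∫ x in {x | x ∈ frontier Ω ∧ ‖x - graphMap e f v₀‖ ∈ T},
          φ ‖x - graphMap e f v₀‖ * (c * (lam / 2 * ‖u x - g x‖ ^ 2)) ∂μHE[m] := by
  have h0' : 0 ≤ᵐ[volume.restrict (Ω ∩ ball (graphMap e f v₀) r₀)] d := by
    filter_upwards [ae_restrict_mem p.measurableSet_bulk] with x hx using h0 x hx.1
  have h1' : 0 ≤ᵐ[volume.restrict (paramBall e f v₀ r₀)] fun v => c * anchorJac e f lam g u v :=
    Filter.Eventually.of_forall fun v => mul_nonneg hc (p.anchorJac_nonneg v)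
  have hS : {x | x ∈ Ω ∧ ‖x - graphMap e f v₀‖ ∈ T} =
      (fun x => ‖x - graphMap e f v₀‖) ⁻¹' T ∩ (Ω ∩ ball (graphMap e f v₀) r₀) := by
    ext x
    simp only [mem_ofPred_eq, mem_inter_iff, mem_preimage, mem_ball, dist_eq_norm]
    exact ⟨fun h => ⟨h.2, h.1, hTr h.2⟩, fun h => ⟨h.2.1, h.1⟩⟩
  have hB : {x | x ∈ frontier Ω ∧ ‖x - graphMap e f v₀‖ ∈ T} =
      graphMap e f '' (paramDist e f v₀ ⁻¹' T ∩ paramBall e f v₀ r₀) := by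
    ext x
    simp only [mem_ofPred_eq, mem_image, mem_inter_iff, mem_preimage]
    constructor
    · rintro ⟨hx, hxT⟩
      have hb : x ∈ ball (graphMap e f v₀) r₀ := by
        rw [mem_ball, dist_eq_norm]; exact hTr hxT
      have hg := graphMap_hor ((p.ballGraph.frontier_iff hb).1 hx)
      refine ⟨hor e x, ⟨?_, ?_⟩, hg⟩
      · rwa [paramDist, hg]
      · rwa [paramBall, mem_preimage, hg]
    · rintro ⟨v, ⟨h1, h2⟩, rfl⟩
      exact ⟨p.mem_frontier (paramBall_subset h2), h1⟩
  rw [energyMeasure] at hφT ⊢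
  rw [Measure.restrict_add, integral_add_measure (hφT.mono_measure (Measure.le_add_right le_rfl))
    (hφT.mono_measure (Measure.le_add_left le_rfl)),
    setIntegral_radialMeasure hd h0' measurable_dist_graphMap hφ hT,
    setIntegral_radialMeasure (p.integrable_anchorJac.const_mul c) h1' p.measurable_paramDist hφ hT,
    Measure.restrict_restrict (measurable_dist_graphMap hT),
    Measure.restrict_restrict (p.measurable_paramDist hT), hS, hB,
    setIntegral_graph e p.graph.smooth ((p.measurable_paramDist hT).inter p.measurableSet_paramBall)]
  congr 2 with v
  simp only [paramDist, anchorJac, anchorDensity]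
  ring

/-- For a fixed solution the densities are bounded, and the singular weight is integrable both on a
ball in dimension `n` and on the `(n - 1)`-dimensional graph. Only finiteness matters here, so the
bounds may depend on the solution. -/
lemma integrableOn_zpow_energyMeasure (hm : 2 ≤ m) {c : ℝ} (hc : 0 ≤ c) :
    IntegrableOn (fun s : ℝ => s ^ (2 - ((m + 1 : ℕ) : ℤ))) (Iio r₀)
      (energyMeasure e f Ω v₀ r₀ lam g u (radialDensity ε u (graphMap e f v₀)) c) := by
  have h0' : 0 ≤ᵐ[volume.restrict (Ω ∩ ball (graphMap e f v₀) r₀)]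
      radialDensity ε u (graphMap e f v₀) := by
    filter_upwards [ae_restrict_mem p.measurableSet_bulk] with x hx
      using (p.densities_nonneg hm hx.1).2.1
  have h1' : 0 ≤ᵐ[volume.restrict (paramBall e f v₀ r₀)] fun v => c * anchorJac e f lam g u v :=
    Filter.Eventually.of_forall fun v => mul_nonneg hc (p.anchorJac_nonneg v)
  have hφ : Measurable fun s : ℝ => s ^ (2 - ((m + 1 : ℕ) : ℤ)) := measurable_id.pow_const _
  have hJ := p.integrable_anchorJac.const_mul c
  rw [energyMeasure, integrableOn_add_measure,
    integrableOn_radialMeasure p.integrable_radialDensity h0' measurable_dist_graphMap hφ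
      measurableSet_Iio,
    integrableOn_radialMeasure hJ h1' p.measurable_paramDist hφ measurableSet_Iio]
  constructor
  · obtain ⟨M₁, hM₁⟩ := p.tame_hsNormSq.exists_bound
    obtain ⟨M₂, hM₂⟩ := p.tame_potential.exists_bound
    have hk : 0 ≤ 2 / (((m + 1 : ℕ) : ℝ) - 2) := by
      have : (2 : ℝ) ≤ m := by exact_mod_cast hm
      exact div_nonneg zero_le_two (by push_cast; linarith)
    refine Integrable.integrableOn ?_
    refine Integrable.mul_bdd (c := M₁ + 2 / (((m + 1 : ℕ) : ℝ) - 2) * M₂)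
      ((integrableOn_zpow_dist _).mono_set inter_subset_right)
      p.integrable_radialDensity.aestronglyMeasurable ?_
    filter_upwards [ae_restrict_mem p.measurableSet_bulk] with x hx
    rw [Real.norm_of_nonneg (p.densities_nonneg hm hx.1).2.1, p.radialDensity_eq]
    have h1 := (le_abs_self _).trans (hM₁ x hx).1
    have h2 := (le_abs_self _).trans (hM₂ x hx).1
    exact add_le_add ((p.radialDeriv_le hx.1).trans h1) (mul_le_mul_of_nonneg_left h2 hk)
  · obtain ⟨M₁, hM₁⟩ := p.tame_anchorJac.exists_bound
    refine Integrable.integrableOn ?_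
    refine Integrable.mul_bdd (c := c * M₁)
      ((integrableOn_zpow_paramDist hm p.graph.smooth).mono_set paramBall_subset)
      hJ.aestronglyMeasurable ?_
    filter_upwards [ae_restrict_mem p.measurableSet_paramBall] with v hv
    rw [norm_mul, Real.norm_of_nonneg hc]
    exact mul_le_mul_of_nonneg_left (hM₁ v hv).1 hc

lemma modifiedPhi_eq (hm : 2 ≤ m) {R : ℝ} (hR : R ≤ r₀) :
    modifiedPhi Ω ε lam g u (graphMap e f v₀) R = R ^ (2 - ((m + 1 : ℕ) : ℤ)) *
      (energyMeasure e f Ω v₀ r₀ lam g u (modifiedDensity ε u)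
        ((((m + 1 : ℕ) : ℝ) - 1) / (((m + 1 : ℕ) : ℝ) - 2))).real (Iio R) := by
  have hm' : (2 : ℝ) ≤ m := by exact_mod_cast hm
  have hc : 0 ≤ (((m + 1 : ℕ) : ℝ) - 1) / (((m + 1 : ℕ) : ℝ) - 2) :=
    div_nonneg (by push_cast; linarith) (by push_cast; linarith)
  have := isFiniteMeasure_energyMeasure (c := (((m + 1 : ℕ) : ℝ) - 1) / (((m + 1 : ℕ) : ℝ) - 2))
    p.integrable_modifiedDensity p.integrable_anchorJac
  have h1 := p.setIntegral_energyMeasure p.integrable_modifiedDensity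
    (fun x hx => (p.densities_nonneg hm hx).1) hc (φ := fun _ => 1) measurable_const
    (measurableSet_Iio (a := R)) (Iio_subset_Iio hR) (integrable_const 1).integrableOn
  simp only [one_mul, setIntegral_const, smul_eq_mul, mul_one] at h1
  rw [modifiedPhi, modifiedEnergy, h1]
  rw [ballPlus_eq, bdryPart_eq]
  rfl

lemma weighted_eq (hm : 2 ≤ m) {T : Set ℝ} (hT : MeasurableSet T) (hTr : T ⊆ Iio r₀) :
    weightedBulk ε u (graphMap e f v₀) {x | x ∈ Ω ∧ ‖x - graphMap e f v₀‖ ∈ T} +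
        weightedBdry lam g u (graphMap e f v₀)
          {x | x ∈ frontier Ω ∧ ‖x - graphMap e f v₀‖ ∈ T} =
      ∫ s in T, s ^ (2 - ((m + 1 : ℕ) : ℤ)) ∂(energyMeasure e f Ω v₀ r₀ lam g u
        (radialDensity ε u (graphMap e f v₀)) (1 / (((m + 1 : ℕ) : ℝ) - 2))) := by
  have hm' : (2 : ℝ) ≤ m := by exact_mod_cast hm
  have hc : 0 ≤ 1 / (((m + 1 : ℕ) : ℝ) - 2) := div_nonneg zero_le_one (by push_cast; linarith)
  rw [p.setIntegral_energyMeasure p.integrable_radialDensity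
    (fun x hx => (p.densities_nonneg hm hx).2.1) hc (φ := fun s => s ^ (2 - ((m + 1 : ℕ) : ℤ)))
    (measurable_id.pow_const _) hT hTr
    ((p.integrableOn_zpow_energyMeasure hm hc).mono_set hTr)]
  congr 1
  refine integral_congr_ae (Filter.Eventually.of_forall fun x => ?_)
  beta_reduce
  rw [div_mul_eq_mul_div, one_mul, div_mul_eq_mul_div, div_div]

lemma testsAgainst (hm : 2 ≤ m) :
    TestsAgainst (m + 1) (3 * M + 1) (dataConst r₀ Λ M C * (2 * sphereConst (m + 1))) r₀
      (energyMeasure e f Ω v₀ r₀ lam g u (modifiedDensity ε u)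
        ((((m + 1 : ℕ) : ℝ) - 1) / (((m + 1 : ℕ) : ℝ) - 2)))
      (energyMeasure e f Ω v₀ r₀ lam g u (radialDensity ε u (graphMap e f v₀))
        (1 / (((m + 1 : ℕ) : ℝ) - 2))) := fun _ _ _ hw h0 ha hab hb hz =>
  p.firstVariationIneq hm ⟨hw, h0, ha, hab, hb, hz⟩

/-- The monotonicity formulas at a boundary point that lies in the chart. -/
theorem monotonicity (hm : 2 ≤ m) (hr₀ : r₀ ≤ 1) (hM : (3 * M + 1) * r₀ ≤ 1 / 4) {C₃ : ℝ}
    (h1 : 2 * ((m + 1) * (3 * M + 1)) ≤ C₃)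
    (h2 : 2 * (dataConst r₀ Λ M C * (2 * sphereConst (m + 1))
      * Real.exp ((m + 1) * (3 * M + 1))) ≤ C₃) :
    (∀ r R : ℝ, 0 < r → r ≤ R → R ≤ r₀ →
      Real.exp (-C₃ * R) * modifiedPhi Ω ε lam g u (graphMap e f v₀) R
          - Real.exp (-C₃ * r) * modifiedPhi Ω ε lam g u (graphMap e f v₀) r
        ≤ 2 * (weightedBulk ε u (graphMap e f v₀)
            (ballPlus Ω (graphMap e f v₀) R \ ballPlus Ω (graphMap e f v₀) r)
          + weightedBdry lam g u (graphMap e f v₀)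
            (bdryPart Ω (graphMap e f v₀) R \ bdryPart Ω (graphMap e f v₀) r)) + C₃ * (R - r) ∧
      1 / 2 * (weightedBulk ε u (graphMap e f v₀)
            (ballPlus Ω (graphMap e f v₀) R \ ballPlus Ω (graphMap e f v₀) r)
          + weightedBdry lam g u (graphMap e f v₀)
            (bdryPart Ω (graphMap e f v₀) R \ bdryPart Ω (graphMap e f v₀) r))
        ≤ Real.exp (C₃ * R) * modifiedPhi Ω ε lam g u (graphMap e f v₀) R
          - Real.exp (C₃ * r) * modifiedPhi Ω ε lam g u (graphMap e f v₀) r + C₃ * (R - r)) ∧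
    ∀ R : ℝ, 0 < R → R ≤ r₀ →
      weightedBulk ε u (graphMap e f v₀) (ballPlus Ω (graphMap e f v₀) R)
          + weightedBdry lam g u (graphMap e f v₀) (bdryPart Ω (graphMap e f v₀) R)
        ≤ Real.exp (C₃ * R) * modifiedPhi Ω ε lam g u (graphMap e f v₀) R + C₃ * R := by
  obtain ⟨-, hM0, -⟩ := p.bounds_nonneg
  have hm' : (2 : ℝ) ≤ m := by exact_mod_cast hm
  have hT := p.testsAgainst hm
  set k : ℝ := ((m + 1 : ℕ) : ℝ) - 2 with hk
  have hk1 : 1 ≤ k := by rw [hk]; push_cast; linarith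
  have hk0 : 0 ≤ 1 / k := by positivity
  have hkc : 1 / k ≤ 2 * ((((m + 1 : ℕ) : ℝ) - 1) / k) := by
    rw [← mul_div_assoc]
    gcongr
    push_cast; linarith
  have fμ := isFiniteMeasure_energyMeasure (c := (((m + 1 : ℕ) : ℝ) - 1) / k)
    p.integrable_modifiedDensity p.integrable_anchorJac
  have fν := isFiniteMeasure_energyMeasure (c := 1 / k)
    p.integrable_radialDensity p.integrable_anchorJac
  have aμ := p.ae_energyMeasure (modifiedDensity ε u) ((((m + 1 : ℕ) : ℝ) - 1) / k)
  have aν := p.ae_energyMeasure (radialDensity ε u (graphMap e f v₀)) (1 / k)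
  have hle := p.energyMeasure_le (fun x hx => (p.densities_nonneg hm hx).2.2) hkc
  have hΦ : ∀ R, R ≤ r₀ → _ := fun R hR => p.modifiedPhi_eq hm (R := R) hR
  have hI : ∀ T, MeasurableSet T → T ⊆ Iio r₀ → _ := fun T h h' => p.weighted_eq hm (T := T) h h'
  rw [← hk] at hΦ hI
  set A := 3 * M + 1 with hA
  set B := dataConst r₀ Λ M C * (2 * sphereConst (m + 1)) with hB
  have hA0 : 0 ≤ A := by positivity
  have hB0 : 0 ≤ B := mul_nonneg dataConst_nonneg (mul_nonneg zero_le_two (sphereConst_nonneg _))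
  have hA1 : 1 ≤ A := by linarith
  have hC0 : 0 < C₃ := lt_of_lt_of_le (by positivity) h1
  have hexp1 : 1 ≤ Real.exp ((m + 1) * A) := Real.one_le_exp (by positivity)
  -- As `A ≥ 1`, a single exponential serves both `TestsAgainst.lower_exp`, which asks for `exp(n -
  -- 2)`, and `TestsAgainst.lower_zero`, which asks for `exp(n A)`.
  have hexp2 : Real.exp (((m + 1 : ℕ) : ℝ) - 2) ≤ Real.exp ((m + 1) * A) :=
    Real.exp_le_exp.2 (by push_cast; nlinarith)
  have hB1 := mul_le_mul_of_nonneg_left hexp1 hB0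
  have hB2 := mul_le_mul_of_nonneg_left hexp2 hB0
  have hB3 : 0 ≤ B * Real.exp ((m + 1) * A) := by positivity
  refine ⟨fun r R hr hrR hR => ?_, fun R hR0 hR => ?_⟩
  · rw [ballPlus_diff, bdryPart_diff, hI _ measurableSet_Ico fun s hs => hs.2.trans_le hR,
      hΦ R hR, hΦ r (hrR.trans hR)]
    refine ⟨?_, ?_⟩
    · rcases hrR.eq_or_lt with rfl | hlt
      · simp
      · refine (hT.upper (by omega) hA0 hB0 hM aμ aν (C := C₃) (by push_cast; nlinarith) hr hlt
          hR).trans ?_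
        gcongr
        linarith
    · exact hT.lower_exp (by omega) hA0 hB0 hM aμ aν hle hC0 (by push_cast; nlinarith) (by linarith)
        hr hrR hR
  · rw [ballPlus_eq, bdryPart_eq, hI _ measurableSet_Iio (Iio_subset_Iio hR), hΦ R hR]
    exact hT.lower_zero (by omega) hA0 hB0 hr₀ aμ aν (by push_cast; nlinarith)
      (by push_cast; linarith) hR0 hR

end Patch

end Patch


/-! ### Uniform charts along the boundary. -/

section Charts

variable {m : ℕ} {Ω : Set (EuclideanSpace ℝ (Fin (m + 1)))}

/-- At the points of `s` there are patches of all radii up to `δ`, with uniform bounds for the first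
two derivatives of the graphs. -/
def HasPatches (Ω s : Set (EuclideanSpace ℝ (Fin (m + 1)))) (δ Λ M : ℝ) : Prop :=
  ∀ x₀ ∈ s, ∀ r₀, 0 < r₀ → r₀ ≤ δ →
    ∃ (e : Splitting m) (f : EuclideanSpace ℝ (Fin m) → ℝ)
      (U : Set (EuclideanSpace ℝ (Fin (m + 1)))) (v₀ : EuclideanSpace ℝ (Fin m)),
      graphMap e f v₀ = x₀ ∧ ∀ (ε lam C : ℝ)
        (g u : EuclideanSpace ℝ (Fin (m + 1)) → EuclideanSpace ℝ (Fin 2)), 0 < ε → 0 < lam →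
        IsSolution Ω ε lam g u → (∀ p ∈ frontier Ω, ‖g p‖ = 1) → HasBoundaryC2Bound Ω g C →
        Patch e f Ω U v₀ r₀ Λ M ε lam C g u

lemma HasPatches.mono {s : Set (EuclideanSpace ℝ (Fin (m + 1)))} {δ δ' Λ Λ' M M' : ℝ}
    (h : HasPatches Ω s δ Λ M) (hδ : δ' ≤ δ) (hΛ : Λ ≤ Λ') (hM : M ≤ M') :
    HasPatches Ω s δ' Λ' M' := by
  intro x₀ hx₀ r₀ h0 h1
  obtain ⟨e, f, U, v₀, hv₀, hp⟩ := h x₀ hx₀ r₀ h0 (h1.trans hδ)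
  refine ⟨e, f, U, v₀, hv₀, fun ε lam C g u hε hlam hu hg hC => ?_⟩
  have p := hp ε lam C g u hε hlam hu hg hC
  exact { p with
    norm_fderiv_le := fun v hv => (p.norm_fderiv_le v hv).trans hΛ
    norm_hessian_le := fun v hv => (p.norm_hessian_le v hv).trans hM }

/-- One chart around `p` serves every boundary point near `p`, since the patch center need not be
the point where the graph is horizontal. -/
lemma IsBoundedSmoothDomain.exists_patches_near (hΩ : IsBoundedSmoothDomain Ω)
    {p : EuclideanSpace ℝ (Fin (m + 1))} (hp : p ∈ frontier Ω) :
    ∃ δ Λ M, 0 < δ ∧ 0 ≤ M ∧ HasPatches Ω (frontier Ω ∩ ball p δ) δ Λ M := by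
  obtain ⟨ν, φ, hφ⟩ := hΩ.smooth_boundary p hp
  obtain ⟨e, f, ρ, -, hρ, hl, -⟩ := hφ.exists_localGraph hΩ.isOpen
  have hc1 : Continuous (fderiv ℝ f) := hl.smooth.continuous_fderiv (by simp)
  have hc2 : Continuous (fderiv ℝ (fderiv ℝ f)) :=
    (hl.smooth.fderiv_right (m := ∞) le_rfl).continuous_fderiv (by simp)
  obtain ⟨Λ, hΛ⟩ := (isCompact_closedBall (hor e p) ρ).exists_bound_of_continuousOn
    hc1.continuousOn
  obtain ⟨M, hM⟩ := (isCompact_closedBall (hor e p) ρ).exists_bound_of_continuousOn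
    (f := fderiv ℝ (fderiv ℝ f)) hc2.continuousOn
  have h0 := mem_closedBall_self (x := hor e p) hρ.le
  have hΛ0 : 0 ≤ Λ := (norm_nonneg _).trans (hΛ _ h0)
  have hM0 : 0 ≤ M := (norm_nonneg (fderiv ℝ (fderiv ℝ f) (hor e p))).trans (hM _ h0)
  have hδρ : ρ / (2 * (1 + Λ)) ≤ ρ / 2 := by
    gcongr; linarith
  -- The graph map is `(1 + Λ)`-Lipschitz, so a parameter ball of this radius moves its image by at
  -- most `ρ / 2`; with the center within `ρ / 2` of `p` it stays in the chart.
  refine ⟨ρ / (2 * (1 + Λ)), Λ, M, by positivity, hM0, ?_⟩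
  rintro x₀ ⟨hx₀, hxp⟩ r₀ hr0 hrδ
  have hxρ : dist x₀ p < ρ / 2 := (mem_ball.1 hxp).trans_le hδρ
  have hxU : x₀ ∈ ball p ρ := mem_ball.2 (by linarith)
  have hg := graphMap_hor ((hl.frontier_iff hxU).1 hx₀)
  have hv₀ : dist (hor e x₀) (hor e p) < ρ / 2 := by
    rw [dist_eq_norm, ← map_sub]
    exact (norm_hor_le e _).trans_lt (by rwa [← dist_eq_norm])
  have hvρ : ∀ v ∈ ball (hor e x₀) r₀, v ∈ closedBall (hor e p) ρ := fun v hv => by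
    have := dist_triangle v (hor e x₀) (hor e p)
    rw [mem_ball] at hv
    rw [mem_closedBall]; linarith
  refine ⟨e, f, ball p ρ, hor e x₀, hg, fun ε lam C g u hε hlam hu hunit hC =>
    ⟨hΩ, hl, hr0, ?_, ?_, fun v hv => hΛ v (hvρ v hv), fun v hv => hM v (hvρ v hv), hε, hlam, hu,
      hunit, hC⟩⟩
  · rw [hg]
    exact ball_subset_ball' (by linarith)
  · intro v hv
    have h1 := (convex_closedBall (hor e p) ρ).norm_image_sub_le_of_norm_fderiv_le (𝕜 := ℝ)
      (f := graphMap e f) (C := 1 + Λ) (x := hor e x₀) (y := v)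
      (fun w _ => ((contDiff_graphMap e hl.smooth).differentiable (by simp)) w)
      (fun w hw => (norm_fderiv_graphMap_le hl.smooth w).trans (by linarith [hΛ w hw]))
      (mem_closedBall.2 (by linarith)) (hvρ v hv)
    rw [hg, ← dist_eq_norm, ← dist_eq_norm] at h1
    have h2 : (1 + Λ) * dist v (hor e x₀) ≤ (1 + Λ) * (ρ / (2 * (1 + Λ))) := by
      have := (mem_ball.1 hv).le
      gcongr
      linarith
    have h3 : (1 + Λ) * (ρ / (2 * (1 + Λ))) = ρ / 2 := by field_simp
    have h4 := dist_triangle (graphMap e f v) x₀ p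
    rw [mem_ball]; linarith

/-- Local bounds combine under finite unions, by the minimum of the radii and the maxima of the
derivative bounds, so compactness of the boundary makes them global. -/
lemma IsBoundedSmoothDomain.exists_patches (hΩ : IsBoundedSmoothDomain Ω) :
    ∃ δ Λ M, 0 < δ ∧ 0 ≤ M ∧ HasPatches Ω (frontier Ω) δ Λ M := by
  have hc : IsCompact (frontier Ω) := Metric.isCompact_of_isClosed_isBounded isClosed_frontier
    (hΩ.isBounded.closure.subset frontier_subset_closure)
  suffices h : ∃ δ Λ M, 0 < δ ∧ 0 ≤ M ∧ HasPatches Ω (frontier Ω ∩ frontier Ω) δ Λ M by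
    rwa [inter_self] at h
  refine hc.induction_on (p := fun s => ∃ δ Λ M, 0 < δ ∧ 0 ≤ M ∧ HasPatches Ω (frontier Ω ∩ s) δ Λ M)
    ?_ ?_ ?_ ?_
  · exact ⟨1, 0, 0, one_pos, le_rfl, fun x hx => (hx.2).elim⟩
  · rintro s t hst ⟨δ, Λ, M, h0, hM, h⟩
    exact ⟨δ, Λ, M, h0, hM, fun x hx => h x ⟨hx.1, hst hx.2⟩⟩
  · rintro s t ⟨δ, Λ, M, h0, hM, h⟩ ⟨δ', Λ', M', h0', hM', h'⟩
    refine ⟨min δ δ', max Λ Λ', max M M', lt_min h0 h0', hM.trans (le_max_left _ _), ?_⟩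
    rintro x ⟨hx, hxs | hxt⟩
    · exact h.mono (min_le_left _ _) (le_max_left _ _) (le_max_left _ _) x ⟨hx, hxs⟩
    · exact h'.mono (min_le_right _ _) (le_max_right _ _) (le_max_right _ _) x ⟨hx, hxt⟩
  · intro p hp
    obtain ⟨δ, Λ, M, h0, hM, h⟩ := hΩ.exists_patches_near hp
    exact ⟨ball p δ, mem_nhdsWithin_of_mem_nhds (ball_mem_nhds p h0), δ, Λ, M, h0, hM, h⟩

end Charts

end WeakAnchoring

/-! ### Choice of the radius and the constants. -/

theorem theorem2p4 (n : ℕ) (hn : 3 ≤ n) (Ω : Set (EuclideanSpace ℝ (Fin n)))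
    (hΩ : WeakAnchoring.IsBoundedSmoothDomain Ω) :
    ∃ r₀ : ℝ, 0 < r₀ ∧ r₀ < 1 ∧
    ∀ C₀ : ℝ, 0 < C₀ →
    ∃ C₃ C₄ : ℝ, 0 < C₃ ∧ 0 < C₄ ∧
    ∀ g : ℝ → EuclideanSpace ℝ (Fin n) → EuclideanSpace ℝ (Fin 2),
      WeakAnchoring.ConditionG Ω g C₀ →
    ∀ K α ε lam : ℝ, 0 < K → 0 ≤ α → α < 1 → 0 < ε → ε ≤ 1 → lam = K * ε ^ (-α) →
    ∀ u : EuclideanSpace ℝ (Fin n) → EuclideanSpace ℝ (Fin 2),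
      WeakAnchoring.IsSolution Ω ε lam (g ε) u →
    ∀ x₀ ∈ frontier Ω,
      (∀ r R : ℝ, 0 < r → r ≤ R → R ≤ r₀ →
        Real.exp (-C₃ * R) * WeakAnchoring.modifiedPhi Ω ε lam (g ε) u x₀ R
            - Real.exp (-C₃ * r) * WeakAnchoring.modifiedPhi Ω ε lam (g ε) u x₀ r
          ≤ 2 * (WeakAnchoring.weightedBulk ε u x₀
                  (WeakAnchoring.ballPlus Ω x₀ R \ WeakAnchoring.ballPlus Ω x₀ r)
                + WeakAnchoring.weightedBdry lam (g ε) u x₀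
                  (WeakAnchoring.bdryPart Ω x₀ R \ WeakAnchoring.bdryPart Ω x₀ r))
            + C₃ * (R - r) ∧
        1 / 2 * (WeakAnchoring.weightedBulk ε u x₀
                  (WeakAnchoring.ballPlus Ω x₀ R \ WeakAnchoring.ballPlus Ω x₀ r)
                + WeakAnchoring.weightedBdry lam (g ε) u x₀
                  (WeakAnchoring.bdryPart Ω x₀ R \ WeakAnchoring.bdryPart Ω x₀ r))
          ≤ Real.exp (C₃ * R) * WeakAnchoring.modifiedPhi Ω ε lam (g ε) u x₀ R
            - Real.exp (C₃ * r) * WeakAnchoring.modifiedPhi Ω ε lam (g ε) u x₀ r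
            + C₃ * (R - r)) ∧
      (∀ R : ℝ, 0 < R → R ≤ r₀ →
        WeakAnchoring.weightedBulk ε u x₀ (WeakAnchoring.ballPlus Ω x₀ R)
            + WeakAnchoring.weightedBdry lam (g ε) u x₀ (WeakAnchoring.bdryPart Ω x₀ R)
          ≤ Real.exp (C₄ * R) * WeakAnchoring.modifiedPhi Ω ε lam (g ε) u x₀ R + C₄ * R) := by
  obtain ⟨m, rfl⟩ : ∃ m, n = m + 1 := ⟨n - 1, by omega⟩
  obtain ⟨δ, Λ, M, hδ, hM, hP⟩ := hΩ.exists_patches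
  -- The three entries guarantee charts, a radius below `1`, and `A r₀ ≤ 1 / 4` for `A = 3 M + 1`.
  -- All of them are determined by the domain, before `C₀` is introduced.
  refine ⟨min δ (min (1 / 2) (1 / (4 * (3 * M + 1)))), lt_min hδ (lt_min one_half_pos (by positivity)),
    ((min_le_right _ _).trans (min_le_left _ _)).trans_lt one_half_lt_one, fun C₀ _ => ?_⟩
  set r₀ := min δ (min (1 / 2) (1 / (4 * (3 * M + 1)))) with hr₀
  have hr0 : 0 < r₀ := lt_min hδ (lt_min one_half_pos (by positivity))
  have hr1 : r₀ ≤ 1 / 2 := (min_le_right _ _).trans (min_le_left _ _)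
  have hrM : (3 * M + 1) * r₀ ≤ 1 / 4 := by
    have h : r₀ ≤ 1 / (4 * (3 * M + 1)) := (min_le_right _ _).trans (min_le_right _ _)
    rw [le_div_iff₀ (by positivity)] at h
    linarith
  -- The summand `a` absorbs the geometric errors and `b` those of the boundary data; their sum
  -- serves as both `C₃` and `C₄`.
  set a : ℝ := 2 * ((m + 1) * (3 * M + 1)) with ha
  set b : ℝ := 2 * (WeakAnchoring.dataConst r₀ Λ M C₀ * (2 * WeakAnchoring.sphereConst (m + 1))
    * Real.exp ((m + 1) * (3 * M + 1))) with hb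
  have ha0 : 0 < a := by positivity
  have hb0 : 0 ≤ b := by
    have := WeakAnchoring.dataConst_nonneg (r₀ := r₀) (Λ := Λ) (M := M) (C := C₀)
    have := WeakAnchoring.sphereConst_nonneg (m + 1)
    positivity
  refine ⟨a + b, a + b, by positivity, by positivity, ?_⟩
  intro g hg K α ε lam hK _ _ hε hε1 hlam u hu x₀ hx₀
  obtain ⟨e, f, U, v₀, rfl, hp⟩ := hP x₀ hx₀ r₀ hr0 (min_le_left _ _)
  have p := hp ε lam C₀ (g ε) u hε (by rw [hlam]; positivity) hu (hg ε hε hε1).1 (hg ε hε hε1).2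
  exact p.monotonicity (by omega) (by linarith) hrM (by linarith) (by linarith)
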